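/- **Setting.** Let $\mathcal C$ be a semisimple abelian balanced rigid braided tensor category over $\mathbb C$ (finite-dimensional Hom spaces, every object a finite direct sum of simple objects, bilinear tensor product, simple unit $\mathbf 1$, universal twist $\theta$). Let $A$ be a rigid commutative associative unital algebra in $\mathcal C$ with $\theta_A=\mathrm{id}$; rigid means that $\dim\mathrm{Hom}(\mathbf 1,A)=1$, the pairing $A\otimes A\to A\to\mathbf 1$ (multiplication followed by the projection splitting the unit $\mathbf 1\to A$) is non-degenerate, and $\dim A\neq0$. Let a finite group $G$ act faithfully on $A$ by algebra automorphisms $\pi_g$ with $A^G=\mathbf 1$. Let $\mathrm{Rep}\,A$ be the category of left $A$-modules in $\mathcal C$; for $X\in\mathrm{Rep}\,A$ and $g\in G$ let $X^g$ be the object $X$ with action $\mu_X\circ(\pi_g\otimes\mathrm{id})$. Let $\mathcal D$ be the category of pairs $(X,\varphi_X)$, where $X\in\mathrm{Rep}\,A$ and $\varphi_X(g)\colon X\to X$, $g\in G$, are morphisms of $\mathcal C$ with $\varphi_X(g)\circ\mu_X=\mu_X\circ(\pi_g\otimes\varphi_X(g))$, $\varphi_X(g)\varphi_X(h)=\varphi_X(gh)$,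 $\varphi_X(1)=\mathrm{id}$; morphisms are the $A$-module morphisms commuting with all $\varphi(g)$. Let $S$ be the set of isomorphism classes of simple $A$-modules, with the $G$-action $g[X]=[X^{g^{-1}}]$. Choose a representative $X_s$ of each $s\in S$ and $A$-module isomorphisms $\varphi_s(g)\colon X_s^{g^{-1}}\to X_{gs}$ for all $g\in G$, $s\in S$. For a $G$-orbit $\mathcal O\subset S$ let $\mathcal F[\mathcal O]$ be the algebra of functions $\mathcal O\to\mathbb C$ and $\mathcal F^*[\mathcal O]$ the group of non-vanishing ones, with $(g\cdot f)(s)=f(g^{-1}s)$. For a 2-cocycle $\alpha$ of $G$ with values in $\mathcal F^*[\mathcal O]$ let $\mathcal A_\alpha(G,\mathcal O)=\bigoplus_{g\in G}\mathcal F[\mathcal O]\,g$ with product $(fg)(f'g')=f\,(g\cdot f')\,\alpha(g,g')\,gg'$. $\mathrm{Rep}$ of an algebra is its category of finite-dimensional modules, and a direct sum of categories consists of families with only finitely many non-zero members. For a finite-dimensional vector space $V$ and $X\in\mathrm{Rep}\,A$, $V\boxtimes X\in\mathrm{Rep}\,A$ is the object with $\mathrm{Hom}_A(V\boxtimes X,Z)=\mathrm{Hom}_{\mathbb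 C}(V,\mathrm{Hom}_A(X,Z))$. **Theorem.** The category $\mathcal D$ is abelian. There is a unique 2-cocycle $\alpha$ of $G$ with values in $\mathcal F^*[S]$ such that $\varphi_{hs}(g)\,\varphi_s(h)=\alpha(g,h)(ghs)\,\varphi_s(gh)$ for all $g,h\in G$, $s\in S$. Its restrictions to the orbits are again denoted $\alpha$, and for $s\in S$ with stabilizer $G_s$ let $\alpha_s(g,h)=\alpha(g,h)(s)$, $g,h\in G_s$. Then: 1. There is an equivalence of ($\mathbb C$-linear) abelian categories $$\mathcal D\simeq\bigoplus_{\mathcal O}\mathrm{Rep}\,\mathcal A_{\alpha^{-1}}(G,\mathcal O),$$ where $\mathcal O$ runs over the $G$-orbits in $S$. It is given by $X\mapsto\big(\bigoplus_{s\in\mathcal O}\mathrm{Hom}_A(X_s,X)\big)_{\mathcal O}$, where $\mathcal F[\mathcal O]$ acts by multiplication on the components and $g\in G$ maps $a\in\mathrm{Hom}_A(X_s,X)$ to $\varphi_X(g)\circ a\circ\varphi_s(g)^{-1}\in\mathrm{Hom}_A(X_{gs},X)$. Its inverse is given by $(V_{\mathcal O})_{\mathcal O}\mapsto\bigoplus_{\mathcal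 O}V_{\mathcal O}\boxtimes_{\mathcal F[\mathcal O]}X_{\mathcal O}=\bigoplus_{s\in S}V_s\boxtimes X_s$, naturally in $(V_{\mathcal O})$, where $X_{\mathcal O}=\bigoplus_{s\in\mathcal O}X_s$ and $V_{\mathcal O}=\bigoplus_{s\in\mathcal O}V_s$ is the decomposition given by the action of $\mathcal F[\mathcal O]$, with $\varphi(g)=\bigoplus_s\varphi_{V_s}(g)\otimes\varphi_s(g)$, $\varphi_{V_s}(g)\colon V_s\to V_{gs}$ being the action of $1\cdot g\in\mathcal A_{\alpha^{-1}}(G,\mathcal O)$. 2. For every set $R\subset S$ of representatives of the $G$-orbits there is an equivalence of ($\mathbb C$-linear) abelian categories $$\mathcal D\simeq\bigoplus_{s\in R}\mathrm{Rep}\,\mathbb C^{\alpha_s^{-1}}[G_s],\qquad X\mapsto\big(\mathrm{Hom}_A(X_s,X)\big)_{s\in R},$$ where $\mathbb C^{\alpha_s^{-1}}[G_s]$ is the twisted group algebra, with basis $G_s$ and product $g\cdot h=\alpha_s(g,h)^{-1}gh$, and $g\in G_s$ acts on $\mathrm{Hom}_A(X_s,X)$ by $a\mapsto\varphi_X(g)\circ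 a\circ\varphi_s(g)^{-1}$. -/

import Mathlib

open CategoryTheory MonoidalCategory Limits

universe v u w

noncomputable section

namespace Orbifold

/-! ### Semisimple balanced rigid braided categories -/

/-- A balancing (universal twist) on a rigid braided category: a natural automorphism `θ` of the
identity functor with `θ_{X ⊗ Y} = c_{Y,X} c_{X,Y} (θ_X ⊗ θ_Y)`, `θ_𝟙 = id`, `θ_{X*} = (θ_X)*`. -/
class BalancedRigid (C : Type u) [Category.{v} C] [MonoidalCategory C] [BraidedCategory C]
    [RigidCategory C] where
  twist : 𝟭 C ≅ 𝟭 C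
  twist_tensor : ∀ X Y : C, twist.hom.app (X ⊗ Y) =
    (twist.hom.app X ⊗ₘ twist.hom.app Y) ≫ (β_ X Y).hom ≫ (β_ Y X).hom
  twist_unit : twist.hom.app (𝟙_ C) = 𝟙 (𝟙_ C)
  twist_dual : ∀ X : C, twist.hom.app (Xᘁ) = rightAdjointMate (twist.hom.app X)

attribute [local instance] Abelian.hasFiniteBiproducts in
/-- A semisimple abelian category over `ℂ`: spaces of morphisms are finite dimensional and every
object is a finite direct sum of simple objects. -/
structure IsSemisimpleCat (C : Type u) [Category.{v} C] [Abelian C] [Linear ℂ C] : Prop where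
  finiteDimensional_hom : ∀ X Y : C, FiniteDimensional ℂ (X ⟶ Y)
  exists_iso_sum : ∀ X : C, ∃ (n : ℕ) (f : Fin n → C),
    (∀ i, Simple (f i)) ∧ Nonempty (X ≅ ⨁ f)

section QuantumDim

variable {C : Type u} [Category.{v} C] [MonoidalCategory C] [BraidedCategory C]
  [RigidCategory C] [BalancedRigid C]

/-- The universal twist `θ_X : X ⟶ X`. -/
def theta (X : C) : X ⟶ X := (BalancedRigid.twist (C := C)).hom.app X

/-- The quantum dimension of `X`, as an endomorphism of the unit object:
`𝟙 ⟶ X ⊗ X* ⟶ X ⊗ X* ⟶ X* ⊗ X ⟶ 𝟙` (coevaluation, twist on `X`, braiding, evaluation). -/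
def qdim (X : C) : 𝟙_ C ⟶ 𝟙_ C :=
  η_ X (Xᘁ) ≫ theta X ▷ (Xᘁ) ≫ (β_ X (Xᘁ)).hom ≫ ε_ X (Xᘁ)

end QuantumDim

/-- Rigidity of an algebra `A` in `C`: `Hom(𝟙, A)` is one dimensional, the pairing
`A ⊗ A ⟶ A ⟶ 𝟙` (multiplication followed by the projection `ε` onto the unit, `ε ∘ ι_A = id`) is
non-degenerate, and the dimension of `A` is nonzero. -/
structure IsRigidAlgebra {C : Type u} [Category.{v} C] [Abelian C] [Linear ℂ C]
    [MonoidalCategory C] [BraidedCategory C] [RigidCategory C] [BalancedRigid C]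
    (A : Mon C) : Prop where
  finrank_unit : Module.finrank ℂ (𝟙_ C ⟶ A.X) = 1
  nondegenerate : ∃ e : A.X ⟶ 𝟙_ C, (MonObj.one : 𝟙_ C ⟶ A.X) ≫ e = 𝟙 (𝟙_ C) ∧
    ∃ p : ExactPairing A.X A.X, p.evaluation' = MonObj.mul ≫ e
  qdim_ne_zero : qdim A.X ≠ 0

/-- The invariants `A^G` of a group acting on the algebra `A` are the unit object: every morphism
to `A` fixed by all `π g` factors uniquely through the unit `𝟙 ⟶ A`. -/
def InvariantsEqUnit {C : Type u} [Category.{v} C] [MonoidalCategory C] {G : Type w} [Group G]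
    {A : Mon C} (π : G →* Aut A) : Prop :=
  ∀ (Z : C) (f : Z ⟶ A.X), (∀ g, f ≫ (π g).hom.hom = f) → ∃! h : Z ⟶ 𝟙_ C, h ≫ MonObj.one = f

/-! ### The linear category `Rep A` of modules over an algebra -/

section ModLinear

variable {C : Type u} [Category.{v} C] [MonoidalCategory C] {A : C} [MonObj A]

/-- The action morphism `A ⊗ M ⟶ M` of an `A`-module. -/
abbrev act (M : Mod C A) : A ⊗ M.X ⟶ M.X := ModObj.smul (M := A) (X := M.X)

lemma act_hom {M N : Mod C A} (f : M ⟶ N) : act M ≫ f.hom = A ◁ f.hom ≫ act N :=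
  IsModHom.smul_hom (A := A) (f := f.hom)

/-- Constructor for morphisms of `A`-modules. -/
def mkHom {M N : Mod C A} (f : M.X ⟶ N.X)
    (h : act M ≫ f = A ◁ f ≫ act N) : M ⟶ N :=
  Mod.Hom.mk' f h

@[simp]
lemma mkHom_hom {M N : Mod C A} (f : M.X ⟶ N.X)
    (h : act M ≫ f = A ◁ f ≫ act N) :
    (mkHom f h).hom = f := rfl

lemma hom_injective {M N : Mod C A} :
    Function.Injective (fun f : M ⟶ N => (f.hom : M.X ⟶ N.X)) :=
  fun _ _ h => Mod.hom_ext _ _ h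

variable [Preadditive C] [MonoidalPreadditive C]

instance {M N : Mod C A} : Zero (M ⟶ N) := ⟨mkHom 0 (by simp)⟩
instance {M N : Mod C A} : Add (M ⟶ N) :=
  ⟨fun f g => mkHom (f.hom + g.hom) (by simp)⟩
instance {M N : Mod C A} : Neg (M ⟶ N) :=
  ⟨fun f => mkHom (-f.hom) (by
    have : A ◁ (-f.hom) = -(A ◁ f.hom) := (tensorLeft A).map_neg
    rw [this, Preadditive.comp_neg, act_hom, Preadditive.neg_comp])⟩
instance {M N : Mod C A} : Sub (M ⟶ N) :=
  ⟨fun f g => mkHom (f.hom - g.hom) (by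
    have : A ◁ (f.hom - g.hom) = A ◁ f.hom - A ◁ g.hom := (tensorLeft A).map_sub
    rw [this, Preadditive.comp_sub, act_hom, act_hom, Preadditive.sub_comp])⟩
instance {M N : Mod C A} : SMul ℕ (M ⟶ N) :=
  ⟨fun n f => mkHom (n • f.hom) (by
    have : A ◁ (n • f.hom) = n • (A ◁ f.hom) := (tensorLeft A).map_nsmul
    rw [this, Preadditive.comp_nsmul, act_hom, Preadditive.nsmul_comp])⟩
instance {M N : Mod C A} : SMul ℤ (M ⟶ N) :=
  ⟨fun n f => mkHom (n • f.hom) (by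
    have : A ◁ (n • f.hom) = n • (A ◁ f.hom) := (tensorLeft A).map_zsmul
    rw [this, Preadditive.comp_zsmul, act_hom, Preadditive.zsmul_comp])⟩

instance {M N : Mod C A} : AddCommGroup (M ⟶ N) :=
  Function.Injective.addCommGroup _ hom_injective rfl (fun _ _ => rfl) (fun _ => rfl)
    (fun _ _ => rfl) (fun _ _ => rfl) (fun _ _ => rfl)

@[simp] lemma add_hom {M N : Mod C A} (f g : M ⟶ N) : (f + g).hom = f.hom + g.hom := rfl
@[simp] lemma zero_hom {M N : Mod C A} : (0 : M ⟶ N).hom = 0 := rfl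

instance : Preadditive (Mod C A) where
  add_comp _ _ _ _ _ _ := by ext; simp
  comp_add _ _ _ _ _ _ := by ext; simp

/-- The underlying `C`-morphism, as an additive map. -/
def homAddHom (M N : Mod C A) : (M ⟶ N) →+ (M.X ⟶ N.X) where
  toFun f := f.hom
  map_zero' := rfl
  map_add' _ _ := rfl

variable [Linear ℂ C] [MonoidalLinear ℂ C]

instance {M N : Mod C A} : SMul ℂ (M ⟶ N) :=
  ⟨fun c f => mkHom (c • f.hom) (by simp)⟩

@[simp] lemma smul_hom {M N : Mod C A} (c : ℂ) (f : M ⟶ N) : (c • f).hom = c • f.hom := rfl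

instance {M N : Mod C A} : Module ℂ (M ⟶ N) :=
  Function.Injective.module ℂ (homAddHom M N) hom_injective (fun _ _ => rfl)

instance : Linear ℂ (Mod C A) where
  smul_comp _ _ _ _ _ _ := by ext; simp
  comp_smul _ _ _ _ _ _ := by ext; simp

end ModLinear

/-! ### The action of `G` on `Rep A` and the category `D` -/

section Action

variable {C : Type u} [Category.{v} C] [MonoidalCategory C] {G : Type w} [Group G] {A : Mon C}

/-- The module `M^g`: the same object of `C`, with action `A ⊗ M ⟶ A ⊗ M ⟶ M` twisted by `π g`. -/
def twistBy (π : G →* Aut A) (g : G) : Mod C A.X ⥤ Mod C A.X := Mod.comap (π g).hom.hom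

lemma twistBy_smul (π : G →* Aut A) (g : G) (M : Mod C A.X) :
    act ((twistBy π g).obj M) = (π g).hom.hom ▷ M.X ≫ act M := rfl

/-- The functor `Π_g : M ↦ M^{g⁻¹}`. -/
def piFun (π : G →* Aut A) (g : G) : Mod C A.X ⥤ Mod C A.X := twistBy π g⁻¹

lemma aut_mul_hom (π : G →* Aut A) (g h : G) :
    (π (g * h)).hom.hom = (π h).hom.hom ≫ (π g).hom.hom := by
  rw [map_mul]; rfl

lemma aut_one_hom (π : G →* Aut A) : (π 1).hom.hom = 𝟙 A.X := by
  rw [map_one]; rfl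

/-- Isomorphisms of modules from isomorphisms of the underlying objects. -/
def mkIso {A : C} [MonObj A] {M N : Mod C A} (e : M.X ≅ N.X)
    (h : act M ≫ e.hom = A ◁ e.hom ≫ act N) : M ≅ N where
  hom := mkHom e.hom h
  inv := mkHom e.inv (by
    rw [← cancel_mono e.hom, Category.assoc, Category.assoc, Iso.inv_hom_id, h,
      ← whiskerLeft_comp_assoc]
    simp)
  hom_inv_id := by ext; simp
  inv_hom_id := by ext; simp

/-- `Π_g Π_h = Π_{gh}`, given by the identity of the underlying object. -/
def piComp (π : G →* Aut A) (g h : G) : piFun π h ⋙ piFun π g ≅ piFun π (g * h) :=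
  NatIso.ofComponents (fun M => mkIso (Iso.refl M.X) (by
    change ((π g⁻¹).hom.hom ▷ M.X ≫ (π h⁻¹).hom.hom ▷ M.X ≫ act M) ≫ 𝟙 M.X =
      A.X ◁ 𝟙 M.X ≫ (π (g * h)⁻¹).hom.hom ▷ M.X ≫ act M
    rw [mul_inv_rev, aut_mul_hom, comp_whiskerRight]
    simp))
    (fun {M N} f => by
      ext
      change f.hom ≫ 𝟙 N.X = 𝟙 M.X ≫ f.hom
      simp)

/-- `Π_1 = id`, given by the identity of the underlying object. -/
def piOne (π : G →* Aut A) : piFun π 1 ≅ 𝟭 (Mod C A.X) :=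
  NatIso.ofComponents (fun M => mkIso (Iso.refl M.X) (by
    change ((π 1⁻¹).hom.hom ▷ M.X ≫ act M) ≫ 𝟙 M.X = A.X ◁ 𝟙 M.X ≫ act M
    rw [inv_one, aut_one_hom]
    simp))
    (fun {M N} f => by
      ext
      change f.hom ≫ 𝟙 N.X = 𝟙 M.X ≫ f.hom
      simp)

/-- `Π_g` is an equivalence with inverse `Π_{g⁻¹}`. -/
def piEquiv (π : G →* Aut A) (g : G) : Mod C A.X ≌ Mod C A.X :=
  CategoryTheory.Equivalence.mk (piFun π g) (piFun π g⁻¹)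
    ((piOne π).symm ≪≫ eqToIso (by rw [inv_mul_cancel]) ≪≫ (piComp π g⁻¹ g).symm)
    (piComp π g g⁻¹ ≪≫ eqToIso (by rw [mul_inv_cancel]) ≪≫ piOne π)

variable [Preadditive C] [MonoidalPreadditive C]

lemma simple_piFun (π : G →* Aut A) (g : G) (M : Mod C A.X) (hM : Simple M) :
    Simple ((piFun π g).obj M) := by
  have : (piFun π g).IsEquivalence := (piEquiv π g).isEquivalence_functor
  exact simple_obj (piFun π g) M

/-- The set `S` of isomorphism classes of simple `A`-modules. (The action `π`, on which this set
does not depend, is recorded so that `G` acts on it.) -/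
def SimpleClass (_π : G →* Aut A) : Type (max u v) :=
  {c : Quotient (isIsomorphicSetoid (Mod C A.X)) //
    ∃ M : Mod C A.X, Simple M ∧ Quotient.mk (isIsomorphicSetoid (Mod C A.X)) M = c}

/-- The map induced by `Π_g` on isomorphism classes of modules. -/
def piClass (π : G →* Aut A) (g : G) :
    Quotient (isIsomorphicSetoid (Mod C A.X)) → Quotient (isIsomorphicSetoid (Mod C A.X)) :=
  Quotient.map' (piFun π g).obj (fun _ _ ⟨e⟩ => ⟨(piFun π g).mapIso e⟩)

/-- `G` acts on `S` by `g [M] = [M^{g⁻¹}]`. -/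
instance (π : G →* Aut A) : MulAction G (SimpleClass π) where
  smul g s := ⟨piClass π g s.1, by
    obtain ⟨M, hM, h⟩ := s.2
    exact ⟨(piFun π g).obj M, simple_piFun π g M hM, by rw [← h]; rfl⟩⟩
  one_smul s := by
    obtain ⟨_, M, hM, rfl⟩ := s
    exact Subtype.ext (Quotient.sound ⟨(piOne π).app M⟩)
  mul_smul g h s := by
    obtain ⟨_, M, hM, rfl⟩ := s
    exact Subtype.ext (Quotient.sound ⟨((piComp π g h).app M).symm⟩)

end Action

/-- An object of `D`: an `A`-module `M` with `C`-endomorphisms `φ g`, `g ∈ G`, of the underlying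
object such that `φ g ∘ μ_M = μ_M ∘ (π g ⊗ φ g)`, `φ (g h) = φ g ∘ φ h` and `φ 1 = id`. -/
structure EquivMod {C : Type u} [Category.{v} C] [MonoidalCategory C] {G : Type w} [Group G]
    {A : Mon C} (π : G →* Aut A) where
  M : Mod C A.X
  φ : G → (M.X ⟶ M.X)
  act_φ : ∀ g, act M ≫ φ g = ((π g).hom.hom ⊗ₘ φ g) ≫ act M
  φ_mul : ∀ g h, φ (g * h) = φ h ≫ φ g
  φ_one : φ 1 = 𝟙 M.X

namespace EquivMod

variable {C : Type u} [Category.{v} C] [MonoidalCategory C] {G : Type w} [Group G] {A : Mon C}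
  {π : G →* Aut A}

/-- Morphisms in `D` are morphisms of `A`-modules commuting with all `φ g`. -/
@[ext]
structure Hom (X Y : EquivMod π) where
  hom : X.M ⟶ Y.M
  comm : ∀ g, X.φ g ≫ hom.hom = hom.hom ≫ Y.φ g

instance : Category (EquivMod π) where
  Hom X Y := Hom X Y
  id X := ⟨𝟙 X.M, fun g => by simp⟩
  comp f g := ⟨f.hom ≫ g.hom, fun k => by
    rw [Mod.comp_hom', ← Category.assoc, f.comm, Category.assoc, g.comm, Category.assoc]⟩

@[ext]
lemma hom_ext {X Y : EquivMod π} (f g : X ⟶ Y) (h : f.hom = g.hom) : f = g := Hom.ext h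

@[simp] lemma id_hom (X : EquivMod π) : (𝟙 X : X ⟶ X).hom = 𝟙 X.M := rfl
@[simp] lemma comp_hom {X Y Z : EquivMod π} (f : X ⟶ Y) (g : Y ⟶ Z) :
    (f ≫ g).hom = f.hom ≫ g.hom := rfl

lemma hom_injective {X Y : EquivMod π} :
    Function.Injective (fun f : X ⟶ Y => (f.hom : X.M ⟶ Y.M)) :=
  fun _ _ h => hom_ext _ _ h

/-- `φ g`, as a morphism of `A`-modules `M^{g⁻¹} ⟶ M`. -/
def φHom (X : EquivMod π) (g : G) : (piFun π g).obj X.M ⟶ X.M :=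
  mkHom (X.φ g) (by
    change ((π g⁻¹).hom.hom ▷ X.M.X ≫ act X.M) ≫ X.φ g = A.X ◁ X.φ g ≫ act X.M
    rw [Category.assoc, X.act_φ, MonoidalCategory.tensorHom_def, Category.assoc, ← comp_whiskerRight_assoc,
      ← aut_mul_hom, mul_inv_cancel, aut_one_hom]
    simp)

section Linear

variable [Preadditive C] [MonoidalPreadditive C]

instance {X Y : EquivMod π} : Zero (X ⟶ Y) := ⟨⟨0, fun g => by simp⟩⟩
instance {X Y : EquivMod π} : Add (X ⟶ Y) :=
  ⟨fun f g => ⟨f.hom + g.hom, fun k => by simp [f.comm, g.comm]⟩⟩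
instance {X Y : EquivMod π} : Neg (X ⟶ Y) :=
  ⟨fun f => ⟨-f.hom, fun k => by
    change X.φ k ≫ (-f.hom.hom) = (-f.hom.hom) ≫ Y.φ k
    simp [f.comm]⟩⟩
instance {X Y : EquivMod π} : Sub (X ⟶ Y) :=
  ⟨fun f g => ⟨f.hom - g.hom, fun k => by
    change X.φ k ≫ (f.hom.hom - g.hom.hom) = (f.hom.hom - g.hom.hom) ≫ Y.φ k
    simp [f.comm, g.comm]⟩⟩
instance {X Y : EquivMod π} : SMul ℕ (X ⟶ Y) :=
  ⟨fun n f => ⟨n • f.hom, fun k => by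
    change X.φ k ≫ (n • f.hom.hom) = (n • f.hom.hom) ≫ Y.φ k
    simp [f.comm]⟩⟩
instance {X Y : EquivMod π} : SMul ℤ (X ⟶ Y) :=
  ⟨fun n f => ⟨n • f.hom, fun k => by
    change X.φ k ≫ (n • f.hom.hom) = (n • f.hom.hom) ≫ Y.φ k
    simp [f.comm]⟩⟩

instance {X Y : EquivMod π} : AddCommGroup (X ⟶ Y) :=
  Function.Injective.addCommGroup _ hom_injective rfl (fun _ _ => rfl) (fun _ => rfl)
    (fun _ _ => rfl) (fun _ _ => rfl) (fun _ _ => rfl)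

@[simp] lemma add_hom {X Y : EquivMod π} (f g : X ⟶ Y) : (f + g).hom = f.hom + g.hom := rfl

instance : Preadditive (EquivMod π) where
  add_comp _ _ _ _ _ _ := by ext; simp
  comp_add _ _ _ _ _ _ := by ext; simp

/-- The underlying morphism of modules, as an additive map. -/
def homAddHom (X Y : EquivMod π) : (X ⟶ Y) →+ (X.M ⟶ Y.M) where
  toFun f := f.hom
  map_zero' := rfl
  map_add' _ _ := rfl

variable [Linear ℂ C] [MonoidalLinear ℂ C]

instance {X Y : EquivMod π} : SMul ℂ (X ⟶ Y) :=
  ⟨fun c f => ⟨c • f.hom, fun k => by simp [f.comm]⟩⟩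

@[simp] lemma smul_hom {X Y : EquivMod π} (c : ℂ) (f : X ⟶ Y) : (c • f).hom = c • f.hom := rfl

instance {X Y : EquivMod π} : Module ℂ (X ⟶ Y) :=
  Function.Injective.module ℂ (homAddHom X Y) hom_injective (fun _ _ => rfl)

instance : Linear ℂ (EquivMod π) where
  smul_comp _ _ _ _ _ _ := by ext; simp
  comp_smul _ _ _ _ _ _ := by ext; simp

end Linear

end EquivMod

/-! ### Cocycles and twisted algebras -/

/-- A 2-cocycle of `G` with values in the group `F*[T]` of non-vanishing functions on the `G`-set
`T`, on which `G` acts by `(g · f) t = f (g⁻¹ t)`. -/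
@[ext]
structure Cocycle (G : Type*) (T : Type*) [Group G] [MulAction G T] where
  toFun : G → G → T → ℂˣ
  cocycle : ∀ g h k t,
    toFun h k (g⁻¹ • t) * toFun g (h * k) t = toFun g h t * toFun (g * h) k t

/-- A 2-cocycle of `H` with values in `ℂˣ`, with trivial action. -/
@[ext]
structure ScalarCocycle (H : Type*) [Group H] where
  toFun : H → H → ℂˣ
  cocycle : ∀ g h k, toFun h k * toFun g (h * k) = toFun g h * toFun (g * h) k

namespace Cocycle

variable {G : Type*} {T : Type*} [Group G] [MulAction G T] (α : Cocycle G T)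

/-- The inverse cocycle `α⁻¹`. -/
def inv : Cocycle G T where
  toFun g h t := (α.toFun g h t)⁻¹
  cocycle g h k t := by rw [← mul_inv, ← mul_inv, α.cocycle]

/-- The restriction of `α` to an orbit. -/
def onOrbit (o : MulAction.orbitRel.Quotient G T) : Cocycle G o.orbit where
  toFun g h t := α.toFun g h t
  cocycle g h k t := α.cocycle g h k t

/-- The cocycle `α_s` of the stabilizer of `s`, `α_s(g, h) = α(g, h)(s)`. -/
def atPoint (s : T) : ScalarCocycle (MulAction.stabilizer G s) where
  toFun g h := α.toFun g h s
  cocycle g h k := by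
    have := α.cocycle (g : G) h k s
    rwa [show (g : G)⁻¹ • s = s from (g⁻¹).2] at this

lemma one_left (k : G) (t : T) : α.toFun 1 k t = α.toFun 1 1 t := by
  have := α.cocycle 1 1 k t
  simp only [inv_one, one_smul, one_mul] at this
  exact mul_right_cancel this

lemma one_right (g : G) (t : T) : α.toFun g 1 t = α.toFun 1 1 (g⁻¹ • t) := by
  have := α.cocycle g 1 1 t
  simp only [mul_one] at this
  exact (mul_right_cancel this).symm

end Cocycle

namespace ScalarCocycle

variable {H : Type*} [Group H] (α : ScalarCocycle H)

/-- The inverse cocycle. -/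
def inv : ScalarCocycle H where
  toFun g h := (α.toFun g h)⁻¹
  cocycle g h k := by rw [← mul_inv, ← mul_inv, α.cocycle]

lemma one_left (k : H) : α.toFun 1 k = α.toFun 1 1 := by
  have := α.cocycle 1 1 k
  simp only [one_mul] at this
  exact mul_right_cancel this

lemma one_right (g : H) : α.toFun g 1 = α.toFun 1 1 := by
  have := α.cocycle g 1 1
  simp only [mul_one] at this
  exact (mul_right_cancel this).symm

end ScalarCocycle

section TwistedAlgebra

attribute [local instance] Fintype.ofFinite

variable {G : Type*} {T : Type*} [Group G] [MulAction G T]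

/-- The twisted algebra `A_α(G, T) = ⨁_{g ∈ G} F[T] g`, where `F[T]` is the algebra of functions
`T → ℂ`, with product `(f g) (f' g') = f · (g · f') · α(g, g') g g'`. The element `∑_g a_g g` has
coefficients `g ↦ a_g`. -/
@[ext]
structure TwistedAlg (α : Cocycle G T) where
  coeff : G → T → ℂ

namespace TwistedAlg

variable {α : Cocycle G T}

lemma coeff_injective : Function.Injective (coeff (α := α)) := fun _ _ h => TwistedAlg.ext h

instance : Zero (TwistedAlg α) := ⟨⟨0⟩⟩
instance : Add (TwistedAlg α) := ⟨fun a b => ⟨a.coeff + b.coeff⟩⟩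
instance : Neg (TwistedAlg α) := ⟨fun a => ⟨-a.coeff⟩⟩
instance : Sub (TwistedAlg α) := ⟨fun a b => ⟨a.coeff - b.coeff⟩⟩
instance : SMul ℕ (TwistedAlg α) := ⟨fun n a => ⟨n • a.coeff⟩⟩
instance : SMul ℤ (TwistedAlg α) := ⟨fun n a => ⟨n • a.coeff⟩⟩
instance : SMul ℂ (TwistedAlg α) := ⟨fun c a => ⟨c • a.coeff⟩⟩

instance : AddCommGroup (TwistedAlg α) :=
  coeff_injective.addCommGroup _ rfl (fun _ _ => rfl) (fun _ => rfl) (fun _ _ => rfl)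
    (fun _ _ => rfl) (fun _ _ => rfl)

instance : Module ℂ (TwistedAlg α) :=
  coeff_injective.module ℂ
    ({ toFun := coeff, map_zero' := rfl, map_add' := fun _ _ => rfl } :
      TwistedAlg α →+ (G → T → ℂ)) (fun _ _ => rfl)

@[simp] lemma add_coeff (a b : TwistedAlg α) (g : G) (t : T) :
    (a + b).coeff g t = a.coeff g t + b.coeff g t := rfl
@[simp] lemma zero_coeff (g : G) (t : T) : (0 : TwistedAlg α).coeff g t = 0 := rfl
@[simp] lemma smul_coeff (c : ℂ) (a : TwistedAlg α) (g : G) (t : T) :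
    (c • a).coeff g t = c * a.coeff g t := rfl

open scoped Classical in
/-- The element `u_g = 1 · g`. -/
def u (α : Cocycle G T) (g : G) : TwistedAlg α := ⟨fun k _ => if k = g then 1 else 0⟩

open scoped Classical in
/-- The embedding `F[T] ⊆ A_α(G, T)`. (As `α` need not be normalized, the unit of the algebra is
`α(1,1)⁻¹ · 1`.) -/
def ofFun (α : Cocycle G T) (f : T → ℂ) : TwistedAlg α :=
  ⟨fun k t => if k = 1 then f t * ((α.toFun 1 1 t)⁻¹ : ℂˣ) else 0⟩

open scoped Classical in
/-- The delta function `δ_s ∈ F[T] ⊆ A_α(G, T)`. -/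
def delta (α : Cocycle G T) (s : T) : TwistedAlg α := ofFun α (fun t => if t = s then 1 else 0)

instance : One (TwistedAlg α) := ⟨ofFun α 1⟩

lemma one_def : (1 : TwistedAlg α) = ofFun α 1 := rfl

variable [Finite G]

instance : Mul (TwistedAlg α) :=
  ⟨fun a b => ⟨fun k t =>
    ∑ g, a.coeff g t * b.coeff (g⁻¹ * k) (g⁻¹ • t) * α.toFun g (g⁻¹ * k) t⟩⟩

lemma mul_coeff (a b : TwistedAlg α) (k : G) (t : T) : (a * b).coeff k t =
    ∑ g, a.coeff g t * b.coeff (g⁻¹ * k) (g⁻¹ • t) * α.toFun g (g⁻¹ * k) t := rfl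

lemma ofFun_mul_coeff (f : T → ℂ) (b : TwistedAlg α) (k : G) (t : T) :
    (ofFun α f * b).coeff k t = f t * b.coeff k t := by
  rw [mul_coeff, Finset.sum_eq_single 1]
  · simp [ofFun, α.one_left k]
    field_simp
  · intro g _ hg
    simp [ofFun, hg]
  · simp

lemma mul_ofFun_coeff (f : T → ℂ) (a : TwistedAlg α) (k : G) (t : T) :
    (a * ofFun α f).coeff k t = a.coeff k t * f (k⁻¹ • t) := by
  rw [mul_coeff, Finset.sum_eq_single k]
  · simp [ofFun, α.one_right k]
    field_simp
  · intro g _ hg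
    have : g⁻¹ * k ≠ 1 := fun h => hg (inv_mul_eq_one.mp h)
    simp [ofFun, this]
  · simp

lemma assoc' (a b c : TwistedAlg α) : a * b * c = a * (b * c) := by
  ext k t
  simp only [mul_coeff, Finset.sum_mul, Finset.mul_sum]
  rw [Finset.sum_comm]
  refine Finset.sum_congr rfl fun g _ => ?_
  refine Fintype.sum_equiv (Equiv.mulLeft g⁻¹) _ _ fun m => ?_
  have := congrArg (Units.val) (α.cocycle g (g⁻¹ * m) (m⁻¹ * k) t)
  simp only [Units.val_mul, mul_assoc, mul_inv_cancel_left] at this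
  simp only [Equiv.coe_mulLeft, mul_inv_rev, inv_inv, mul_assoc, mul_inv_cancel_left, mul_smul,
    smul_inv_smul]
  linear_combination (-1 : ℂ) * a.coeff g t * b.coeff (g⁻¹ * m) (g⁻¹ • t) *
    c.coeff (m⁻¹ * k) (m⁻¹ • t) * this

instance : Ring (TwistedAlg α) where
  __ := (inferInstance : AddCommGroup (TwistedAlg α))
  mul := (· * ·)
  one := 1
  left_distrib a b c := by ext; simp [mul_coeff, mul_add, add_mul, Finset.sum_add_distrib]
  right_distrib a b c := by ext; simp [mul_coeff, add_mul, Finset.sum_add_distrib]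
  zero_mul a := by ext; simp [mul_coeff]
  mul_zero a := by ext; simp [mul_coeff]
  mul_assoc := assoc'
  one_mul a := by ext; exact (ofFun_mul_coeff _ _ _ _).trans (by simp)
  mul_one a := by ext; exact (mul_ofFun_coeff _ _ _ _).trans (by simp)

instance : Algebra ℂ (TwistedAlg α) :=
  Algebra.ofModule
    (fun c a b => by ext; simp [mul_coeff, Finset.mul_sum, mul_assoc])
    (fun c a b => by
      ext
      simp only [mul_coeff, smul_coeff, Finset.mul_sum]
      exact Finset.sum_congr rfl fun _ _ => by ring)

/-- `u_g δ_s = δ_{gs} u_g`. -/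
lemma u_mul_delta (g : G) (s : T) : u α g * delta α s = delta α (g • s) * u α g := by
  ext k t
  rw [delta, delta, mul_ofFun_coeff, ofFun_mul_coeff]
  by_cases h : k = g
  · subst h
    by_cases h : t = k • s
    · simp [u, h]
    · simp [u, h, inv_smul_eq_iff]
  · simp [u, h]

end TwistedAlg

end TwistedAlgebra

section TwistedGroupAlgebra

attribute [local instance] Fintype.ofFinite

variable {H : Type*} [Group H]

/-- The twisted group algebra `ℂ^α[H]`, with basis `H` and product `g · h = α(g, h) gh`. -/
@[ext]
structure TwistedGroupAlg (α : ScalarCocycle H) where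
  coeff : H → ℂ

namespace TwistedGroupAlg

variable {α : ScalarCocycle H}

lemma coeff_injective : Function.Injective (coeff (α := α)) := fun _ _ h => TwistedGroupAlg.ext h

instance : Zero (TwistedGroupAlg α) := ⟨⟨0⟩⟩
instance : Add (TwistedGroupAlg α) := ⟨fun a b => ⟨a.coeff + b.coeff⟩⟩
instance : Neg (TwistedGroupAlg α) := ⟨fun a => ⟨-a.coeff⟩⟩
instance : Sub (TwistedGroupAlg α) := ⟨fun a b => ⟨a.coeff - b.coeff⟩⟩
instance : SMul ℕ (TwistedGroupAlg α) := ⟨fun n a => ⟨n • a.coeff⟩⟩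
instance : SMul ℤ (TwistedGroupAlg α) := ⟨fun n a => ⟨n • a.coeff⟩⟩
instance : SMul ℂ (TwistedGroupAlg α) := ⟨fun c a => ⟨c • a.coeff⟩⟩

instance : AddCommGroup (TwistedGroupAlg α) :=
  coeff_injective.addCommGroup _ rfl (fun _ _ => rfl) (fun _ => rfl) (fun _ _ => rfl)
    (fun _ _ => rfl) (fun _ _ => rfl)

instance : Module ℂ (TwistedGroupAlg α) :=
  coeff_injective.module ℂ
    ({ toFun := coeff, map_zero' := rfl, map_add' := fun _ _ => rfl } :
      TwistedGroupAlg α →+ (H → ℂ)) (fun _ _ => rfl)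

@[simp] lemma add_coeff (a b : TwistedGroupAlg α) (g : H) :
    (a + b).coeff g = a.coeff g + b.coeff g := rfl
@[simp] lemma zero_coeff (g : H) : (0 : TwistedGroupAlg α).coeff g = 0 := rfl
@[simp] lemma smul_coeff (c : ℂ) (a : TwistedGroupAlg α) (g : H) :
    (c • a).coeff g = c * a.coeff g := rfl

open scoped Classical in
/-- The unit `α(1,1)⁻¹ · 1`. -/
instance : One (TwistedGroupAlg α) :=
  ⟨⟨fun k => if k = 1 then ((α.toFun 1 1)⁻¹ : ℂˣ) else 0⟩⟩

open scoped Classical in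
lemma one_coeff (k : H) :
    (1 : TwistedGroupAlg α).coeff k = if k = 1 then (((α.toFun 1 1)⁻¹ : ℂˣ) : ℂ) else 0 := rfl

variable [Finite H]

instance : Mul (TwistedGroupAlg α) :=
  ⟨fun a b => ⟨fun k => ∑ g, a.coeff g * b.coeff (g⁻¹ * k) * α.toFun g (g⁻¹ * k)⟩⟩

lemma mul_coeff (a b : TwistedGroupAlg α) (k : H) :
    (a * b).coeff k = ∑ g, a.coeff g * b.coeff (g⁻¹ * k) * α.toFun g (g⁻¹ * k) := rfl

lemma assoc' (a b c : TwistedGroupAlg α) : a * b * c = a * (b * c) := by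
  ext k
  simp only [mul_coeff, Finset.sum_mul, Finset.mul_sum]
  rw [Finset.sum_comm]
  refine Finset.sum_congr rfl fun g _ => ?_
  refine Fintype.sum_equiv (Equiv.mulLeft g⁻¹) _ _ fun m => ?_
  have := congrArg (Units.val) (α.cocycle g (g⁻¹ * m) (m⁻¹ * k))
  simp only [Units.val_mul, mul_assoc, mul_inv_cancel_left] at this
  simp only [Equiv.coe_mulLeft, mul_inv_rev, inv_inv, mul_assoc, mul_inv_cancel_left]
  linear_combination (-1 : ℂ) * a.coeff g * b.coeff (g⁻¹ * m) * c.coeff (m⁻¹ * k) * this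

lemma one_mul' (a : TwistedGroupAlg α) : 1 * a = a := by
  ext k
  rw [mul_coeff, Finset.sum_eq_single 1]
  · simp [one_coeff, α.one_left k]
    field_simp
  · intro g _ hg
    simp [one_coeff, hg]
  · simp

lemma mul_one' (a : TwistedGroupAlg α) : a * 1 = a := by
  ext k
  rw [mul_coeff, Finset.sum_eq_single k]
  · simp [one_coeff, α.one_right k]
  · intro g _ hg
    have : g⁻¹ * k ≠ 1 := fun h => hg (inv_mul_eq_one.mp h)
    simp [one_coeff, this]
  · simp

instance : Ring (TwistedGroupAlg α) where
  __ := (inferInstance : AddCommGroup (TwistedGroupAlg α))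
  mul := (· * ·)
  one := 1
  left_distrib a b c := by ext; simp [mul_coeff, mul_add, add_mul, Finset.sum_add_distrib]
  right_distrib a b c := by ext; simp [mul_coeff, add_mul, Finset.sum_add_distrib]
  zero_mul a := by ext; simp [mul_coeff]
  mul_zero a := by ext; simp [mul_coeff]
  mul_assoc := assoc'
  one_mul := one_mul'
  mul_one := mul_one'

instance : Algebra ℂ (TwistedGroupAlg α) :=
  Algebra.ofModule
    (fun c a b => by ext; simp [mul_coeff, Finset.mul_sum, mul_assoc])
    (fun c a b => by
      ext
      simp only [mul_coeff, smul_coeff, Finset.mul_sum]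
      exact Finset.sum_congr rfl fun _ _ => by ring)

end TwistedGroupAlg

end TwistedGroupAlgebra

/-! ### Direct sums of categories of representations -/

section DirectSum

instance {ι : Type*} {D : ι → Type*} [∀ i, Category (D i)] [∀ i, Preadditive (D i)] :
    Preadditive (∀ i, D i) where
  homGroup X Y := inferInstanceAs (AddCommGroup (∀ i, X i ⟶ Y i))
  add_comp _ _ _ _ _ _ := funext fun _ => Preadditive.add_comp _ _ _ _ _ _
  comp_add _ _ _ _ _ _ := funext fun _ => Preadditive.comp_add _ _ _ _ _ _

instance {ι : Type*} {D : ι → Type*} [∀ i, Category (D i)] [∀ i, Preadditive (D i)]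
    [∀ i, Linear ℂ (D i)] : Linear ℂ (∀ i, D i) where
  homModule X Y := inferInstanceAs (Module ℂ (∀ i, X i ⟶ Y i))
  smul_comp _ _ _ _ _ _ := funext fun _ => Linear.smul_comp _ _ _ _ _ _
  comp_smul _ _ _ _ _ _ := funext fun _ => Linear.comp_smul _ _ _ _ _ _

open scoped ModuleCat in
/-- Families of finite dimensional representations, all but finitely many of which are zero. -/
def isDirectSum {ι : Type*} (R : ι → Type*) [∀ i, Ring (R i)] [∀ i, Algebra ℂ (R i)] :
    ObjectProperty (∀ i, ModuleCat.{w} (R i)) :=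
  fun V => (∀ i, FiniteDimensional ℂ (V i)) ∧ {i | Nontrivial (V i)}.Finite

/-- The direct sum `⨁_i Rep R_i` of the categories of finite dimensional representations of the
algebras `R i`. -/
abbrev RepSum {ι : Type*} (R : ι → Type*) [∀ i, Ring (R i)] [∀ i, Algebra ℂ (R i)] :=
  (isDirectSum.{w} R).FullSubcategory

end DirectSum

/-! ### Projective action on the simple modules -/

section Functors

attribute [local instance] Fintype.ofFinite

variable {C : Type u} [Category.{v} C] [MonoidalCategory C] [Preadditive C]
  [MonoidalPreadditive C] {G : Type w} [Group G] {A : Mon C}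

/-- A choice of a representative `X_s` of every isomorphism class `s ∈ S` of simple `A`-modules,
and of isomorphisms of `A`-modules `φ_s(g) : X_s^{g⁻¹} ≅ X_{gs}`. -/
structure Choice (π : G →* Aut A) where
  X : SimpleClass π → Mod C A.X
  mk_X : ∀ s, Quotient.mk (isIsomorphicSetoid (Mod C A.X)) (X s) = s.1
  φ : ∀ (g : G) (s : SimpleClass π), (piFun π g).obj (X s) ≅ X (g • s)

namespace Choice

lemma nonempty (π : G →* Aut A) : Nonempty (Choice π) := by
  refine ⟨⟨fun s => s.1.out, fun s => s.1.out_eq, fun g s => Classical.choice ?_⟩⟩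
  apply Quotient.exact (s := isIsomorphicSetoid (Mod C A.X))
  rw [Quotient.out_eq]
  change piClass π g (Quotient.mk _ s.1.out) = (g • s).1
  rw [Quotient.out_eq]
  rfl

variable {π : G →* Aut A} (c : Choice π)

/-- `φ_s(g)`, with target `X_t` for any `t` equal to `gs`. -/
def iso (g : G) {s t : SimpleClass π} (h : g • s = t) : (piFun π g).obj (c.X s) ≅ c.X t :=
  c.φ g s ≪≫ eqToIso (congrArg c.X h)

/-- The `C`-morphism underlying `φ_s(g)`. -/
def f (g : G) {s t : SimpleClass π} (h : g • s = t) : (c.X s).X ⟶ (c.X t).X :=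
  (c.iso g h).hom.hom

/-- The inverse of `c.f`. -/
def finv (g : G) {s t : SimpleClass π} (h : g • s = t) : (c.X t).X ⟶ (c.X s).X :=
  (c.iso g h).inv.hom

lemma f_finv (g : G) {s t : SimpleClass π} (h : g • s = t) : c.f g h ≫ c.finv g h = 𝟙 _ :=
  congrArg Mod.Hom.hom (c.iso g h).hom_inv_id

lemma finv_f (g : G) {s t : SimpleClass π} (h : g • s = t) : c.finv g h ≫ c.f g h = 𝟙 _ :=
  congrArg Mod.Hom.hom (c.iso g h).inv_hom_id

lemma f_cancel (g : G) {s t : SimpleClass π} (h : g • s = t) {Z : C} {a b : (c.X t).X ⟶ Z}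
    (hab : c.f g h ≫ a = c.f g h ≫ b) : a = b := by
  have := congrArg (c.finv g h ≫ ·) hab
  simpa only [← Category.assoc, finv_f, Category.id_comp] using this

lemma orbit_smul {o : MulAction.orbitRel.Quotient G (SimpleClass π)} {g : G} {s t : o.orbit}
    (h : g • s = t) : g • (s : SimpleClass π) = (t : SimpleClass π) :=
  congrArg Subtype.val h

lemma stab_smul {s : SimpleClass π} (g : MulAction.stabilizer G s) : (g : G) • s = s := g.2

variable [Linear ℂ C] [MonoidalLinear ℂ C]

/-- `α` is the 2-cocycle of the projective action: `φ(g) φ(h) = α(g, h) φ(gh)`, where the function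
`α(g, h) ∈ F*[S]` acts on `X_u` by its value at `u`. -/
def IsCocycle (α : Cocycle G (SimpleClass π)) : Prop :=
  ∀ (g h : G) (s t r : SimpleClass π) (hst : h • s = t) (htr : g • t = r),
    c.f h hst ≫ c.f g htr =
      ((α.toFun g h r : ℂˣ) : ℂ) • c.f (g * h) (by rw [mul_smul, hst, htr] : (g * h) • s = r)

/-- For an object `Y` of `D`, the map `Hom_A(X_s, Y) → Hom_A(X_{gs}, Y)`,
`a ↦ φ_Y(g) ∘ a ∘ φ_s(g)⁻¹`. -/
def conj (Y : EquivMod π) (g : G) {s t : SimpleClass π} (h : g • s = t) :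
    (c.X s ⟶ Y.M) →ₗ[ℂ] (c.X t ⟶ Y.M) where
  toFun a := (c.iso g h).inv ≫ (piFun π g).map a ≫ Y.φHom g
  map_add' a b := by
    ext
    change c.finv g h ≫ (a.hom + b.hom) ≫ Y.φ g =
      c.finv g h ≫ a.hom ≫ Y.φ g + c.finv g h ≫ b.hom ≫ Y.φ g
    simp
  map_smul' z a := by
    ext
    change c.finv g h ≫ (z • a.hom) ≫ Y.φ g = z • (c.finv g h ≫ a.hom ≫ Y.φ g)
    simp

lemma conj_hom (Y : EquivMod π) (g : G) {s t : SimpleClass π} (h : g • s = t)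
    (a : c.X s ⟶ Y.M) : (c.conj Y g h a).hom = c.finv g h ≫ a.hom ≫ Y.φ g := rfl

lemma f_conj (Y : EquivMod π) (g : G) {s t : SimpleClass π} (h : g • s = t)
    (a : c.X s ⟶ Y.M) : c.f g h ≫ (c.conj Y g h a).hom = a.hom ≫ Y.φ g := by
  rw [conj_hom, ← Category.assoc, f_finv, Category.id_comp]

lemma conj_comp {Y Z : EquivMod π} (m : Y ⟶ Z) (g : G) {s t : SimpleClass π} (h : g • s = t)
    (a : c.X s ⟶ Y.M) : c.conj Y g h a ≫ m.hom = c.conj Z g h (a ≫ m.hom) := by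
  ext
  simp only [Mod.comp_hom', conj_hom, Category.assoc, m.comm]

variable {c} {α : Cocycle G (SimpleClass π)}

lemma IsCocycle.conj_conj (hα : c.IsCocycle α) (Y : EquivMod π) (g h : G)
    {s t r : SimpleClass π} (hst : h • s = t) (htr : g • t = r) (a : c.X s ⟶ Y.M) :
    c.conj Y g htr (c.conj Y h hst a) =
      (((α.toFun g h r)⁻¹ : ℂˣ) : ℂ) •
        c.conj Y (g * h) (by rw [mul_smul, hst, htr] : (g * h) • s = r) a := by
  ext
  have hr : (g * h) • s = r := by rw [mul_smul, hst, htr]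
  have h1 := hα g h s t r hst htr
  have h2 : c.f h hst ≫ c.f g htr ≫ (c.conj Y g htr (c.conj Y h hst a)).hom =
      c.f (g * h) hr ≫ (c.conj Y (g * h) hr a).hom := by
    rw [f_conj, f_conj, ← Category.assoc, f_conj, Category.assoc, Y.φ_mul]
  rw [← Category.assoc, h1, Linear.smul_comp] at h2
  apply c.f_cancel (g * h) hr
  rw [Orbifold.smul_hom, Linear.comp_smul, ← h2, smul_smul]
  simp

lemma IsCocycle.conj_one (hα : c.IsCocycle α) (Y : EquivMod π) {s : SimpleClass π}
    (h : (1 : G) • s = s) (a : c.X s ⟶ Y.M) :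
    c.conj Y 1 h a = (((α.toFun 1 1 s)⁻¹ : ℂˣ) : ℂ) • a := by
  have h1 := hα 1 1 s s s h h
  simp only [mul_one] at h1
  have h2 : c.f 1 h = ((α.toFun 1 1 s : ℂˣ) : ℂ) • 𝟙 _ := by
    apply c.f_cancel 1 h
    rw [h1, Linear.comp_smul, Category.comp_id]
  ext
  apply c.f_cancel 1 h
  rw [f_conj, Y.φ_one, Category.comp_id, h2, Orbifold.smul_hom, Linear.comp_smul,
    Linear.smul_comp, smul_smul]
  simp

/-- The algebra `A_{α⁻¹}(G, O)` of an orbit `O`. -/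
abbrev OrbitAlg (α : Cocycle G (SimpleClass π))
    (o : MulAction.orbitRel.Quotient G (SimpleClass π)) : Type _ :=
  TwistedAlg (α.inv.onOrbit o)

/-- The twisted group algebra `ℂ^{α_s⁻¹}[G_s]` of the stabilizer of `s`. -/
abbrev StabAlg (α : Cocycle G (SimpleClass π)) (s : SimpleClass π) : Type _ :=
  TwistedGroupAlg (α.inv.atPoint s)

variable (c)

/-- `conj` on families indexed by an orbit: `a ↦ φ_Y(g) ∘ a_{g⁻¹t} ∘ φ_{g⁻¹t}(g)⁻¹`. -/
def conjAt {o : MulAction.orbitRel.Quotient G (SimpleClass π)} (Y : EquivMod π) (g : G)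
    (a : ∀ s : o.orbit, c.X s ⟶ Y.M) (t : o.orbit) : c.X t ⟶ Y.M :=
  c.conj Y g (orbit_smul (smul_inv_smul g t)) (a (g⁻¹ • t))

lemma conjAt_eq {o : MulAction.orbitRel.Quotient G (SimpleClass π)} (Y : EquivMod π) (g : G)
    (a : ∀ s : o.orbit, c.X s ⟶ Y.M) (s t : o.orbit) (h : g • s = t) :
    c.conjAt Y g a t = c.conj Y g (orbit_smul h) (a s) := by
  obtain rfl : s = g⁻¹ • t := by rw [← h, inv_smul_smul]
  rfl

lemma conjAt_zero {o : MulAction.orbitRel.Quotient G (SimpleClass π)} (Y : EquivMod π) (g : G)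
    (t : o.orbit) : c.conjAt Y g 0 t = 0 :=
  map_zero (c.conj Y g _)

lemma conjAt_add {o : MulAction.orbitRel.Quotient G (SimpleClass π)} (Y : EquivMod π) (g : G)
    (a b : ∀ s : o.orbit, c.X s ⟶ Y.M) (t : o.orbit) :
    c.conjAt Y g (a + b) t = c.conjAt Y g a t + c.conjAt Y g b t :=
  map_add (c.conj Y g _) _ _

lemma conjAt_comp {o : MulAction.orbitRel.Quotient G (SimpleClass π)} {Y Z : EquivMod π}
    (m : Y ⟶ Z) (g : G) (a : ∀ s : o.orbit, c.X s ⟶ Y.M) (t : o.orbit) :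
    c.conjAt Y g a t ≫ m.hom = c.conjAt Z g (fun s => a s ≫ m.hom) t :=
  c.conj_comp m g _ _

variable [Finite G]

lemma sum_conjAt_comp {o : MulAction.orbitRel.Quotient G (SimpleClass π)} {Y Z : EquivMod π}
    (m : Y ⟶ Z) (x : OrbitAlg α o) (a : ∀ s : o.orbit, c.X s ⟶ Y.M) (t : o.orbit) :
    (∑ g, x.coeff g t • c.conjAt Y g a t) ≫ m.hom =
      ∑ g, x.coeff g t • c.conjAt Z g (fun s => a s ≫ m.hom) t := by
  simp only [Preadditive.sum_comp, Linear.smul_comp, conjAt_comp]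

lemma sum_conj_comp {s : SimpleClass π} {Y Z : EquivMod π}
    (m : Y ⟶ Z) (x : StabAlg α s) (a : c.X s ⟶ Y.M) :
    (∑ g, x.coeff g • c.conj Y g (stab_smul g) a) ≫ m.hom =
      ∑ g, x.coeff g • c.conj Z g (stab_smul g) (a ≫ m.hom) := by
  simp only [Preadditive.sum_comp, Linear.smul_comp, conj_comp]

variable {c}

/-- The action of `A_{α⁻¹}(G, O)` on `⨁_{s ∈ O} Hom_A(X_s, Y)` (the orbit `O` is finite, so that
this is the product): functions on `O` act by multiplication on the components and `g` maps
`a : X_s ⟶ Y` to `φ_Y(g) ∘ a ∘ φ_s(g)⁻¹ : X_{gs} ⟶ Y`. -/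
@[reducible]
def IsCocycle.orbitModule (hα : c.IsCocycle α)
    (o : MulAction.orbitRel.Quotient G (SimpleClass π)) (Y : EquivMod π) :
    Module (OrbitAlg α o) (∀ s : o.orbit, c.X s ⟶ Y.M) where
  smul x a := fun t => ∑ g, x.coeff g t • c.conjAt Y g a t
  one_smul a := by
    funext t
    change ∑ g, (1 : OrbitAlg α o).coeff g t • c.conjAt Y g a t = a t
    rw [Finset.sum_eq_single 1]
    · rw [c.conjAt_eq Y 1 a t t (one_smul _ _), hα.conj_one, smul_smul]
      simp [TwistedAlg.one_def, TwistedAlg.ofFun, Cocycle.onOrbit, Cocycle.inv]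
    · intro g _ hg
      simp [TwistedAlg.one_def, TwistedAlg.ofFun, hg]
    · simp
  mul_smul x y a := by
    funext t
    change ∑ m, (x * y).coeff m t • c.conjAt Y m a t =
      ∑ g, x.coeff g t • c.conj Y g _ (∑ h, y.coeff h (g⁻¹ • t) • c.conjAt Y h a (g⁻¹ • t))
    simp only [TwistedAlg.mul_coeff, Finset.sum_smul, map_sum, map_smul, Finset.smul_sum]
    rw [Finset.sum_comm]
    refine Finset.sum_congr rfl fun g _ => ?_
    refine Fintype.sum_equiv (Equiv.mulLeft g⁻¹) _ _ fun m => ?_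
    have e1 : (g⁻¹ * m) • (m⁻¹ • t) = g⁻¹ • t := by rw [mul_smul, smul_inv_smul]
    have e2 : m • (m⁻¹ • t) = t := smul_inv_smul m t
    rw [Equiv.coe_mulLeft, c.conjAt_eq Y (g⁻¹ * m) a _ _ e1, c.conjAt_eq Y m a _ _ e2,
      hα.conj_conj, smul_smul, smul_smul]
    simp only [mul_inv_cancel_left]
    rfl
  smul_zero x := by
    funext t
    change ∑ g, x.coeff g t • c.conjAt Y g 0 t = 0
    simp only [conjAt_zero, smul_zero, Finset.sum_const_zero]
  smul_add x a b := by
    funext t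
    change ∑ g, x.coeff g t • c.conjAt Y g (a + b) t =
      ∑ g, x.coeff g t • c.conjAt Y g a t + ∑ g, x.coeff g t • c.conjAt Y g b t
    simp only [conjAt_add, smul_add, Finset.sum_add_distrib]
  add_smul x y a := by
    funext t
    change ∑ g, (x + y).coeff g t • c.conjAt Y g a t =
      ∑ g, x.coeff g t • c.conjAt Y g a t + ∑ g, y.coeff g t • c.conjAt Y g a t
    simp [add_smul, Finset.sum_add_distrib]
  zero_smul a := by
    funext t
    change ∑ g, (0 : OrbitAlg α o).coeff g t • c.conjAt Y g a t = 0
    simp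

/-- The `A_{α⁻¹}(G, O)`-module `⨁_{s ∈ O} Hom_A(X_s, Y)`. -/
def IsCocycle.orbitObj (hα : c.IsCocycle α)
    (o : MulAction.orbitRel.Quotient G (SimpleClass π)) (Y : EquivMod π) :
    ModuleCat.{max u v} (OrbitAlg α o) :=
  letI := hα.orbitModule o Y
  ModuleCat.of (OrbitAlg α o) (∀ s : o.orbit, c.X s ⟶ Y.M)

/-- Composition with a morphism of `D`, as a map of `A_{α⁻¹}(G, O)`-modules. -/
def IsCocycle.orbitMap (hα : c.IsCocycle α)
    (o : MulAction.orbitRel.Quotient G (SimpleClass π)) {Y Z : EquivMod π} (m : Y ⟶ Z) :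
    hα.orbitObj o Y →ₗ[OrbitAlg α o] hα.orbitObj o Z where
  toFun := fun (a : ∀ s : o.orbit, c.X s ⟶ Y.M) s => a s ≫ m.hom
  map_add' := fun _ _ => funext fun _ => Preadditive.add_comp _ _ _ _ _ _
  map_smul' := fun x a => funext fun t => c.sum_conjAt_comp m x a t

/-- The functor `Y ↦ ⨁_{s ∈ O} Hom_A(X_s, Y)` from `D` to modules over `A_{α⁻¹}(G, O)`. -/
def IsCocycle.orbitFunctor (hα : c.IsCocycle α)
    (o : MulAction.orbitRel.Quotient G (SimpleClass π)) :
    EquivMod π ⥤ ModuleCat.{max u v} (OrbitAlg α o) where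
  obj Y := hα.orbitObj o Y
  map m := (ModuleCat.ofHom (hα.orbitMap o m) :)
  map_id Y := ModuleCat.hom_ext (LinearMap.ext fun a =>
    funext fun s => Category.comp_id (a s : c.X s ⟶ Y.M))
  map_comp {X _ _} m n := ModuleCat.hom_ext (LinearMap.ext fun a =>
    funext fun s => (Category.assoc (a s : c.X s ⟶ X.M) m.hom n.hom).symm)

/-- The functor `Y ↦ (⨁_{s ∈ O} Hom_A(X_s, Y))_O`, where `O` runs over the orbits of `G` in `S`. -/
def IsCocycle.homFunctor (hα : c.IsCocycle α) :
    EquivMod π ⥤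
      ∀ o : MulAction.orbitRel.Quotient G (SimpleClass π), ModuleCat.{max u v} (OrbitAlg α o) :=
  Functor.pi' hα.orbitFunctor

/-- The action of `ℂ^{α_s⁻¹}[G_s]` on `Hom_A(X_s, Y)`: `g` acts by
`a ↦ φ_Y(g) ∘ a ∘ φ_s(g)⁻¹`. -/
@[reducible]
def IsCocycle.stabModule (hα : c.IsCocycle α) (s : SimpleClass π) (Y : EquivMod π) :
    Module (StabAlg α s) (c.X s ⟶ Y.M) where
  smul x a := ∑ g, x.coeff g • c.conj Y g (stab_smul g) a
  one_smul a := by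
    change ∑ g, (1 : StabAlg α s).coeff g • c.conj Y g (stab_smul g) a = a
    rw [Finset.sum_eq_single 1]
    · have := hα.conj_one Y (one_smul G s) a
      simp only [Subgroup.coe_one]
      rw [this, smul_smul]
      simp [TwistedGroupAlg.one_coeff, Cocycle.atPoint, Cocycle.inv]
    · intro g _ hg
      simp [TwistedGroupAlg.one_coeff, hg]
    · simp
  mul_smul x y a := by
    change ∑ m, (x * y).coeff m • c.conj Y m (stab_smul m) a =
      ∑ g, x.coeff g • c.conj Y g (stab_smul g) (∑ h, y.coeff h • c.conj Y h (stab_smul h) a)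
    simp only [TwistedGroupAlg.mul_coeff, Finset.sum_smul, map_sum, map_smul, Finset.smul_sum]
    rw [Finset.sum_comm]
    refine Finset.sum_congr rfl fun g _ => ?_
    refine Fintype.sum_equiv (Equiv.mulLeft g⁻¹) _ _ fun m => ?_
    dsimp only [Equiv.coe_mulLeft]
    rw [hα.conj_conj, smul_smul, smul_smul]
    simp only [Subgroup.coe_mul, Subgroup.coe_inv, mul_inv_cancel_left]
    rfl
  smul_zero x := by
    change ∑ g, x.coeff g • c.conj Y g (stab_smul g) 0 = 0
    simp
  smul_add x a b := by
    change ∑ g, x.coeff g • c.conj Y g (stab_smul g) (a + b) =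
      ∑ g, x.coeff g • c.conj Y g (stab_smul g) a + ∑ g, x.coeff g • c.conj Y g (stab_smul g) b
    simp [Finset.sum_add_distrib]
  add_smul x y a := by
    change ∑ g, (x + y).coeff g • c.conj Y g (stab_smul g) a =
      ∑ g, x.coeff g • c.conj Y g (stab_smul g) a + ∑ g, y.coeff g • c.conj Y g (stab_smul g) a
    simp [add_smul, Finset.sum_add_distrib]
  zero_smul a := by
    change ∑ g, (0 : StabAlg α s).coeff g • c.conj Y g (stab_smul g) a = 0
    simp

/-- The `ℂ^{α_s⁻¹}[G_s]`-module `Hom_A(X_s, Y)`. -/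
def IsCocycle.stabObj (hα : c.IsCocycle α) (s : SimpleClass π) (Y : EquivMod π) :
    ModuleCat.{v} (StabAlg α s) :=
  letI := hα.stabModule s Y
  ModuleCat.of (StabAlg α s) (c.X s ⟶ Y.M)

/-- Composition with a morphism of `D`, as a map of `ℂ^{α_s⁻¹}[G_s]`-modules. -/
def IsCocycle.stabMap (hα : c.IsCocycle α) (s : SimpleClass π) {Y Z : EquivMod π} (m : Y ⟶ Z) :
    hα.stabObj s Y →ₗ[StabAlg α s] hα.stabObj s Z where
  toFun := fun (a : c.X s ⟶ Y.M) => a ≫ m.hom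
  map_add' := fun _ _ => Preadditive.add_comp _ _ _ _ _ _
  map_smul' := fun x a => c.sum_conj_comp m x a

/-- The functor `Y ↦ Hom_A(X_s, Y)` from `D` to modules over `ℂ^{α_s⁻¹}[G_s]`. -/
def IsCocycle.stabFunctor (hα : c.IsCocycle α) (s : SimpleClass π) :
    EquivMod π ⥤ ModuleCat.{v} (StabAlg α s) where
  obj Y := hα.stabObj s Y
  map m := (ModuleCat.ofHom (hα.stabMap s m) :)
  map_id Y := ModuleCat.hom_ext (LinearMap.ext fun a => Category.comp_id (a : c.X s ⟶ Y.M))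
  map_comp {X _ _} m n := ModuleCat.hom_ext (LinearMap.ext fun a =>
    (Category.assoc (a : c.X s ⟶ X.M) m.hom n.hom).symm)

/-- The functor `Y ↦ (Hom_A(X_s, Y))_s`, where `s = r o` runs over given representatives of the
orbits of `G` in `S`. -/
def IsCocycle.stabHomFunctor (hα : c.IsCocycle α)
    (r : MulAction.orbitRel.Quotient G (SimpleClass π) → SimpleClass π) :
    EquivMod π ⥤
      ∀ o : MulAction.orbitRel.Quotient G (SimpleClass π), ModuleCat.{v} (StabAlg α (r o)) :=
  Functor.pi' fun o => hα.stabFunctor (r o)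

end Choice

end Functors

/-! ### The components `V_s` of a representation of `A_α(G, O)` and the sums `⨁ V_s ⊠ X_s` -/

section Components

variable {G : Type*} {T : Type*} [Group G] [MulAction G T] [Finite G] {α : Cocycle G T}

open scoped ModuleCat

/-- The component `V_s = δ_s V` of a module over `A_α(G, T)`. -/
def component (V : ModuleCat.{w} (TwistedAlg α)) (s : T) : Submodule ℂ V where
  carrier := {x | TwistedAlg.delta α s • x = x}
  add_mem' {x y} hx hy := by
    change _ • (x + y) = x + y
    rw [smul_add, hx, hy]
  zero_mem' := smul_zero _
  smul_mem' z x hx := by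
    change _ • (z • x) = z • x
    rw [smul_comm, hx]

/-- The map `V_s → V_t`, `t = gs`, given by the action of `g` on `V`. -/
def componentAct (V : ModuleCat.{w} (TwistedAlg α)) (g : G) {s t : T} (h : g • s = t) :
    component V s →ₗ[ℂ] component V t where
  toFun x := ⟨TwistedAlg.u α g • (x : V), by
    subst h
    change _ • (_ • (x : V)) = _
    rw [← mul_smul, ← TwistedAlg.u_mul_delta, mul_smul, x.2]⟩
  map_add' x y := Subtype.ext (smul_add _ _ _)
  map_smul' z x := Subtype.ext (smul_comm _ _ _)

/-- The map `V_s → W_s` induced by a morphism of representations. -/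
def componentMap {V W : ModuleCat.{w} (TwistedAlg α)} (m : V ⟶ W) (s : T) :
    component V s →ₗ[ℂ] component W s where
  toFun x := ⟨m.hom (x : V), by
    change _ • m.hom (x : V) = _
    rw [← map_smul, x.2]⟩
  map_add' x y := Subtype.ext (map_add _ _ _)
  map_smul' z x := Subtype.ext ((m.hom.restrictScalars ℂ).map_smul z (x : V))

end Components

section SumTensor

variable {C : Type u} [Category.{v} C] [MonoidalCategory C] [Preadditive C]
  [MonoidalPreadditive C] [Linear ℂ C] [MonoidalLinear ℂ C] {G : Type w} [Group G] [Finite G]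
  {A : Mon C} {π : G →* Aut A}

/-- The object `Y` of `D`, with the linear maps `i_s : V_s → Hom_A(X_s, Y)`, is
`⨁_O V_O ⊠_{F[O]} X_O = ⨁_s V_s ⊠ X_s` with `φ_Y(g) = ⨁_s φ_{V_s}(g) ⊗ φ_s(g)`. Here `V ⊠ X`, for
a vector space `V`, is the object with `Hom(V ⊠ X, Z) = Hom_ℂ(V, Hom(X, Z))`. -/
structure IsSumTensor (c : Choice π) (α : Cocycle G (SimpleClass π))
    (V : ∀ o : MulAction.orbitRel.Quotient G (SimpleClass π),
      ModuleCat.{max u v} (Choice.OrbitAlg α o)) (Y : EquivMod π)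
    (i : ∀ (o : MulAction.orbitRel.Quotient G (SimpleClass π)) (s : o.orbit),
      component (V o) s →ₗ[ℂ] (c.X s ⟶ Y.M)) : Prop where
  universal : ∀ (Z : Mod C A.X)
    (j : ∀ (o : MulAction.orbitRel.Quotient G (SimpleClass π)) (s : o.orbit),
      component (V o) s →ₗ[ℂ] (c.X s ⟶ Z)),
    ∃! m : Y.M ⟶ Z, ∀ o s x, i o s x ≫ m = j o s x
  equivariant : ∀ (g : G) (o : MulAction.orbitRel.Quotient G (SimpleClass π)) (s t : o.orbit)
    (h : g • s = t) (x : component (V o) s),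
    (i o s x).hom ≫ Y.φ g =
      c.f g (Choice.orbit_smul h) ≫ (i o t (componentAct (V o) g h x)).hom

end SumTensor

/-- A preadditive category is abelian. -/
def IsAbelian (D : Type u) [Category.{v} D] [inst : Preadditive D] : Prop :=
  ∃ a : Abelian D, a.toPreadditive = inst

end Orbifold
end

open Orbifold

noncomputable section

namespace Orbifold

/-! ### Categories in which every morphism is von Neumann regular -/

/-! Call a morphism `f` regular if `f ≫ g ≫ f = f` for some `g`. All morphisms of the semisimple
category `C` are regular, and regularity passes from `C` to `Rep A` and from `Rep A` to `D` by two
arguments in the style of Maschke. For `Rep A`, a quasi-inverse in `C` is averaged over the Casimir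
element of `A`, the copairing of the non-degenerate pairing. The product of this element is `z`
times the unit because `Hom(𝟙, A)` is a line, and `z ≠ 0` because commutativity and `θ_A = id`
identify copairing followed by pairing with `dim A ≠ 0` (`IsCasimir.of_exactPairing`,
`IsRigidAlgebra.exists_casimir`, `allRegular_mod`). For `D`, a quasi-inverse in `Rep A` is averaged
over `G` (`EquivMod.allRegular`). Biproducts and split idempotents lift along the forgetful
functors, and together with regularity they make `D` abelian (`AllRegular.isAbelian`).

Regularity and finite dimensional Hom spaces decompose every `A`-module into simple ones
(`AllRegular.sumOfSimples`). By Schur's lemma, `M ↦ (Hom_A(X_s, M))_s` then identifies `Rep A` with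
families of finite dimensional vector spaces of finite support (`Choice.existsUnique_hom`,
`Choice.exists_sum_module`). Schur's lemma also yields `α`, since `φ(g)φ(h)` and `φ(gh)` differ by a
scalar on each `X_s`.

Under this identification, giving `φ_M(g)` amounts to giving the maps `a ↦ φ_M(g) ∘ a ∘ φ_s(g)⁻¹`
from `Hom_A(X_s, M)` to `Hom_A(X_{gs}, M)`. As the `φ_s` compose up to `α`, these maps compose up to
`α⁻¹`. Over an orbit `O`, such a family of spaces and maps is a module over `A_{α⁻¹}(G, O)`, with
`F[O]` cutting out the components. This gives full faithfulness (`Choice.exists_hom_of_conj`) and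
essential surjectivity (`Choice.IsCocycle.realize`), and it turns the universal property of `⨁ V_s ⊠
X_s` into a form of `existsUnique_hom`.

For the stabilizers, the action of `G` identifies all components over an orbit with the one at a
representative, on which only the stabilizer still acts. In the other direction, a representation of
the stabilizer is induced to the orbit (`inducedFamily`). -/

/-- Every morphism `f` has a quasi-inverse `g`: `f ≫ g ≫ f = f`. -/
def AllRegular (D : Type u) [Category.{v} D] : Prop :=
  ∀ (X Y : D) (f : X ⟶ Y), ∃ g : Y ⟶ X, f ≫ g ≫ f = f

section

variable {D : Type u} [Category.{v} D]

lemma AllRegular.mono_split (h : AllRegular D) {X Y : D} (f : X ⟶ Y) [Mono f] :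
    ∃ g : Y ⟶ X, f ≫ g = 𝟙 X := by
  obtain ⟨g, hg⟩ := h _ _ f
  exact ⟨g, by rw [← cancel_mono f]; simpa using hg⟩

lemma AllRegular.epi_split (h : AllRegular D) {X Y : D} (f : X ⟶ Y) [Epi f] :
    ∃ g : Y ⟶ X, g ≫ f = 𝟙 Y := by
  obtain ⟨g, hg⟩ := h _ _ f
  exact ⟨g, by rw [← cancel_epi f]; simpa using hg⟩

end

/-- If every finite family of objects has a bicone with `∑ π ≫ ι = 𝟙`, then finite biproducts
exist. -/
lemma hasFiniteBiproducts_of_total {D : Type u} [Category.{v} D] [Preadditive D]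
    (h : ∀ (n : ℕ) (f : Fin n → D), ∃ b : Bicone f, ∑ j, b.π j ≫ b.ι j = 𝟙 b.pt) :
    HasFiniteBiproducts D where
  out n := ⟨fun F => by
    obtain ⟨b, hb⟩ := h n F
    exact hasBiproduct_of_total b hb⟩

section Regular

variable {D : Type u} [Category.{v} D] [Preadditive D] [IsIdempotentComplete D]

/-- If `f ≫ g ≫ f = f`, then `𝟙 - f ≫ g` is an idempotent that is killed by composing with `f` and
fixes every `x` with `x ≫ f = 0`. The object splitting it is therefore the kernel. -/
lemma AllRegular.hasKernels (h : AllRegular D) : HasKernels D where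
  has_limit {X Y} f := by
    obtain ⟨g, hg⟩ := h _ _ f
    obtain ⟨K, i, e, hie, hei⟩ := IsIdempotentComplete.idempotents_split X (𝟙 X - f ≫ g) (by
      simp only [Preadditive.comp_sub, Preadditive.sub_comp, Category.id_comp, Category.comp_id,
        Category.assoc, reassoc_of% hg]
      abel)
    have hif : i ≫ f = 0 := by
      have : (e ≫ i) ≫ f = 0 := by
        rw [hei]
        simp [hg]
      have h2 : i ≫ (e ≫ i) ≫ f = i ≫ f := by simp [reassoc_of% hie]
      rw [← h2, this, comp_zero]
    have hm : Mono i := ⟨fun a b hab => by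
      simpa [hie] using congrArg (· ≫ e) hab⟩
    exact ⟨⟨⟨KernelFork.ofι i hif, KernelFork.IsLimit.ofι i hif (fun x _ => x ≫ e)
      (fun x hx => by
        rw [Category.assoc, hei]
        simp [reassoc_of% hx])
      (fun x hx m hm' => by rw [← cancel_mono i, hm', Category.assoc, hei]; simp [reassoc_of% hx])⟩⟩⟩

lemma AllRegular.hasCokernels (h : AllRegular D) : HasCokernels D where
  has_colimit {X Y} f := by
    obtain ⟨g, hg⟩ := h _ _ f
    obtain ⟨K, i, e, hie, hei⟩ := IsIdempotentComplete.idempotents_split Y (𝟙 Y - g ≫ f) (by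
      simp only [Preadditive.comp_sub, Preadditive.sub_comp, Category.id_comp, Category.comp_id,
        Category.assoc, hg]
      abel)
    have hif : f ≫ e = 0 := by
      have : f ≫ e ≫ i = 0 := by
        rw [hei]
        simp [hg]
      have h2 : (f ≫ e ≫ i) ≫ e = f ≫ e := by simp [hie]
      rw [← h2, this, zero_comp]
    have hm : Epi e := ⟨fun a b hab => by
      simpa [reassoc_of% hie] using congrArg (i ≫ ·) hab⟩
    have key : ∀ {W : D} (x : Y ⟶ W), f ≫ x = 0 → e ≫ i ≫ x = x := fun x hx => by
      rw [reassoc_of% hei]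
      simp [hx]
    exact ⟨⟨⟨CokernelCofork.ofπ e hif, CokernelCofork.IsColimit.ofπ e hif (fun x _ => i ≫ x)
      (fun x hx => key x hx)
      (fun x hx m hm' => by rw [← cancel_epi e, hm', key x hx])⟩⟩⟩

/-- A preadditive category with finite biproducts, split idempotents and only regular morphisms is
abelian. -/
lemma AllRegular.isAbelian {D : Type u} [Category.{v} D] [inst : Preadditive D]
    [IsIdempotentComplete D] [HasFiniteBiproducts D] (h : AllRegular D) : IsAbelian D := by
  have := h.hasKernels
  have := h.hasCokernels
  have hm : IsNormalMonoCategory D := ⟨fun {X Y} f _ => by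
    obtain ⟨r, hr⟩ := h.mono_split f
    -- A split mono `f` with retraction `r` is the kernel of the complementary idempotent `𝟙 - r ≫
    -- f`.
    refine ⟨⟨Y, 𝟙 Y - r ≫ f, by simp [reassoc_of% hr],
      KernelFork.IsLimit.ofι _ _ (fun x _ => x ≫ r) (fun x hx => ?_) (fun x hx m hm => ?_)⟩⟩
    · rw [Preadditive.comp_sub, Category.comp_id, sub_eq_zero] at hx
      rw [Category.assoc, ← hx]
    · rw [← hm, Category.assoc, hr, Category.comp_id]⟩
  have he : IsNormalEpiCategory D := ⟨fun {X Y} f _ => by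
    obtain ⟨r, hr⟩ := h.epi_split f
    refine ⟨⟨X, 𝟙 X - f ≫ r, by simp [hr],
      CokernelCofork.IsColimit.ofπ _ _ (fun x _ => r ≫ x) (fun x hx => ?_) (fun x hx m hm => ?_)⟩⟩
    · rw [Preadditive.sub_comp, Category.id_comp, sub_eq_zero, Category.assoc] at hx
      exact hx.symm
    · rw [← hm, reassoc_of% hr]⟩
  exact ⟨{ toPreadditive := inst, toIsNormalMonoCategory := hm, toIsNormalEpiCategory := he }, rfl⟩

end Regular

/-! ### Semisimple categories -/

section Semisimple

variable {C : Type u} [Category.{v} C] [Abelian C]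

/-- A jointly monic finite family of morphisms to simple objects is jointly split. -/
lemma exists_sum_eq_id_of_jointly_mono : ∀ (n : ℕ) (N : C) (S : Fin n → C)
    (_ : ∀ i, Simple (S i)) (q : ∀ i, N ⟶ S i)
    (_ : ∀ (Z : C) (x : Z ⟶ N), (∀ i, x ≫ q i = 0) → x = 0),
    ∃ h : ∀ i, S i ⟶ N, ∑ i, q i ≫ h i = 𝟙 N
  | 0, N, S, _, q, hq => ⟨fun i => i.elim0, (hq N _ fun i => i.elim0).symm⟩
  | n + 1, N, S, hS, q, hq => by
    -- On the kernel of `q 0` the remaining morphisms are still jointly monic, so the induction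
    -- hypothesis applies there.
    obtain ⟨h, hh⟩ := exists_sum_eq_id_of_jointly_mono n (kernel (q 0)) (fun i => S i.succ)
      (fun i => hS _) (fun i => kernel.ι (q 0) ≫ q i.succ) (fun Z x hx => by
        rw [← cancel_mono (kernel.ι (q 0)), zero_comp]
        refine hq _ _ fun i => ?_
        refine Fin.cases (by simp) (fun j => by simpa using hx j) i)
    let r : N ⟶ N := ∑ i : Fin n, q i.succ ≫ h i ≫ kernel.ι (q 0)
    have hr : kernel.ι (q 0) ≫ (𝟙 N - r) = 0 := by
      have : kernel.ι (q 0) ≫ r = (∑ i : Fin n, (kernel.ι (q 0) ≫ q i.succ) ≫ h i) ≫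
          kernel.ι (q 0) := by
        simp [r, Preadditive.comp_sum, Preadditive.sum_comp]
      rw [Preadditive.comp_sub, this, hh]
      simp
    -- The morphism `𝟙 N - r` vanishes on the kernel of `q 0`. It therefore factors through `q 0`,
    -- which is either zero or, its target being simple, an epimorphism.
    obtain ⟨k, hk⟩ : ∃ k : S 0 ⟶ N, q 0 ≫ k = 𝟙 N - r := by
      by_cases h0 : q 0 = 0
      · refine ⟨0, ?_⟩
        have : IsIso (kernel.ι (q 0)) := by
          rw [h0]
          infer_instance
        rw [← cancel_epi (kernel.ι (q 0)), hr]
        simp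
      · have := hS 0
        have := epi_of_nonzero_to_simple h0
        exact ⟨Abelian.epiDesc (q 0) _ hr, Abelian.comp_epiDesc _ _ _⟩
    refine ⟨Fin.cases k fun i => h i ≫ kernel.ι (q 0), ?_⟩
    rw [Fin.sum_univ_succ]
    simp only [Fin.cases_zero, Fin.cases_succ]
    rw [hk]
    simp [r]

/-- Monomorphisms split: the coordinates of the target in a decomposition into simple objects
restrict to a jointly monic family on the source. For general `f`, a retraction of its image,
followed by a section of the projection onto the image, is a quasi-inverse. -/
lemma IsSemisimpleCat.allRegular [Linear ℂ C] (hC : IsSemisimpleCat C) : AllRegular C := by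
  have hmono : ∀ {X Y : C} (f : X ⟶ Y) [Mono f], ∃ g : Y ⟶ X, f ≫ g = 𝟙 X := by
    intro X Y f _
    let := Abelian.hasFiniteBiproducts (C := C)
    obtain ⟨n, S, hS, ⟨e⟩⟩ := hC.exists_iso_sum Y
    obtain ⟨h, hh⟩ := exists_sum_eq_id_of_jointly_mono n X S hS
      (fun i => f ≫ e.hom ≫ biproduct.π S i) (fun Z x hx => by
        rw [← cancel_mono f, ← cancel_mono e.hom, zero_comp, zero_comp]
        refine biproduct.hom_ext _ _ fun i => ?_
        simpa using hx i)
    exact ⟨∑ i, (e.hom ≫ biproduct.π S i) ≫ h i, by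
      rw [← hh, Preadditive.comp_sum]
      simp⟩
  intro X Y f
  obtain ⟨r, hr⟩ := hmono (Abelian.image.ι f)
  obtain ⟨k, hk⟩ := hmono (kernel.ι (Abelian.factorThruImage f))
  -- Since `k` retracts the kernel inclusion, `𝟙 - k ≫ kernel.ι` vanishes on the kernel and descends
  -- to the image. This descended morphism is the section.
  let s := Abelian.epiDesc (Abelian.factorThruImage f)
    (𝟙 X - k ≫ kernel.ι (Abelian.factorThruImage f)) (by simp [reassoc_of% hk])
  have hs : Abelian.factorThruImage f ≫ s =
      𝟙 X - k ≫ kernel.ι (Abelian.factorThruImage f) := Abelian.comp_epiDesc _ _ _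
  refine ⟨r ≫ s, ?_⟩
  have hf : Abelian.factorThruImage f ≫ Abelian.image.ι f = f := by simp
  calc f ≫ (r ≫ s) ≫ f = (Abelian.factorThruImage f ≫ Abelian.image.ι f) ≫ (r ≫ s) ≫
        Abelian.factorThruImage f ≫ Abelian.image.ι f := by rw [hf]
    _ = f := by
      simp only [Category.assoc]
      rw [reassoc_of% hr, reassoc_of% hs, Preadditive.sub_comp, Category.assoc,
        kernel.condition_assoc]
      simp

end Semisimple

/-! ### Decomposition into simple objects -/

section Decomposition

variable {D : Type u} [Category.{v} D] [Preadditive D]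

/-- `M` is a finite sum of simple objects: its identity is a sum of morphisms through simple
objects. -/
def SumOfSimples (M : D) : Prop :=
  ∃ (ι : Type) (_ : Fintype ι) (S : ι → D) (p : ∀ k, M ⟶ S k) (i : ∀ k, S k ⟶ M),
    (∀ k, Simple (S k)) ∧ ∑ k, p k ≫ i k = 𝟙 M

lemma SumOfSimples.of_add {M N K : D} (hN : SumOfSimples N) (hK : SumOfSimples K)
    (g : M ⟶ N) (f : N ⟶ M) (e : M ⟶ K) (i : K ⟶ M) (h : g ≫ f + e ≫ i = 𝟙 M) :
    SumOfSimples M := by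
  obtain ⟨ι₁, _, S₁, p₁, i₁, hS₁, h₁⟩ := hN
  obtain ⟨ι₂, _, S₂, p₂, i₂, hS₂, h₂⟩ := hK
  refine ⟨ι₁ ⊕ ι₂, inferInstance, Sum.elim S₁ S₂, Sum.rec (fun k => g ≫ p₁ k) (fun k => e ≫ p₂ k),
    Sum.rec (fun k => i₁ k ≫ f) (fun k => i₂ k ≫ i), Sum.rec hS₁ hS₂, ?_⟩
  rw [Fintype.sum_sum_type, ← h]
  have e1 : g ≫ f = g ≫ (∑ k, p₁ k ≫ i₁ k) ≫ f := by rw [h₁, Category.id_comp]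
  have e2 : e ≫ i = e ≫ (∑ k, p₂ k ≫ i₂ k) ≫ i := by rw [h₂, Category.id_comp]
  rw [e1, e2]
  simp [Preadditive.comp_sum, Preadditive.sum_comp]

variable [Linear ℂ D]

/-- The map `x ↦ r ≫ x ≫ i` embeds `End N` in `End M`. Its image misses `q`, because `i ≫ q = 0`
would force the preimage of `q`, and with it `q`, to give zero. This makes `dim End` a measure that
decreases on proper direct summands. -/
lemma finrank_end_lt_of_retract [∀ X Y : D, FiniteDimensional ℂ (X ⟶ Y)] {N M : D} (i : N ⟶ M)
    (r : M ⟶ N) (hir : i ≫ r = 𝟙 N) (q : M ⟶ M) (hq : q ≠ 0) (hiq : i ≫ q = 0) :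
    Module.finrank ℂ (N ⟶ N) < Module.finrank ℂ (M ⟶ M) := by
  let L : (N ⟶ N) →ₗ[ℂ] (M ⟶ M) :=
    { toFun := fun x => r ≫ x ≫ i
      map_add' := by simp
      map_smul' := by simp }
  have hL : Function.Injective L := fun x y hxy => by
    have : i ≫ (r ≫ x ≫ i) ≫ r = i ≫ (r ≫ y ≫ i) ≫ r := by
      rw [show r ≫ x ≫ i = r ≫ y ≫ i from hxy]
    simpa [hir, reassoc_of% hir] using this
  rw [← LinearMap.finrank_range_of_inj hL]
  refine Submodule.finrank_lt fun htop => ?_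
  obtain ⟨x, hx⟩ : q ∈ LinearMap.range L := htop ▸ Submodule.mem_top
  have hx : r ≫ x ≫ i = q := hx
  apply hq
  have h0 : x ≫ i = 0 := by
    rw [← hiq, ← hx, reassoc_of% hir]
  rw [← hx, h0, comp_zero]

/-- Strong induction on `dim End M`. If `M` is neither zero nor simple, it has a nonzero proper
subobject `N`, which splits off by regularity. Both `N` and its complement `K` have smaller
endomorphism algebras. -/
lemma AllRegular.sumOfSimples (h : AllRegular D) [IsIdempotentComplete D]
    [∀ X Y : D, FiniteDimensional ℂ (X ⟶ Y)] (M : D) : SumOfSimples M := by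
  induction hn : Module.finrank ℂ (M ⟶ M) using Nat.strong_induction_on generalizing M with
  | _ n ih =>
  subst hn
  by_cases hM : 𝟙 M = 0
  · exact ⟨Empty, inferInstance, fun k => k.elim, fun k => k.elim, fun k => k.elim,
      fun k => k.elim, by simp [hM]⟩
  by_cases hS : Simple M
  · exact ⟨Unit, inferInstance, fun _ => M, fun _ => 𝟙 M, fun _ => 𝟙 M, fun _ => hS, by simp⟩
  obtain ⟨N, f, hf, hf0, hfi⟩ : ∃ (N : D) (f : N ⟶ M), Mono f ∧ f ≠ 0 ∧ ¬ IsIso f := by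
    by_contra hcon
    push Not at hcon
    refine hS ⟨fun {Y} f hf => ⟨fun hfi h0 => hM ?_, fun h0 => hcon Y f hf h0⟩⟩
    simpa [h0] using (IsIso.inv_hom_id f).symm
  obtain ⟨g, hg⟩ := h.mono_split f
  have hp : (𝟙 M - g ≫ f) ≫ (𝟙 M - g ≫ f) = 𝟙 M - g ≫ f := by simp [reassoc_of% hg]
  obtain ⟨K, i, e, hie, hei⟩ := IsIdempotentComplete.idempotents_split M _ hp
  have hp0 : 𝟙 M - g ≫ f ≠ 0 := fun h0 => hfi ⟨g, hg, (sub_eq_zero.mp h0).symm⟩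
  have hgf0 : g ≫ f ≠ 0 := fun h0 => hf0 (by
    have := congrArg (f ≫ ·) h0
    simpa [reassoc_of% hg] using this)
  refine SumOfSimples.of_add
    (ih _ (finrank_end_lt_of_retract f g hg _ hp0 (by simp [reassoc_of% hg])) N rfl)
    (ih _ (finrank_end_lt_of_retract i e hie _ hgf0 ?_) K rfl) g f e i (by rw [hei]; simp)
  have h1 : g ≫ f = 𝟙 M - e ≫ i := by rw [hei]; simp
  rw [h1]
  simp [reassoc_of% hie]

end Decomposition

/-! ### Constructing modules -/

section ModConstructions

variable {C : Type u} [Category.{v} C] [MonoidalCategory C] {A : C} [MonObj A]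

lemma one_act (M : Mod C A) : (MonObj.one : 𝟙_ C ⟶ A) ▷ M.X ≫ act M = (λ_ M.X).hom :=
  ModObj.one_smul (M := A) M.X

lemma mul_act (M : Mod C A) :
    (MonObj.mul : A ⊗ A ⟶ A) ▷ M.X ≫ act M = (α_ A A M.X).hom ≫ A ◁ act M ≫ act M :=
  ModObj.mul_smul (M := A) M.X

/-- A module structure on an object with a jointly monic family of morphisms to modules. -/
def liftMod {J : Type*} (K : C) (a : A ⊗ K ⟶ K) (M : J → Mod C A) (k : ∀ j, K ⟶ (M j).X)
    (hk : ∀ {Z : C} (x y : Z ⟶ K), (∀ j, x ≫ k j = y ≫ k j) → x = y)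
    (ha : ∀ j, a ≫ k j = A ◁ k j ≫ act (M j)) : Mod C A :=
  letI : ModObj A K :=
    { smul := a
      one_smul := hk _ _ fun j => by
        change (MonObj.one ▷ K ≫ a) ≫ k j = (λ_ K).hom ≫ k j
        rw [Category.assoc, ha, ← whisker_exchange_assoc, one_act]
        simp
      mul_smul := hk _ _ fun j => by
        change (MonObj.mul ▷ K ≫ a) ≫ k j = ((α_ A A K).hom ≫ A ◁ a ≫ a) ≫ k j
        simp only [Category.assoc]
        rw [ha, ← whisker_exchange_assoc, mul_act, ← whiskerLeft_comp_assoc, ha]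
        simp }
  ⟨K⟩

variable {J : Type*} (K : C) (a : A ⊗ K ⟶ K) (M : J → Mod C A) (k : ∀ j, K ⟶ (M j).X)
    (hk : ∀ {Z : C} (x y : Z ⟶ K), (∀ j, x ≫ k j = y ≫ k j) → x = y)
    (ha : ∀ j, a ≫ k j = A ◁ k j ≫ act (M j))

/-- The given morphisms, as morphisms of modules. -/
def liftModProj (j : J) : liftMod K a M k hk ha ⟶ M j := mkHom (k j) (ha j)

/-- A morphism of modules to `liftMod`. -/
def liftModLift (N : Mod C A) (f : N.X ⟶ K) (p : ∀ j, N ⟶ M j) (hf : ∀ j, f ≫ k j = (p j).hom) :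
    N ⟶ liftMod K a M k hk ha :=
  mkHom f (hk _ _ fun j => by
    change (act N ≫ f) ≫ k j = (A ◁ f ≫ a) ≫ k j
    rw [Category.assoc, hf, Category.assoc, ha, ← whiskerLeft_comp_assoc, hf, act_hom])

end ModConstructions

section ModPreadditive

variable {C : Type u} [Category.{v} C] [MonoidalCategory C] {A : C} [MonObj A] [Preadditive C]
  [MonoidalPreadditive C]

lemma sum_hom {M N : Mod C A} {J : Type*} (s : Finset J) (f : J → (M ⟶ N)) :
    (∑ j ∈ s, f j).hom = ∑ j ∈ s, (f j).hom :=
  map_sum (homAddHom M N) f s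

/-- The object splitting the underlying idempotent carries the compressed action `A ⊗ K ⟶ A ⊗ M ⟶ M
⟶ K`. The inclusion intertwines it with the action on `M` because `p` is a module morphism. -/
instance [IsIdempotentComplete C] : IsIdempotentComplete (Mod C A) where
  idempotents_split M p hp := by
    obtain ⟨K, i, e, hie, hei⟩ := IsIdempotentComplete.idempotents_split M.X p.hom
      (congrArg Mod.Hom.hom hp)
    have hip : i ≫ p.hom = i := by rw [← hei, reassoc_of% hie]
    have hk : ∀ {Z : C} (x y : Z ⟶ K), (∀ _ : Unit, x ≫ i = y ≫ i) → x = y := fun x y h => by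
      simpa [hie] using congrArg (· ≫ e) (h ())
    have ha : ∀ _ : Unit, (A ◁ i ≫ act M ≫ e) ≫ i = A ◁ i ≫ act M := fun _ => by
      simp only [Category.assoc]
      rw [hei, act_hom, ← whiskerLeft_comp_assoc, hip]
    refine ⟨liftMod K (A ◁ i ≫ act M ≫ e) (fun _ : Unit => M) (fun _ => i) hk ha,
      liftModProj K _ _ _ hk ha (), liftModLift K _ _ _ hk ha M e (fun _ => p) (fun _ => hei),
      ?_, ?_⟩
    · ext
      exact hie
    · ext
      exact hei

instance [HasFiniteBiproducts C] : HasFiniteBiproducts (Mod C A) :=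
  hasFiniteBiproducts_of_total fun n f => by
    let K : C := ⨁ fun j => (f j).X
    let a : A ⊗ K ⟶ K := biproduct.lift fun j => A ◁ biproduct.π (fun j => (f j).X) j ≫ act (f j)
    have hk : ∀ {Z : C} (x y : Z ⟶ K), (∀ j, x ≫ biproduct.π (fun j => (f j).X) j =
        y ≫ biproduct.π (fun j => (f j).X) j) → x = y := fun x y h => biproduct.hom_ext _ _ h
    have ha : ∀ j, a ≫ biproduct.π (fun j => (f j).X) j =
        A ◁ biproduct.π (fun j => (f j).X) j ≫ act (f j) := fun j => biproduct.lift_π _ _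
    have hi : ∀ i j, biproduct.ι (fun j => (f j).X) i ≫ biproduct.π (fun j => (f j).X) j =
        (if h : i = j then eqToHom (by rw [h]) else 0 : f i ⟶ f j).hom := fun i j => by
      by_cases h : i = j
      · subst h
        simp
      · simp [h, biproduct.ι_π_ne _ h]
    refine ⟨⟨liftMod K a f _ hk ha, liftModProj K a f _ hk ha,
      fun i => liftModLift K a f _ hk ha (f i) (biproduct.ι (fun j => (f j).X) i)
        (fun j => if h : i = j then eqToHom (by rw [h]) else 0) (hi i), fun i j => ?_⟩, ?_⟩
    · ext
      refine (hi i j).trans ?_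
      congr
    · ext
      rw [sum_hom]
      exact biproduct.total

end ModPreadditive

/-! ### Averaging over the Casimir element of a rigid algebra -/

section Casimir

variable {C : Type u} [Category.{v} C] [MonoidalCategory C] {A : C} [MonObj A]

/-- The map `x ↦ ∑ i₁ ⊗ i₂ x`, where `∑ i₁ ⊗ i₂` is the element `i` of `A ⊗ A`. -/
def casimirMap (i : 𝟙_ C ⟶ A ⊗ A) (M : Mod C A) : M.X ⟶ A ⊗ M.X :=
  (λ_ M.X).inv ≫ i ▷ M.X ≫ (α_ A A M.X).hom ≫ A ◁ act M

lemma casimirMap_naturality (i : 𝟙_ C ⟶ A ⊗ A) {M N : Mod C A} (f : M ⟶ N) :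
    f.hom ≫ casimirMap i N = casimirMap i M ≫ A ◁ f.hom := by
  simp only [casimirMap, Category.assoc]
  rw [← whiskerLeft_comp, act_hom, leftUnitor_inv_naturality_assoc, whisker_exchange_assoc]
  simp

/-- `i` is a Casimir element: `∑ a i₁ ⊗ i₂ = ∑ i₁ ⊗ i₂ a`. -/
def IsCasimir (i : 𝟙_ C ⟶ A ⊗ A) : Prop :=
  (ρ_ A).inv ≫ A ◁ i ≫ (α_ A A A).inv ≫ MonObj.mul ▷ A =
    (λ_ A).inv ≫ i ▷ A ≫ (α_ A A A).hom ≫ A ◁ MonObj.mul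

/-- The left side of the Casimir identity is the transpose of the multiplication under the duality
of `A` with itself, so it suffices to transpose the right side back. The pairing is `e` after
multiplication, hence invariant by associativity, and the zigzag identity then leaves the
multiplication. -/
lemma IsCasimir.of_exactPairing (p : ExactPairing A A) (e : A ⟶ 𝟙_ C)
    (he : p.evaluation' = MonObj.mul ≫ e) : IsCasimir p.coevaluation' := by
  have key : ((λ_ A).inv ≫ p.coevaluation' ▷ A ≫ (α_ A A A).hom ≫ A ◁ MonObj.mul) ▷ A ≫
      (α_ A A A).hom ≫ A ◁ p.evaluation' ≫ (ρ_ A).hom = MonObj.mul := by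
    have h := p.evaluation_coevaluation'
    rw [he] at h ⊢
    calc _ = (λ_ A).inv ▷ A ≫ p.coevaluation' ▷ A ▷ A ≫ (α_ A A A).hom ▷ A ≫ (α_ A _ A).hom ≫
          A ◁ ((MonObj.mul ▷ A ≫ MonObj.mul) ≫ e) ≫ (ρ_ A).hom := by monoidal
      _ = (λ_ (A ⊗ A)).inv ≫ p.coevaluation' ▷ (A ⊗ A) ≫ (A ⊗ A) ◁ MonObj.mul ≫
          (α_ A A A).hom ≫ A ◁ (MonObj.mul ≫ e) ≫ (ρ_ A).hom := by
        rw [MonObj.mul_assoc]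
        monoidal
      _ = MonObj.mul := by
        rw [← whisker_exchange_assoc, reassoc_of% h]
        simp
  refine ((tensorRightHomEquiv A A A A).eq_symm_apply (y := MonObj.mul)).mp ?_
  exact key.symm

/-- The Casimir identity, pushed from `A` to `M`: `∑ i₁ ⊗ i₂ a x = ∑ a i₁ ⊗ i₂ x`. This is what
makes an average of arbitrary morphisms of `C` linear over `A`. -/
lemma IsCasimir.act_casimirMap {i : 𝟙_ C ⟶ A ⊗ A} (hi : IsCasimir i) (M : Mod C A) :
    act M ≫ casimirMap i M =
      A ◁ casimirMap i M ≫ (α_ A A M.X).inv ≫ MonObj.mul ▷ M.X := by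
  have h : ((ρ_ A).inv ≫ A ◁ i ≫ (α_ A A A).inv ≫ MonObj.mul ▷ A) ▷ M.X ≫ (α_ A A M.X).hom ≫
      A ◁ act M = ((λ_ A).inv ≫ i ▷ A ≫ (α_ A A A).hom ≫ A ◁ MonObj.mul) ▷ M.X ≫
      (α_ A A M.X).hom ≫ A ◁ act M := by rw [hi]
  calc act M ≫ casimirMap i M = (λ_ (A ⊗ M.X)).inv ≫ (𝟙_ C) ◁ act M ≫ i ▷ M.X ≫
        (α_ A A M.X).hom ≫ A ◁ act M := by simp [casimirMap]
    _ = (λ_ (A ⊗ M.X)).inv ≫ i ▷ (A ⊗ M.X) ≫ (α_ A A (A ⊗ M.X)).hom ≫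
        A ◁ ((α_ A A M.X).inv ≫ (α_ A A M.X).hom ≫ A ◁ act M ≫ act M) := by
      rw [whisker_exchange_assoc]
      simp
    _ = ((λ_ A).inv ≫ i ▷ A ≫ (α_ A A A).hom ≫ A ◁ MonObj.mul) ▷ M.X ≫
        (α_ A A M.X).hom ≫ A ◁ act M := by
      rw [← mul_act]
      monoidal
    _ = _ := by
      rw [← h]
      simp only [comp_whiskerRight, Category.assoc, casimirMap, MonoidalCategory.whiskerLeft_comp]
      rw [associator_naturality_left_assoc, ← whisker_exchange]
      monoidal

variable [Preadditive C] [MonoidalPreadditive C] [Linear ℂ C] [MonoidalLinear ℂ C]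

lemma casimirMap_act {i : 𝟙_ C ⟶ A ⊗ A} {z : ℂ} (hz : i ≫ MonObj.mul = z • MonObj.one)
    (M : Mod C A) : casimirMap i M ≫ act M = z • 𝟙 M.X := by
  have h := mul_act M
  simp only [casimirMap, Category.assoc]
  rw [← h, ← comp_whiskerRight_assoc, hz]
  simp

/-- The average `x ↦ ∑ i₁ s(i₂ x)` of a morphism `s`. -/
def average {i : 𝟙_ C ⟶ A ⊗ A} (hi : IsCasimir i) {M N : Mod C A} (s : M.X ⟶ N.X) : M ⟶ N :=
  mkHom (casimirMap i M ≫ A ◁ s ≫ act N) (by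
    rw [← Category.assoc, hi.act_casimirMap]
    simp only [Category.assoc, MonoidalCategory.whiskerLeft_comp]
    rw [← whisker_exchange_assoc, mul_act]
    simp)

/-- A module morphism `f` can be moved into the average, so `f ≫ average g ≫ f` is the average of `f
≫ g ≫ f = f`, which is `z • f`. Dividing by `z` gives a quasi-inverse in `Rep A`. -/
lemma allRegular_mod {i : 𝟙_ C ⟶ A ⊗ A} (hi : IsCasimir i) {z : ℂ} (hz0 : z ≠ 0)
    (hz : i ≫ MonObj.mul = z • MonObj.one) (hC : AllRegular C) : AllRegular (Mod C A) := by
  intro M N f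
  obtain ⟨g, hg⟩ := hC _ _ f.hom
  refine ⟨z⁻¹ • average hi g, ?_⟩
  ext
  have h1 : f.hom ≫ (average hi g).hom ≫ f.hom = z • f.hom := by
    change f.hom ≫ (casimirMap i N ≫ A ◁ g ≫ act M) ≫ f.hom = z • f.hom
    simp only [Category.assoc]
    rw [act_hom, ← whiskerLeft_comp_assoc, reassoc_of% (casimirMap_naturality i f),
      ← whiskerLeft_comp_assoc, hg, ← act_hom, reassoc_of% (casimirMap_act hz M)]
    simp
  simp [h1, smul_smul, inv_mul_cancel₀ hz0]

end Casimir

/-! ### Rigid algebras have a Casimir element -/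

section Rigid

variable {C : Type u} [Category.{v} C] [MonoidalCategory C] [BraidedCategory C]

/-- The composite `𝟙 ⟶ X ⊗ Y ⟶ Y ⊗ X ⟶ 𝟙` does not depend on the dual `Y` of `X`. -/
lemma coev_braiding_ev_eq {X Y Z : C} (p : ExactPairing X Y) (q : ExactPairing X Z) :
    p.coevaluation' ≫ (β_ X Y).hom ≫ p.evaluation' =
      q.coevaluation' ≫ (β_ X Z).hom ≫ q.evaluation' := by
  -- This is the canonical comparison of two duals of `X`. It carries one copairing to the other and
  -- one pairing to the other, and naturality of the braiding moves it across.
  let f : Y ⟶ Z := (ρ_ Y).inv ≫ Y ◁ q.coevaluation' ≫ (α_ Y X Z).inv ≫ p.evaluation' ▷ Z ≫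
    (λ_ Z).hom
  have h1 : p.coevaluation' ≫ X ◁ f = q.coevaluation' := by
    have h := p.evaluation_coevaluation'
    calc _ = (ρ_ _).inv ≫ p.coevaluation' ▷ 𝟙_ C ≫ (X ⊗ Y) ◁ q.coevaluation' ≫ (α_ X Y _).hom ≫
          X ◁ (α_ Y X Z).inv ≫ X ◁ p.evaluation' ▷ Z ≫ X ◁ (λ_ Z).hom := by
          simp only [f]
          monoidal
      _ = q.coevaluation' ≫ (λ_ _).inv ≫ (α_ _ _ _).inv ≫ (p.coevaluation' ▷ X ≫
          (α_ X Y X).hom ≫ X ◁ p.evaluation') ▷ Z ≫ (α_ _ _ _).hom ≫ X ◁ (λ_ Z).hom := by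
          rw [← whisker_exchange_assoc]
          monoidal
      _ = _ := by
          rw [h]
          monoidal
  have h2 : f ▷ X ≫ q.evaluation' = p.evaluation' := by
    have h := q.evaluation_coevaluation'
    calc _ = (ρ_ Y).inv ▷ X ≫ (Y ◁ q.coevaluation') ▷ X ≫ (α_ Y X Z).inv ▷ X ≫
          (α_ _ _ _).hom ≫ (p.evaluation' ▷ (Z ⊗ X) ≫ (𝟙_ C) ◁ q.evaluation') ≫ (λ_ _).hom := by
          simp only [f]
          monoidal
      _ = Y ◁ (λ_ X).inv ≫ Y ◁ (q.coevaluation' ▷ X ≫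
          (α_ X Z X).hom ≫ X ◁ q.evaluation') ≫ (α_ Y X _).inv ≫ p.evaluation' ▷ _ ≫
          (λ_ _).hom := by
          rw [← whisker_exchange]
          monoidal
      _ = _ := by
          rw [h]
          monoidal
  rw [← h1, ← h2]
  simp

end Rigid

/-- The Casimir element is the copairing. Its product lies in the line `Hom(𝟙, A)`, so it is `z`
times the unit. Composed with `e` it becomes the quantum dimension, once the trivial twist has been
removed and the braiding absorbed into the commutative product. Hence `z ≠ 0`. -/
lemma IsRigidAlgebra.exists_casimir {C : Type u} [Category.{v} C] [Abelian C] [Linear ℂ C]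
    [MonoidalCategory C] [BraidedCategory C] [RigidCategory C] [BalancedRigid C] {A : Mon C}
    [IsCommMonObj A.X] (hA : IsRigidAlgebra A) (hθ : theta A.X = 𝟙 A.X) :
    ∃ (i : 𝟙_ C ⟶ A.X ⊗ A.X) (z : ℂ), IsCasimir i ∧ z ≠ 0 ∧
      i ≫ MonObj.mul = z • MonObj.one := by
  obtain ⟨e, he, p, hp⟩ := hA.nondegenerate
  have hq : qdim A.X = p.coevaluation' ≫ MonObj.mul ≫ e := by
    have h := coev_braiding_ev_eq (C := C) (X := A.X) (inferInstance : ExactPairing A.X (A.Xᘁ)) p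
    have hc : (β_ A.X A.X).hom ≫ (MonObj.mul : A.X ⊗ A.X ⟶ A.X) = MonObj.mul :=
      IsCommMonObj.mul_comm A.X
    rw [hp, reassoc_of% hc] at h
    rw [← h, qdim, hθ, MonoidalCategory.id_whiskerRight, Category.id_comp]
    rfl
  -- If the unit of `A` vanished, `he` would make `𝟙 (𝟙_ C)` zero, and the dimension of `A` with it.
  have hone : (MonObj.one : 𝟙_ C ⟶ A.X) ≠ 0 := fun h0 => by
    rw [h0, zero_comp] at he
    apply hA.qdim_ne_zero
    rw [← Category.id_comp (qdim A.X), ← he, zero_comp]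
  obtain ⟨z, hz⟩ := (finrank_eq_one_iff_of_nonzero' _ hone).mp hA.finrank_unit
    (p.coevaluation' ≫ MonObj.mul)
  refine ⟨p.coevaluation', z, IsCasimir.of_exactPairing p e hp, fun h0 => hA.qdim_ne_zero ?_,
    hz.symm⟩
  rw [hq, ← Category.assoc, ← hz, h0]
  simp

/-! ### Semisimplicity of `Rep A` -/

section SemisimpleMod

variable {C : Type u} [Category.{v} C] [MonoidalCategory C] [Preadditive C]
  [MonoidalPreadditive C]

section

variable [Linear ℂ C] [MonoidalLinear ℂ C]

lemma finiteDimensional_mod_hom {A : C} [MonObj A]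
    (h : ∀ X Y : C, FiniteDimensional ℂ (X ⟶ Y)) (M N : Mod C A) :
    FiniteDimensional ℂ (M ⟶ N) :=
  have := h M.X N.X
  FiniteDimensional.of_injective (V₂ := M.X ⟶ N.X)
    { toFun := fun f : M ⟶ N => f.hom
      map_add' := fun _ _ => rfl
      map_smul' := fun _ _ => rfl } (fun _ _ hfg => Mod.hom_ext _ _ hfg)

/-- What is used about `Rep A`: it has finite dimensional spaces of morphisms and quasi-inverses. -/
structure IsSemisimpleAlg (A : Mon C) : Prop where
  finiteDimensional : ∀ M N : Mod C A.X, FiniteDimensional ℂ (M ⟶ N)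
  allRegular : AllRegular (Mod C A.X)

end

variable {G : Type w} [Group G] {A : Mon C} {π : G →* Aut A} (c : Choice π)

namespace Choice

lemma simple_X (s : SimpleClass π) : Simple (c.X s) := by
  obtain ⟨M, hM, h⟩ := s.2
  have : Nonempty (c.X s ≅ M) := Quotient.exact (s := isIsomorphicSetoid (Mod C A.X))
    ((c.mk_X s).trans h.symm)
  exact Simple.of_iso this.some

lemma exists_iso_X (π : G →* Aut A) (c : Choice π) (M : Mod C A.X) (hM : Simple M) :
    ∃ s : SimpleClass π, Nonempty (M ≅ c.X s) :=
  let s : SimpleClass π := ⟨Quotient.mk (isIsomorphicSetoid (Mod C A.X)) M, M, hM, rfl⟩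
  ⟨s, Quotient.exact (s := isIsomorphicSetoid (Mod C A.X)) (c.mk_X s).symm⟩

lemma eq_of_iso {s t : SimpleClass π} (e : c.X s ≅ c.X t) : s = t := by
  apply Subtype.ext
  rw [← c.mk_X s, ← c.mk_X t]
  exact Quotient.sound (s := isIsomorphicSetoid (Mod C A.X)) ⟨e⟩

lemma id_X_ne_zero (s : SimpleClass π) : 𝟙 (c.X s) ≠ 0 := by
  have := c.simple_X s
  exact id_nonzero _

lemma id_X_hom_ne_zero (s : SimpleClass π) : 𝟙 (c.X s).X ≠ 0 := fun h =>
  c.id_X_ne_zero s (Mod.hom_ext _ _ h)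

variable [Linear ℂ C] [MonoidalLinear ℂ C] [IsIdempotentComplete C] (hA : IsSemisimpleAlg A)
include hA

lemma hom_eq_zero {s t : SimpleClass π} (h : s ≠ t) (a : c.X s ⟶ c.X t) : a = 0 := by
  have := hA.allRegular.hasKernels
  have := c.simple_X s
  have := c.simple_X t
  by_contra h0
  have := isIso_of_hom_simple h0
  exact h (c.eq_of_iso (asIso a))

lemma exists_smul_id {s : SimpleClass π} (a : c.X s ⟶ c.X s) : ∃ z : ℂ, z • 𝟙 (c.X s) = a := by
  have := hA.allRegular.hasKernels
  have := c.simple_X s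
  have := hA.finiteDimensional (c.X s) (c.X s)
  exact endomorphism_simple_eq_smul_id ℂ a

/-- Every module is a finite sum of modules `X_s`. -/
lemma exists_decomposition (M : Mod C A.X) : ∃ (n : ℕ) (s : Fin n → SimpleClass π)
    (p : ∀ k, M ⟶ c.X (s k)) (i : ∀ k, c.X (s k) ⟶ M), ∑ k, p k ≫ i k = 𝟙 M := by
  have := hA.finiteDimensional
  obtain ⟨ι, _, S, p, i, hS, h⟩ := hA.allRegular.sumOfSimples M
  choose s e using fun k => c.exists_iso_X π (S k) (hS k)
  let f := (Fintype.equivFin ι).symm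
  refine ⟨_, fun k => s (f k), fun k => p (f k) ≫ (e (f k)).some.hom,
    fun k => (e (f k)).some.inv ≫ i (f k), ?_⟩
  rw [← h, ← f.sum_comp]
  simp

/-- The morphisms from the modules `X_s` to `M` are jointly epic in `C`. -/
lemma hom_ext_X {M : Mod C A.X} {Z : C} {x y : M.X ⟶ Z}
    (h : ∀ s (a : c.X s ⟶ M), a.hom ≫ x = a.hom ≫ y) : x = y := by
  obtain ⟨n, s, p, i, hpi⟩ := c.exists_decomposition hA M
  have hpi' := congrArg Mod.Hom.hom hpi
  rw [sum_hom] at hpi'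
  rw [← Category.id_comp x, ← Category.id_comp y]
  change (𝟙 M : M ⟶ M).hom ≫ x = (𝟙 M : M ⟶ M).hom ≫ y
  rw [← hpi']
  simp [Preadditive.sum_comp, h]

/-- A morphism of modules is determined by, and can be prescribed by, linear maps on the spaces
`Hom_A(X_s, M)`. -/
lemma existsUnique_hom (M N : Mod C A.X) (T : ∀ s, (c.X s ⟶ M) →ₗ[ℂ] (c.X s ⟶ N)) :
    ∃! m : M ⟶ N, ∀ s a, a ≫ m = T s a := by
  obtain ⟨n, s, p, i, hpi⟩ := c.exists_decomposition hA M
  refine ⟨∑ k, p k ≫ T _ (i k), fun t a => ?_, fun m hm => ?_⟩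
  -- By Schur's lemma `a ≫ p k` is zero or a scalar, so the linear maps `T` commute with
  -- precomposition by it.
  · have key : ∀ k, (a ≫ p k) ≫ T _ (i k) = T t ((a ≫ p k) ≫ i k) := fun k => by
      generalize a ≫ p k = b
      generalize i k = j
      revert b j
      generalize s k = r
      intro b j
      by_cases h : t = r
      · subst h
        obtain ⟨z, rfl⟩ := c.exists_smul_id hA b
        simp
      · rw [c.hom_eq_zero hA h b]
        simp
    rw [Preadditive.comp_sum]
    simp only [← Category.assoc, key]
    rw [← map_sum]
    simp only [Category.assoc, ← Preadditive.comp_sum, hpi, Category.comp_id]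
  · rw [← Category.id_comp m, ← hpi, Preadditive.sum_comp]
    simp [hm]

end Choice

end SemisimpleMod

/-! ### The category `D` is abelian -/

namespace EquivMod

section

variable {C : Type u} [Category.{v} C] [MonoidalCategory C] {G : Type w} [Group G] {A : Mon C}
  {π : G →* Aut A}

@[simp]
lemma φ_comp_φ_inv (Y : EquivMod π) (g : G) : Y.φ g ≫ Y.φ g⁻¹ = 𝟙 _ := by
  rw [← Y.φ_mul, inv_mul_cancel, Y.φ_one]

@[simp]
lemma φ_comp_φ_inv_assoc (Y : EquivMod π) (g : G) {Z : C} (f : Y.M.X ⟶ Z) :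
    Y.φ g ≫ Y.φ g⁻¹ ≫ f = f := by
  rw [← Category.assoc, φ_comp_φ_inv, Category.id_comp]

/-- An object of `D` from a module `K` with a jointly monic family of morphisms to objects of `D`
and compatible endomorphisms. -/
def lift {J : Type*} (K : Mod C A.X) (φ : G → (K.X ⟶ K.X)) (Y : J → EquivMod π)
    (k : ∀ j, K ⟶ (Y j).M)
    (hk : ∀ {Z : C} (x y : Z ⟶ K.X), (∀ j, x ≫ (k j).hom = y ≫ (k j).hom) → x = y)
    (hφ : ∀ g j, φ g ≫ (k j).hom = (k j).hom ≫ (Y j).φ g) : EquivMod π where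
  M := K
  φ := φ
  act_φ g := hk _ _ fun j => by
    simp only [Category.assoc]
    rw [hφ, act_hom, reassoc_of% (act_hom (k j)), (Y j).act_φ, ← id_tensorHom,
      tensorHom_comp_tensorHom_assoc, tensorHom_comp_tensorHom_assoc, hφ]
    simp
  φ_mul g h := hk _ _ fun j => by
    simp only [Category.assoc]
    rw [hφ, hφ, reassoc_of% (hφ h j), (Y j).φ_mul]
  φ_one := hk _ _ fun j => by
    rw [hφ, (Y j).φ_one]
    simp

variable [Preadditive C] [MonoidalPreadditive C]

lemma sum_hom {Y Z : EquivMod π} {J : Type*} (s : Finset J) (f : J → (Y ⟶ Z)) :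
    (∑ j ∈ s, f j).hom = ∑ j ∈ s, (f j).hom :=
  map_sum (homAddHom Y Z) f s

/-- The splitting in `Rep A` inherits the compressed maps `i ≫ φ g ≫ e`. They are compatible with
`i` and `e` because `p` commutes with `φ g`. -/
instance [IsIdempotentComplete C] : IsIdempotentComplete (EquivMod π) where
  idempotents_split Y p hp := by
    obtain ⟨K, i, e, hie, hei⟩ := IsIdempotentComplete.idempotents_split Y.M p.hom
      (congrArg Hom.hom hp)
    have hip : i ≫ p.hom = i := by rw [← hei, reassoc_of% hie]
    have hpe : p.hom ≫ e = e := by rw [← hei, Category.assoc, hie, Category.comp_id]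
    have hie' : i.hom ≫ e.hom = 𝟙 K.X := congrArg Mod.Hom.hom hie
    have hei' : e.hom ≫ i.hom = p.hom.hom := congrArg Mod.Hom.hom hei
    have hip' : i.hom ≫ p.hom.hom = i.hom := congrArg Mod.Hom.hom hip
    have hpe' : p.hom.hom ≫ e.hom = e.hom := congrArg Mod.Hom.hom hpe
    refine ⟨lift K (fun g => i.hom ≫ Y.φ g ≫ e.hom) (fun _ : Unit => Y) (fun _ => i)
      (fun x y h => by simpa [hie'] using congrArg (· ≫ e.hom) (h ())) (fun g _ => ?_),
      ⟨i, fun g => ?_⟩, ⟨e, fun g => ?_⟩, ?_, ?_⟩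
    · simp only [Category.assoc]
      rw [hei', p.comm, reassoc_of% hip']
    · change (i.hom ≫ Y.φ g ≫ e.hom) ≫ i.hom = i.hom ≫ Y.φ g
      simp only [Category.assoc]
      rw [hei', p.comm, reassoc_of% hip']
    · change Y.φ g ≫ e.hom = e.hom ≫ i.hom ≫ Y.φ g ≫ e.hom
      rw [reassoc_of% hei', ← reassoc_of% (p.comm g), hpe']
    · ext1
      exact hie
    · ext1
      exact hei

instance [HasFiniteBiproducts C] : HasFiniteBiproducts (EquivMod π) :=
  hasFiniteBiproducts_of_total fun n f => by
    let K : Mod C A.X := ⨁ fun j => (f j).M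
    let p : ∀ j, K ⟶ (f j).M := fun j => biproduct.π (fun j => (f j).M) j
    let i : ∀ j, (f j).M ⟶ K := fun j => biproduct.ι (fun j => (f j).M) j
    have tot : ∑ j, p j ≫ i j = 𝟙 K := biproduct.total
    have tot' : ∑ j, (p j).hom ≫ (i j).hom = 𝟙 K.X := by
      have := congrArg Mod.Hom.hom tot
      rwa [Orbifold.sum_hom] at this
    have ip : ∀ j k, i j ≫ p k = (if h : j = k then eqToHom (by rw [h]) else 0 : f j ⟶ f k).hom :=
      fun j k => by
        by_cases h : j = k
        · subst h
          simp [i, p]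
        · simp only [h, dite_false]
          exact biproduct.ι_π_ne _ h
    have ip1 : ∀ j, i j ≫ p j = 𝟙 _ := fun j => biproduct.ι_π_self _ j
    have ip0 : ∀ j k, j ≠ k → i j ≫ p k = 0 := fun j k h => biproduct.ι_π_ne _ h
    let φ : G → (K.X ⟶ K.X) := fun g => ∑ j, (p j).hom ≫ (f j).φ g ≫ (i j).hom
    have hp : ∀ g j, φ g ≫ (p j).hom = (p j).hom ≫ (f j).φ g := fun g j => by
      simp only [φ, Preadditive.sum_comp, Category.assoc]
      rw [Finset.sum_eq_single j]
      · rw [← Mod.comp_hom', ip1]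
        simp
      · intro k _ hk
        rw [← Mod.comp_hom' (i k), ip0 k j hk]
        simp
      · simp
    have hi : ∀ g j, (f j).φ g ≫ (i j).hom = (i j).hom ≫ φ g := fun g j => by
      simp only [φ, Preadditive.comp_sum]
      rw [Finset.sum_eq_single j]
      · rw [← Category.assoc, ← Mod.comp_hom', ip1]
        simp
      · intro k _ hk
        rw [← Category.assoc, ← Mod.comp_hom', ip0 j k hk.symm]
        simp
      · simp
    refine ⟨⟨lift K φ f p (fun x y h => ?_) hp, fun j => ⟨p j, fun g => hp g j⟩,
      fun j => ⟨i j, fun g => hi g j⟩, fun j k => ?_⟩, ?_⟩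
    · rw [← Category.comp_id x, ← Category.comp_id y, ← tot', Preadditive.comp_sum,
        Preadditive.comp_sum]
      simp [reassoc_of% h]
    · ext1
      refine (ip j k).trans ?_
      congr
    · ext1
      rw [sum_hom]
      exact tot

end

/-! ### Averaging over the group. -/

section Average

variable {C : Type u} [Category.{v} C] [MonoidalCategory C] {G : Type w} [Group G] {A : Mon C}
  {π : G →* Aut A}

/-- The conjugate `φ_Z(g)⁻¹ ∘ m ∘ φ_Y(g)` of a morphism of modules. -/
def conjHom {Y Z : EquivMod π} (m : Y.M ⟶ Z.M) (g : G) : Y.M ⟶ Z.M :=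
  mkHom (Y.φ g ≫ m.hom ≫ Z.φ g⁻¹) (by
    rw [reassoc_of% (Y.act_φ g), reassoc_of% (act_hom m), Z.act_φ, ← id_tensorHom,
      ← id_tensorHom, tensorHom_comp_tensorHom_assoc, tensorHom_comp_tensorHom_assoc,
      Category.comp_id, ← aut_mul_hom, inv_mul_cancel, aut_one_hom, Category.assoc])

lemma conjHom_hom {Y Z : EquivMod π} (m : Y.M ⟶ Z.M) (g : G) :
    (conjHom m g).hom = Y.φ g ≫ m.hom ≫ Z.φ g⁻¹ := rfl

attribute [local instance] Fintype.ofFinite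

variable [Preadditive C] [MonoidalPreadditive C] [Finite G]

/-- The sum of all conjugates of a morphism of modules, a morphism of `D`. -/
def sumConj {Y Z : EquivMod π} (m : Y.M ⟶ Z.M) : Y ⟶ Z where
  hom := ∑ g, conjHom m g
  comm h := by
    simp only [Orbifold.sum_hom, Preadditive.comp_sum, Preadditive.sum_comp, conjHom_hom]
    refine Fintype.sum_equiv (Equiv.mulRight h) _ _ fun g => ?_
    simp only [Equiv.coe_mulRight, Category.assoc, Y.φ_mul, mul_inv_rev, Z.φ_mul]
    rw [← Z.φ_mul h h⁻¹, mul_inv_cancel, Z.φ_one, Category.comp_id]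

/-- Since `f` commutes with `φ`, placing it on both sides of a conjugate of `m` gives the conjugate
of `f ≫ m ≫ f = f`, which is `f` itself. Each element of `G` thus contributes one copy of `f`. -/
lemma comp_sumConj_comp {Y Z : EquivMod π} (f : Y ⟶ Z) (m : Z.M ⟶ Y.M)
    (h : f.hom ≫ m ≫ f.hom = f.hom) : f ≫ sumConj m ≫ f = Nat.card G • f := by
  have h' : f.hom.hom ≫ m.hom ≫ f.hom.hom = f.hom.hom := congrArg Mod.Hom.hom h
  ext1
  change f.hom ≫ (∑ g, conjHom m g) ≫ f.hom = Nat.card G • f.hom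
  rw [Preadditive.sum_comp, Preadditive.comp_sum, Nat.card_eq_fintype_card]
  refine Finset.sum_eq_card_nsmul fun g _ => ?_
  ext1
  simp only [Mod.comp_hom', conjHom_hom, Category.assoc]
  rw [f.comm, ← reassoc_of% (f.comm g), reassoc_of% h', ← f.comm, φ_comp_φ_inv_assoc]

/-- Maschke's argument: the order of `G` is invertible in `ℂ`, so the mean of the conjugates of a
quasi-inverse in `Rep A` is a quasi-inverse in `D`. -/
lemma allRegular [Linear ℂ C] [MonoidalLinear ℂ C] (h : AllRegular (Mod C A.X)) :
    AllRegular (EquivMod π) := fun Y Z f => by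
  obtain ⟨m, hm⟩ := h _ _ f.hom
  refine ⟨(Nat.card G : ℂ)⁻¹ • sumConj m, ?_⟩
  rw [Linear.smul_comp, Linear.comp_smul, comp_sumConj_comp f m hm, ← Nat.cast_smul_eq_nsmul ℂ,
    smul_smul, inv_mul_cancel₀ (by simp), one_smul]

end Average

end EquivMod

/-! ### The cocycle of the projective action -/

namespace Choice

section

variable {C : Type u} [Category.{v} C] [MonoidalCategory C] [Preadditive C]
  [MonoidalPreadditive C] {G : Type w} [Group G] {A : Mon C} {π : G →* Aut A} (c : Choice π)

/-- Linearity on the twisted module `X_s^{g⁻¹}` becomes `π g`-semilinearity on `X_s`. In this form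
the maps for different `g` can be composed in `C`. -/
lemma act_f (g : G) {s t : SimpleClass π} (h : g • s = t) :
    act (c.X s) ≫ c.f g h = ((π g).hom.hom ⊗ₘ c.f g h) ≫ act (c.X t) := by
  have := act_hom (c.iso g h).hom
  change ((π g⁻¹).hom.hom ▷ (c.X s).X ≫ act (c.X s)) ≫ c.f g h = A.X ◁ c.f g h ≫ act (c.X t) at this
  rw [MonoidalCategory.tensorHom_def, Category.assoc, ← this, Category.assoc, ← comp_whiskerRight_assoc,
    ← aut_mul_hom, inv_mul_cancel, aut_one_hom]
  simp

lemma act_finv (g : G) {s t : SimpleClass π} (h : g • s = t) :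
    act (c.X t) ≫ c.finv g h = ((π g⁻¹).hom.hom ⊗ₘ c.finv g h) ≫ act (c.X s) :=
  act_hom (c.iso g h).inv |>.trans (by
    change A.X ◁ c.finv g h ≫ (π g⁻¹).hom.hom ▷ (c.X s).X ≫ act (c.X s) = _
    rw [MonoidalCategory.tensorHom_def', Category.assoc])

lemma f_ne_zero (g : G) {s t : SimpleClass π} (h : g • s = t) : c.f g h ≠ 0 := fun h0 =>
  c.id_X_hom_ne_zero s (by rw [← c.f_finv g h, h0, zero_comp])

lemma f_congr {g g' : G} (hg : g = g') {s t : SimpleClass π} (h : g • s = t)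
    (h' : g' • s = t) : c.f g h = c.f g' h' := by
  subst hg
  rfl

variable [Linear ℂ C] [MonoidalLinear ℂ C] [IsIdempotentComplete C] (hA : IsSemisimpleAlg A)
include hA

/-- The composite `φ(gh)⁻¹ φ(g) φ(h)` is linear because the semilinearities cancel. By Schur's lemma
it is a scalar on `X_s`, and this scalar is nonzero because the maps involved are invertible. -/
lemma exists_unit (g h : G) {s t r : SimpleClass π} (hst : h • s = t) (htr : g • t = r) :
    ∃ z : ℂˣ, c.f h hst ≫ c.f g htr =
      (z : ℂ) • c.f (g * h) (by rw [mul_smul, hst, htr] : (g * h) • s = r) := by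
  have hr : (g * h) • s = r := by rw [mul_smul, hst, htr]
  let e : c.X s ⟶ c.X s := mkHom (c.f h hst ≫ c.f g htr ≫ c.finv (g * h) hr) (by
    rw [reassoc_of% (c.act_f h hst), reassoc_of% (c.act_f g htr), c.act_finv,
      tensorHom_comp_tensorHom_assoc, tensorHom_comp_tensorHom_assoc, ← aut_mul_hom,
      ← aut_mul_hom, Category.assoc, inv_mul_cancel, aut_one_hom, id_tensorHom])
  obtain ⟨z, hz⟩ := c.exists_smul_id hA e
  have hz' : z • 𝟙 (c.X s).X = c.f h hst ≫ c.f g htr ≫ c.finv (g * h) hr :=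
    congrArg Mod.Hom.hom hz
  have key : c.f h hst ≫ c.f g htr = z • c.f (g * h) hr := by
    have := congrArg (· ≫ c.f (g * h) hr) hz'
    simpa [c.finv_f] using this.symm
  have hz0 : z ≠ 0 := fun h0 => c.f_ne_zero g htr (c.f_cancel h hst (by
    rw [key, h0, zero_smul, comp_zero]))
  exact ⟨Units.mk0 z hz0, key⟩

omit [MonoidalLinear ℂ C] [IsIdempotentComplete C] hA in
lemma smul_f_injective (g : G) {s t : SimpleClass π} (h : g • s = t) {a b : ℂˣ}
    (hab : (a : ℂ) • c.f g h = (b : ℂ) • c.f g h) : a = b :=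
  Units.ext (smul_left_injective ℂ (c.f_ne_zero g h) hab)

/-- The cocycle identity comes from evaluating `φ(g)φ(h)φ(k)` with both bracketings and comparing
the coefficients of `φ(ghk)`. -/
lemma exists_cocycle : ∃ α : Cocycle G (SimpleClass π), c.IsCocycle α := by
  -- The value of `α(g, h)` is indexed by the target `r` of the composite, whose source is then `h⁻¹
  -- g⁻¹ r`.
  choose α hα using fun (g h : G) (r : SimpleClass π) =>
    c.exists_unit hA g h (smul_inv_smul h (g⁻¹ • r)) (smul_inv_smul g r)
  have key : ∀ (g h : G) (s t r : SimpleClass π) (hst : h • s = t) (htr : g • t = r),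
      c.f h hst ≫ c.f g htr =
        ((α g h r : ℂˣ) : ℂ) • c.f (g * h) (by rw [mul_smul, hst, htr] : (g * h) • s = r) := by
    intro g h s t r hst htr
    obtain rfl : t = g⁻¹ • r := by rw [← htr, inv_smul_smul]
    obtain rfl : s = h⁻¹ • g⁻¹ • r := by rw [← hst, inv_smul_smul]
    exact hα g h r
  refine ⟨⟨α, fun g h k r => ?_⟩, key⟩
  have h1 : g • g⁻¹ • r = r := smul_inv_smul _ _
  have h2 : h • h⁻¹ • g⁻¹ • r = g⁻¹ • r := smul_inv_smul _ _
  have h3 : k • k⁻¹ • h⁻¹ • g⁻¹ • r = h⁻¹ • g⁻¹ • r := smul_inv_smul _ _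
  have h4 : (g * (h * k)) • k⁻¹ • h⁻¹ • g⁻¹ • r = r := by simp [mul_smul]
  have e1 := c.f k h3 ≫= key g h _ _ _ h2 h1
  have e2 := key h k _ _ _ h3 h2 =≫ c.f g h1
  rw [Category.assoc, e1, Linear.comp_smul, key, Linear.smul_comp, key, smul_smul (_ : ℂ),
    smul_smul (_ : ℂ),    c.f_congr (mul_assoc g h k) _ h4] at e2
  rw [← Units.val_mul, ← Units.val_mul] at e2
  exact (c.smul_f_injective _ _ e2).symm

omit [MonoidalLinear ℂ C] [IsIdempotentComplete C] hA in
lemma IsCocycle.unique {α α' : Cocycle G (SimpleClass π)} (h : c.IsCocycle α)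
    (h' : c.IsCocycle α') : α' = α := by
  ext g k r : 4
  have e := h' g k _ _ r (smul_inv_smul k (g⁻¹ • r)) (smul_inv_smul g r)
  rw [h] at e
  exact (c.smul_f_injective _ _ e).symm

end

end Choice

/-! ### Realization of families of vector spaces with a projective action -/

namespace Choice

section

variable {C : Type u} [Category.{v} C] [MonoidalCategory C] [Preadditive C]
  [MonoidalPreadditive C] {G : Type w} [Group G] {A : Mon C} {π : G →* Aut A} (c : Choice π)
  [Linear ℂ C] [MonoidalLinear ℂ C]

omit [MonoidalLinear ℂ C] in
-- The choice of `φ_s(1)` is not normalized. From `φ(1)φ(1) = α(1,1)φ(1)` one cancels `φ(1)`.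
lemma IsCocycle.f_one {c : Choice π} {α : Cocycle G (SimpleClass π)} (hα : c.IsCocycle α)
    {s : SimpleClass π} (h : (1 : G) • s = s) :
    c.f 1 h = ((α.toFun 1 1 s : ℂˣ) : ℂ) • 𝟙 _ := by
  apply c.f_cancel 1 h
  have h1 := hα 1 1 s s s h h
  simp only [mul_one] at h1
  rw [h1, Linear.comp_smul, Category.comp_id]

/-- The morphism `X_s ⟶ M^g` given by `φ_s(g)` and a morphism `X_{gs} ⟶ M`. -/
def twistHom (g : G) {s t : SimpleClass π} (h : g • s = t) (M : Mod C A.X) :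
    (c.X t ⟶ M) →ₗ[ℂ] (c.X s ⟶ (twistBy π g).obj M) where
  toFun b := mkHom (M := c.X s) (N := (twistBy π g).obj M) (c.f g h ≫ b.hom) (by
    change act (c.X s) ≫ c.f g h ≫ b.hom =
      A.X ◁ (c.f g h ≫ b.hom) ≫ (π g).hom.hom ▷ M.X ≫ act M
    rw [reassoc_of% (c.act_f g h), act_hom, MonoidalCategory.tensorHom_def', whisker_exchange_assoc,
      MonoidalCategory.whiskerLeft_comp]
    simp only [Category.assoc]
    rw [whisker_exchange_assoc])
  map_add' b b' := by
    ext
    exact Preadditive.comp_add _ _ _ _ _ _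
  map_smul' z b := by
    ext
    exact Linear.comp_smul _ _ _ _ _ _

variable [IsIdempotentComplete C] (hA : IsSemisimpleAlg A)
include hA

open scoped Classical in
lemma finrank_hom (s t : SimpleClass π) :
    Module.finrank ℂ (c.X s ⟶ c.X t) = if s = t then 1 else 0 := by
  split_ifs with h
  · subst h
    have := c.simple_X s
    have := hA.allRegular.hasKernels
    have := hA.finiteDimensional (c.X s) (c.X s)
    exact finrank_endomorphism_simple_eq_one ℂ (c.X s)
  · have : Subsingleton (c.X s ⟶ c.X t) :=
      ⟨fun a b => by rw [c.hom_eq_zero hA h a, c.hom_eq_zero hA h b]⟩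
    exact Module.finrank_zero_of_subsingleton

variable [HasFiniteBiproducts C]

/-- The module `⨁_s V_s ⊠ X_s`. -/
lemma exists_sum_module (V : SimpleClass π → Type*) [∀ s, AddCommGroup (V s)]
    [∀ s, Module ℂ (V s)] [∀ s, FiniteDimensional ℂ (V s)] (hV : {s | Nontrivial (V s)}.Finite) :
    ∃ M : Mod C A.X, ∀ s, Nonempty (V s ≃ₗ[ℂ] (c.X s ⟶ M)) := by
  classical
  have := hV.to_subtype
  let F := {s // Nontrivial (V s)}
  have : Finite F := hV
  have := Fintype.ofFinite F
  -- Each `X_s` in the support is repeated `dim V_s` times. By Schur's lemma `Hom_A(X_s, ⨁ X)` then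
  -- has the dimension of `V_s`, and equality of dimensions suffices.
  let X : (Σ s : F, Fin (Module.finrank ℂ (V s))) → Mod C A.X := fun k => c.X k.1
  refine ⟨⨁ X, fun s => ?_⟩
  have := hA.finiteDimensional
  let e : (c.X s ⟶ ⨁ X) ≃ₗ[ℂ] (∀ k, c.X s ⟶ X k) :=
    { toFun := fun a k => a ≫ biproduct.π X k
      invFun := fun b => biproduct.lift b
      left_inv := fun a => biproduct.hom_ext _ _ fun k => by simp
      right_inv := fun b => by ext1 k; simp
      map_add' := fun a b => by ext1 k; simp
      map_smul' := fun z a => by ext1 k; simp }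
  refine ⟨LinearEquiv.ofFinrankEq _ _ ?_⟩
  rw [e.finrank_eq, Module.finrank_pi_fintype, Fintype.sum_sigma]
  simp only [X, c.finrank_hom hA, Finset.sum_const, Finset.card_univ, Fintype.card_fin]
  by_cases hs : Nontrivial (V s)
  · rw [Finset.sum_eq_single (⟨s, hs⟩ : F)]
    · simp
    · intro t _ ht
      rw [if_neg fun h => ht (Subtype.ext h.symm), smul_zero]
    · simp
  · rw [not_nontrivial_iff_subsingleton] at hs
    rw [Module.finrank_zero_of_subsingleton, Finset.sum_eq_zero]
    intro t _
    rw [if_neg, smul_zero]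
    rintro rfl
    exact not_nontrivial_iff_subsingleton.mpr hs t.2

end

end Choice

lemma finite_orbit {G : Type*} {T : Type*} [Group G] [Finite G] [MulAction G T]
    (o : MulAction.orbitRel.Quotient G T) : Finite o.orbit := by
  induction o using Quotient.inductionOn' with
  | h a => exact Set.finite_range _

/-- A projective action on a family of vector spaces indexed by the elements of the orbits of a
`G`-set: maps `V_s → V_{gs}` that compose up to the inverse of the cocycle `α`. -/
structure ProjectiveFamily {G : Type*} {T : Type*} [Group G] [MulAction G T] (α : Cocycle G T)
    (V : ∀ o : MulAction.orbitRel.Quotient G T, o.orbit → Type*) [∀ o s, AddCommGroup (V o s)]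
    [∀ o s, Module ℂ (V o s)] where
  ψ : ∀ o (g : G) {s t : o.orbit} (_ : g • s = t), V o s →ₗ[ℂ] V o t
  ψ_mul : ∀ o (g h : G) {s t r : o.orbit} (hst : h • s = t) (htr : g • t = r) (x : V o s),
    ψ o g htr (ψ o h hst x) = (((α.toFun g h r)⁻¹ : ℂˣ) : ℂ) •
      ψ o (g * h) (by rw [mul_smul, hst, htr] : (g * h) • s = r) x
  ψ_one : ∀ o {s : o.orbit} (h : (1 : G) • s = s) (x : V o s),
    ψ o 1 h x = (((α.toFun 1 1 s)⁻¹ : ℂˣ) : ℂ) • x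

namespace Choice

section

variable {C : Type u} [Category.{v} C] [MonoidalCategory C] [Preadditive C]
  [MonoidalPreadditive C] {G : Type w} [Group G] {A : Mon C} {π : G →* Aut A} {c : Choice π}
  [Linear ℂ C] [MonoidalLinear ℂ C] [IsIdempotentComplete C] (hA : IsSemisimpleAlg A)
  {α : Cocycle G (SimpleClass π)}
include hA

/-- `existsUnique_hom` for data indexed by the elements of the orbits. -/
lemma existsUnique_hom_orbit (c : Choice π) (M N : Mod C A.X)
    (T : ∀ (o : MulAction.orbitRel.Quotient G (SimpleClass π)) (s : o.orbit),
      (c.X s ⟶ M) →ₗ[ℂ] (c.X s ⟶ N)) :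
    ∃! m : M ⟶ N, ∀ o (s : o.orbit) (a : c.X s ⟶ M), a ≫ m = T o s a := by
  obtain ⟨m, hm, hu⟩ := c.existsUnique_hom hA M N fun s =>
    T (Quotient.mk'' s) ⟨s, MulAction.orbitRel.Quotient.mem_orbit.mpr rfl⟩
  refine ⟨m, ?_, fun m' hm' => hu m' fun s a => hm' _ ⟨s, _⟩ a⟩
  rintro o ⟨s, hs⟩ a
  obtain rfl := MulAction.orbitRel.Quotient.mem_orbit.mp hs
  exact hm s a

lemma hom_ext_X_orbit (c : Choice π) {M : Mod C A.X} {Z : C} {x y : M.X ⟶ Z}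
    (h : ∀ (o : MulAction.orbitRel.Quotient G (SimpleClass π)) (s : o.orbit)
      (a : c.X s ⟶ M), a.hom ≫ x = a.hom ≫ y) : x = y :=
  c.hom_ext_X hA fun s a =>
    h (Quotient.mk'' s) ⟨s, MulAction.orbitRel.Quotient.mem_orbit.mpr rfl⟩ a

variable [HasFiniteBiproducts C] [Finite G]

/-- Every family of finite dimensional vector spaces with finite support and with a projective
action is the family of spaces `Hom_A(X_s, Y)` for an object `Y` of `D`. -/
lemma IsCocycle.realize (hα : c.IsCocycle α)
    {V : ∀ o : MulAction.orbitRel.Quotient G (SimpleClass π), o.orbit → Type*}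
    [∀ o s, AddCommGroup (V o s)] [∀ o s, Module ℂ (V o s)] [∀ o s, FiniteDimensional ℂ (V o s)]
    (hV : {o | ∃ s, Nontrivial (V o s)}.Finite) (P : ProjectiveFamily α V) :
    ∃ (Y : EquivMod π) (i : ∀ (o : MulAction.orbitRel.Quotient G (SimpleClass π)) (s : o.orbit),
        V o s ≃ₗ[ℂ] (c.X s ⟶ Y.M)),
      ∀ o (g : G) (s t : o.orbit) (h : g • s = t) (x : V o s),
        i o t (P.ψ o g h x) = c.conj Y g (orbit_smul h) (i o s x) := by
  obtain ⟨M, hM⟩ := c.exists_sum_module hA (fun s => V (Quotient.mk'' s)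
    ⟨s, MulAction.orbitRel.Quotient.mem_orbit.mpr rfl⟩) (by
    refine (hV.biUnion fun o _ => @Set.toFinite _ o.orbit (finite_orbit o)).subset
      fun s hs => ?_
    rw [Set.mem_iUnion₂]
    exact ⟨Quotient.mk'' s, ⟨_, hs⟩, MulAction.orbitRel.Quotient.mem_orbit.mpr rfl⟩)
  have hi : ∀ o (s : o.orbit), Nonempty (V o s ≃ₗ[ℂ] (c.X s ⟶ M)) := by
    rintro o ⟨s, hs⟩
    obtain rfl := MulAction.orbitRel.Quotient.mem_orbit.mp hs
    exact hM s
  let i := fun o s => (hi o s).some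
  -- The semilinear map `φ(g)` to be built is a module morphism `M ⟶ M^g`, so it can be prescribed
  -- on the spaces `Hom_A(X_s, M)`: it sends `i(x)` to `i(ψ_g x) ∘ φ_s(g)`.
  choose m hm _ using fun g : G => existsUnique_hom_orbit hA c M ((twistBy π g).obj M)
    fun o s => c.twistHom g (orbit_smul (rfl : g • s = g • s)) M ∘ₗ (i o (g • s)).toLinearMap ∘ₗ
      P.ψ o g rfl ∘ₗ (i o s).symm.toLinearMap
  let φ : G → (M.X ⟶ M.X) := fun g => (m g).hom
  have hφ : ∀ o (g : G) (s t : o.orbit) (h : g • s = t) (x : V o s),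
      (i o s x).hom ≫ φ g = c.f g (orbit_smul h) ≫ (i o t (P.ψ o g h x)).hom := by
    rintro o g s _ rfl x
    have h1 := congrArg Mod.Hom.hom (hm g o s (i o s x))
    simp only [LinearMap.comp_apply, LinearEquiv.coe_coe, LinearEquiv.symm_apply_apply] at h1
    exact h1
  have ext : ∀ x y : M.X ⟶ M.X, (∀ o s (a : V o s), (i o s a).hom ≫ x = (i o s a).hom ≫ y) →
      x = y := fun x y h => hom_ext_X_orbit hA c fun o s a => by
    rw [← (i o s).apply_symm_apply a]
    exact h o s _
  let Y : EquivMod π :=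
    { M := M
      φ := φ
      act_φ := fun g => by
        have h1 : act M ≫ φ g = A.X ◁ φ g ≫ (π g).hom.hom ▷ M.X ≫ act M := act_hom (m g)
        rw [h1, MonoidalCategory.tensorHom_def', Category.assoc]
      -- The factor `α⁻¹` from composing the `ψ` cancels the factor `α` from composing the `φ_s`, so
      -- the action on `M` is a genuine one.
      φ_mul := fun g h => ext _ _ fun o s x => by
        have e : (g * h) • s = g • h • s := mul_smul g h s
        rw [hφ o (g * h) s _ e x, reassoc_of% (hφ o h s _ rfl x), hφ o g _ _ rfl, P.ψ_mul,
          map_smul, Orbifold.smul_hom, Linear.comp_smul, Linear.comp_smul, ← Category.assoc,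
          hα g h s _ _ (orbit_smul rfl) (orbit_smul rfl), Linear.smul_comp, smul_smul (_ : ℂ)]
        simp
      φ_one := ext _ _ fun o s x => by
        rw [hφ o 1 s s (one_smul _ _) x, P.ψ_one, map_smul, hα.f_one, Orbifold.smul_hom,
          Linear.comp_smul, Linear.smul_comp, smul_smul (_ : ℂ)]
        simp }
  refine ⟨Y, i, fun o g s t h x => ?_⟩
  ext
  apply c.f_cancel g (orbit_smul h)
  rw [f_conj, ← hφ]

end

end Choice

/-! ### Modules over twisted algebras -/

namespace TwistedAlg

attribute [local instance] Fintype.ofFinite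

variable {G : Type*} {T : Type*} [Group G] [MulAction G T] [Finite G] {α : Cocycle G T}

lemma u_mul_u_coeff (g h k : G) (t : T) [Decidable (k = g * h)] :
    (u α g * u α h).coeff k t = if k = g * h then ((α.toFun g h t : ℂˣ) : ℂ) else 0 := by
  rw [mul_coeff, Finset.sum_eq_single g]
  · by_cases hk : k = g * h
    · subst hk
      simp [u]
    · have : g⁻¹ * k ≠ h := fun e => hk (by rw [← e, mul_inv_cancel_left])
      simp [u, hk, this]
  · intro k' _ hk'
    simp [u, hk']
  · simp

/-- In the algebra `α(g, h)` is a function rather than a scalar. After multiplication by `δ_s` only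
its value at `(gh)s` survives. -/
lemma u_mul_u_mul_delta (g h : G) (s : T) :
    u α g * u α h * delta α s =
      ((α.toFun g h ((g * h) • s) : ℂˣ) : ℂ) • (u α (g * h) * delta α s) := by
  classical
  ext k t
  rw [smul_coeff, delta, mul_ofFun_coeff, mul_ofFun_coeff, u_mul_u_coeff]
  by_cases hk : k = g * h
  · subst hk
    by_cases ht : (g * h)⁻¹ • t = s
    · obtain rfl : t = (g * h) • s := by rw [← ht, smul_inv_smul]
      simp [u]
    · rw [if_neg ht, mul_zero, mul_zero, mul_zero]
  · simp [u, hk]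

omit [Finite G] in
lemma u_one_eq_ofFun : u α 1 = ofFun α fun t => ((α.toFun 1 1 t : ℂˣ) : ℂ) := by
  ext k t
  by_cases hk : k = 1 <;> simp [u, ofFun, hk]

lemma u_one_mul_delta (s : T) :
    u α 1 * delta α s = ((α.toFun 1 1 s : ℂˣ) : ℂ) • delta α s := by
  ext k t
  rw [u_one_eq_ofFun, ofFun_mul_coeff, smul_coeff]
  by_cases ht : t = s
  · rw [ht]
  · simp [delta, ofFun, ht]

open scoped Classical in
lemma delta_mul_delta (s t : T) :
    delta α s * delta α t = if s = t then delta α t else 0 := by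
  ext k r
  rw [delta, ofFun_mul_coeff]
  by_cases hst : s = t
  · subst hst
    by_cases hr : r = s <;> simp [delta, ofFun, hr]
  · by_cases hr : r = s <;> simp [delta, ofFun, hst, hr]

lemma sum_coeff {J : Type*} (F : Finset J) (x : J → TwistedAlg α) (k : G) (t : T) :
    (∑ j ∈ F, x j).coeff k t = ∑ j ∈ F, (x j).coeff k t :=
  map_sum (G := TwistedAlg α →+ ℂ)
    { toFun := fun y => y.coeff k t
      map_zero' := rfl
      map_add' := fun _ _ => rfl } x F

lemma sum_delta [Fintype T] : ∑ t, delta α t = 1 := by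
  classical
  ext k r
  rw [sum_coeff, one_def]
  by_cases hk : k = 1
  · simp [delta, ofFun, hk]
  · simp [delta, ofFun, hk]

lemma eq_sum [Fintype T] (x : TwistedAlg α) :
    x = ∑ g, ∑ t, x.coeff g t • (delta α t * u α g) := by
  classical
  ext k r
  have key : ∀ g t, (x.coeff g t • (delta α t * u α g)).coeff k r =
      x.coeff g t * ((if r = t then 1 else 0) * (if k = g then 1 else 0)) := fun g t => by
    rw [smul_coeff, delta, ofFun_mul_coeff]
    simp only [u]
  simp only [sum_coeff, key]
  rw [Finset.sum_eq_single k, Finset.sum_eq_single r]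
  · simp
  · intro t _ ht
    simp [ht.symm]
  · simp
  · intro g _ hg
    simp [hg.symm]
  · simp

end TwistedAlg

/-! ### Decomposition of a representation into its components. -/

section Components

open scoped ModuleCat

variable {G : Type*} {T : Type*} [Group G] [MulAction G T] [Finite G] {α : Cocycle G T}
  (V : ModuleCat.{w} (TwistedAlg α))

lemma mem_component {V : ModuleCat.{w} (TwistedAlg α)} {s : T} {x : V} :
    x ∈ component V s ↔ TwistedAlg.delta α s • x = x := Iff.rfl

/-- For a representation of the algebra of `α.inv`, this and `componentAct_one` are the axioms of a
`ProjectiveFamily` for `α`. -/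
lemma componentAct_componentAct (g h : G) {s t r : T} (hst : h • s = t) (htr : g • t = r)
    (x : component V s) : componentAct V g htr (componentAct V h hst x) =
      ((α.toFun g h r : ℂˣ) : ℂ) •
        componentAct V (g * h) (by rw [mul_smul, hst, htr] : (g * h) • s = r) x := by
  have hr : (g * h) • s = r := by rw [mul_smul, hst, htr]
  apply Subtype.ext
  change TwistedAlg.u α g • TwistedAlg.u α h • (x : V) = _ • TwistedAlg.u α (g * h) • (x : V)
  have hx : TwistedAlg.delta α s • (x : V) = x := x.2
  rw [← hx, ← mul_smul, ← mul_smul, ← mul_smul, TwistedAlg.u_mul_u_mul_delta, hr, smul_assoc]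

lemma componentAct_one {s : T} (h : (1 : G) • s = s) (x : component V s) :
    componentAct V 1 h x = ((α.toFun 1 1 s : ℂˣ) : ℂ) • x := by
  apply Subtype.ext
  change TwistedAlg.u α 1 • (x : V) = _ • (x : V)
  have hx : TwistedAlg.delta α s • (x : V) = x := x.2
  conv_lhs => rw [← hx]
  rw [← mul_smul, TwistedAlg.u_one_mul_delta, smul_assoc, hx]

/-- The projection of `V` onto its component `V_s`. -/
def componentProj (s : T) : V →ₗ[ℂ] component V s where
  toFun x := ⟨TwistedAlg.delta α s • x, by
    classical
    rw [mem_component, ← mul_smul, TwistedAlg.delta_mul_delta, if_pos rfl]⟩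
  map_add' x y := Subtype.ext (smul_add _ _ _)
  map_smul' z x := Subtype.ext (smul_comm _ _ _)

lemma componentProj_u (g : G) {s t : T} (h : g • s = t) (x : V) :
    componentProj V t (TwistedAlg.u α g • x) = componentAct V g h (componentProj V s x) := by
  apply Subtype.ext
  change TwistedAlg.delta α t • TwistedAlg.u α g • x = TwistedAlg.u α g • TwistedAlg.delta α s • x
  rw [← mul_smul, ← mul_smul, TwistedAlg.u_mul_delta, h]

lemma componentProj_apply {s : T} (x : component V s) : componentProj V s x = x :=
  Subtype.ext x.2

lemma componentProj_eq_zero {s t : T} (h : t ≠ s) (x : component V s) :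
    componentProj V t x = 0 := by
  classical
  apply Subtype.ext
  change TwistedAlg.delta α t • (x : V) = 0
  have hx : TwistedAlg.delta α s • (x : V) = x := x.2
  rw [← hx, ← mul_smul, TwistedAlg.delta_mul_delta, if_neg h, zero_smul]

lemma sum_componentProj [Fintype T] (x : V) : ∑ s, (componentProj V s x : V) = x := by
  change ∑ s, TwistedAlg.delta α s • x = x
  rw [← Finset.sum_smul, TwistedAlg.sum_delta, one_smul]

/-- A linear map is a morphism of representations of `A_α(G, T)` if it commutes with the elements
of `G` and the delta functions. -/
lemma map_smul_of_generators [Finite T] {V W : ModuleCat.{w} (TwistedAlg α)} (L : V →ₗ[ℂ] W)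
    (hu : ∀ g x, L (TwistedAlg.u α g • x) = TwistedAlg.u α g • L x)
    (hd : ∀ s x, L (TwistedAlg.delta α s • x) = TwistedAlg.delta α s • L x)
    (a : TwistedAlg α) (x : V) : L (a • x) = a • L x := by
  have := Fintype.ofFinite T
  rw [a.eq_sum]
  simp only [Finset.sum_smul, map_sum, smul_assoc, map_smul, mul_smul, hu, hd]

end Components

/-! ### The functor to representations of the twisted algebras of the orbits -/

namespace Choice

open scoped ModuleCat

section

variable {C : Type u} [Category.{v} C] [MonoidalCategory C] [Preadditive C]
  [MonoidalPreadditive C] {G : Type w} [Group G] {A : Mon C} {π : G →* Aut A} {c : Choice π}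
  [Linear ℂ C] [MonoidalLinear ℂ C] [Finite G]
  {α : Cocycle G (SimpleClass π)} (hα : c.IsCocycle α)

attribute [local instance] Fintype.ofFinite

lemma IsCocycle.orbitObj_smul {o : MulAction.orbitRel.Quotient G (SimpleClass π)}
    {Y : EquivMod π} (x : OrbitAlg α o) (a : hα.orbitObj o Y) (t : o.orbit) :
    (x • a : hα.orbitObj o Y) t = ∑ g, x.coeff g t • c.conjAt Y g a t := rfl

lemma IsCocycle.orbitObj_ofFun_smul {o : MulAction.orbitRel.Quotient G (SimpleClass π)}
    {Y : EquivMod π} (f : o.orbit → ℂ) (a : hα.orbitObj o Y) (t : o.orbit) :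
    (TwistedAlg.ofFun (α.inv.onOrbit o) f • a : hα.orbitObj o Y) t =
      f t • (show c.X t ⟶ Y.M from a t) := by
  rw [hα.orbitObj_smul, Finset.sum_eq_single 1]
  · rw [c.conjAt_eq Y 1 a t t (one_smul _ _), hα.conj_one, smul_smul (_ : ℂ)]
    simp [TwistedAlg.ofFun, Cocycle.onOrbit, Cocycle.inv]
  · intro g _ hg
    simp [TwistedAlg.ofFun, hg]
  · simp

/-- The representation `orbitObj` as a vector space. -/
def IsCocycle.orbitEquiv (o : MulAction.orbitRel.Quotient G (SimpleClass π)) (Y : EquivMod π) :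
    hα.orbitObj o Y ≃ₗ[ℂ] (∀ s : o.orbit, c.X s ⟶ Y.M) where
  toFun a := a
  invFun a := a
  map_add' _ _ := rfl
  map_smul' z a := by
    funext t
    -- Complex numbers act on `orbitObj` through the algebra, where `z` is the constant function
    -- `z`. The vector space structure therefore has to be compared with the one on Hom spaces.
    change ((algebraMap ℂ (OrbitAlg α o) z) • a : hα.orbitObj o Y) t = _
    have : algebraMap ℂ (OrbitAlg α o) z = TwistedAlg.ofFun _ fun _ => z := by
      rw [Algebra.algebraMap_eq_smul_one]
      ext k t
      rw [TwistedAlg.smul_coeff, TwistedAlg.one_def]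
      by_cases hk : k = 1 <;> simp [TwistedAlg.ofFun, hk]
    rw [this, hα.orbitObj_ofFun_smul]
    rfl

open scoped Classical in
lemma IsCocycle.orbitEquiv_delta (o : MulAction.orbitRel.Quotient G (SimpleClass π))
    (Y : EquivMod π) (s : o.orbit) (a : hα.orbitObj o Y) (t : o.orbit) :
    hα.orbitEquiv o Y (TwistedAlg.delta (α.inv.onOrbit o) s • a) t =
      if t = s then hα.orbitEquiv o Y a t else 0 := by
  refine (hα.orbitObj_ofFun_smul _ a t).trans ?_
  split_ifs with h
  · exact one_smul _ _
  · exact zero_smul _ _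

lemma IsCocycle.orbitEquiv_u (o : MulAction.orbitRel.Quotient G (SimpleClass π))
    (Y : EquivMod π) (g : G) (a : hα.orbitObj o Y) {s t : o.orbit} (h : g • s = t) :
    hα.orbitEquiv o Y (TwistedAlg.u (α.inv.onOrbit o) g • a) t =
      c.conj Y g (orbit_smul h) (hα.orbitEquiv o Y a s) := by
  refine (hα.orbitObj_smul _ a t).trans ?_
  rw [Finset.sum_eq_single g]
  · rw [c.conjAt_eq Y g a s t h]
    simp only [TwistedAlg.u, if_true]
    exact one_smul _ _
  · intro k _ hk
    simp [TwistedAlg.u, hk]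
  · simp

lemma IsCocycle.orbitEquiv_map (o : MulAction.orbitRel.Quotient G (SimpleClass π))
    {Y Z : EquivMod π} (m : Y ⟶ Z) (a : hα.orbitObj o Y) (t : o.orbit) :
    hα.orbitEquiv o Z (((hα.homFunctor.map m) o).hom a) t = hα.orbitEquiv o Y a t ≫ m.hom := rfl

/-- The component of `orbitObj` at `s` is `Hom_A(X_s, Y)`. -/
def IsCocycle.componentEquiv (o : MulAction.orbitRel.Quotient G (SimpleClass π)) (Y : EquivMod π)
    (s : o.orbit) : component (hα.orbitObj o Y) s ≃ₗ[ℂ] (c.X s ⟶ Y.M) := by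
  classical
  exact
  { toFun := fun a => hα.orbitEquiv o Y a s
    map_add' := fun _ _ => rfl
    map_smul' := fun z a => congrFun ((hα.orbitEquiv o Y).map_smul z a) s
    invFun := fun b => ⟨(hα.orbitEquiv o Y).symm (Pi.single s b), by
      rw [mem_component]
      apply (hα.orbitEquiv o Y).injective
      funext t
      rw [hα.orbitEquiv_delta, LinearEquiv.apply_symm_apply]
      by_cases h : t = s
      · simp [h]
      · simp [h]⟩
    left_inv := fun a => by
      apply Subtype.ext
      apply (hα.orbitEquiv o Y).injective
      funext t
      rw [LinearEquiv.apply_symm_apply]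
      by_cases h : t = s
      · subst h
        simp
      · have h1 : hα.orbitEquiv o Y a t = 0 := by
          rw [← mem_component.mp a.2, hα.orbitEquiv_delta, if_neg h]
        simp [h, h1]
    right_inv := fun b => by
      simp }

variable [IsIdempotentComplete C] (hA : IsSemisimpleAlg A)
include hA

/-- Orbits of the finite group are finite and Hom spaces are finite dimensional. Only the orbits of
the finitely many simple summands of `Y` contribute. -/
lemma IsCocycle.homFunctor_isDirectSum (Y : EquivMod π) :
    isDirectSum.{max u v} (OrbitAlg α) (hα.homFunctor.obj Y) := by
  have := hA.finiteDimensional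
  refine ⟨fun o => ?_, ?_⟩
  · have := finite_orbit o
    exact (hα.orbitEquiv o Y).symm.finiteDimensional
  · obtain ⟨n, s, p, i, hpi⟩ := c.exists_decomposition hA Y.M
    refine (Set.finite_range fun k => (Quotient.mk'' (s k) :
      MulAction.orbitRel.Quotient G (SimpleClass π))).subset fun o ho => ?_
    by_contra hcon
    have : Subsingleton (hα.orbitObj o Y) := ⟨fun a b => by
      apply (hα.orbitEquiv o Y).injective
      funext t
      have hzero : ∀ d : c.X t ⟶ Y.M, d = 0 := fun d => by
        rw [← Category.comp_id d, ← hpi, Preadditive.comp_sum]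
        refine Finset.sum_eq_zero fun k _ => ?_
        rw [← Category.assoc, c.hom_eq_zero hA _ (d ≫ p k), zero_comp]
        intro h
        refine hcon ⟨k, ?_⟩
        exact (congrArg Quotient.mk'' h.symm).trans (MulAction.orbitRel.Quotient.mem_orbit.mp t.2)
      rw [hzero (hα.orbitEquiv o Y a t), hzero (hα.orbitEquiv o Y b t)]⟩
    exact not_nontrivial_iff_subsingleton.mpr this ho

lemma IsCocycle.homFunctor_faithful : hα.homFunctor.Faithful where
  map_injective {Y Z m m'} h := by
    ext1
    ext1
    refine hom_ext_X_orbit hA c fun o s a => ?_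
    classical
    let b := (hα.orbitEquiv o Y).symm (Pi.single s a)
    have h1 : (hα.homFunctor.map m o).hom b = (hα.homFunctor.map m' o).hom b := by rw [h]
    have h2 := congrFun (congrArg (hα.orbitEquiv o Z) h1) s
    rw [hα.orbitEquiv_map, hα.orbitEquiv_map, LinearEquiv.apply_symm_apply, Pi.single_eq_same] at h2
    exact congrArg Mod.Hom.hom h2

omit [Finite G] in
/-- A family of linear maps on the spaces `Hom_A(X_s, Y)` compatible with the action of `G` comes
from a morphism of `D`. -/
lemma exists_hom_of_conj (c : Choice π) (Y Z : EquivMod π)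
    (T : ∀ (o : MulAction.orbitRel.Quotient G (SimpleClass π)) (s : o.orbit),
      (c.X s ⟶ Y.M) →ₗ[ℂ] (c.X s ⟶ Z.M))
    (hT : ∀ o (g : G) (s t : o.orbit) (h : g • s = t) (a : c.X s ⟶ Y.M),
      T o t (c.conj Y g (orbit_smul h) a) = c.conj Z g (orbit_smul h) (T o s a)) :
    ∃ m : Y ⟶ Z, ∀ o (s : o.orbit) (a : c.X s ⟶ Y.M), a ≫ m.hom = T o s a := by
  obtain ⟨m, hm, -⟩ := existsUnique_hom_orbit hA c Y.M Z.M T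
  have hm' : ∀ o (s : o.orbit) (a : c.X s ⟶ Y.M), a.hom ≫ m.hom = (T o s a).hom :=
    fun o s a => congrArg Mod.Hom.hom (hm o s a)
  refine ⟨⟨m, fun g => hom_ext_X_orbit hA c fun o s a => ?_⟩, hm⟩
  rw [reassoc_of% (hm' o s a), ← Category.assoc, ← c.f_conj Y g (orbit_smul (rfl : g • s = g • s)),
    Category.assoc, hm' o (g • s), hT o g s _ rfl, c.f_conj]

/-- A morphism of representations commutes with the delta functions, so it is a family of maps `T`
on the components. Commuting with the elements of `G` is then the hypothesis of
`exists_hom_of_conj`. -/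
lemma IsCocycle.homFunctor_full : hα.homFunctor.Full where
  map_surjective {Y Z} F := by
    classical
    let E := fun o => hα.orbitEquiv o Y
    let Fl : ∀ o, hα.orbitObj o Y →ₗ[OrbitAlg α o] hα.orbitObj o Z := fun o => (F o).hom
    let T : ∀ (o : MulAction.orbitRel.Quotient G (SimpleClass π)) (s : o.orbit),
      (c.X s ⟶ Y.M) →ₗ[ℂ] (c.X s ⟶ Z.M) := fun o s =>
        LinearMap.proj s ∘ₗ (hα.orbitEquiv o Z).toLinearMap ∘ₗ (Fl o).restrictScalars ℂ ∘ₗ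
          (E o).symm.toLinearMap ∘ₗ LinearMap.single ℂ (fun s : o.orbit => c.X s ⟶ Y.M) s
    have hT : ∀ o s a, T o s a = hα.orbitEquiv o Z (Fl o ((E o).symm (Pi.single s a))) s :=
      fun _ _ _ => rfl
    have hF : ∀ o (x : hα.orbitObj o Y) s, hα.orbitEquiv o Z (Fl o x) s = T o s (E o x s) := by
      intro o x s
      have h1 : TwistedAlg.delta (α.inv.onOrbit o) s • x = (E o).symm (Pi.single s (E o x s)) := by
        apply (E o).injective
        funext t
        rw [hα.orbitEquiv_delta, LinearEquiv.apply_symm_apply]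
        by_cases h : t = s
        · subst h
          simp [E]
        · simp [h]
      rw [hT, ← h1, map_smul, hα.orbitEquiv_delta, if_pos rfl]
    obtain ⟨m, hm⟩ := exists_hom_of_conj hA c Y Z T fun o g s t h a => by
      have h1 : c.conj Y g (orbit_smul h) a =
          E o (TwistedAlg.u (α.inv.onOrbit o) g • (E o).symm (Pi.single s a)) t := by
        rw [hα.orbitEquiv_u o Y g _ h, LinearEquiv.apply_symm_apply, Pi.single_eq_same]
      rw [h1, ← hF, map_smul, hα.orbitEquiv_u o Z g _ h, hT]
    refine ⟨m, funext fun o => ModuleCat.hom_ext (LinearMap.ext fun x => ?_)⟩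
    apply (hα.orbitEquiv o Z).injective
    funext s
    exact (hα.orbitEquiv_map o m x s).trans ((hm o s _).trans (hF o x s).symm)

variable [HasFiniteBiproducts C]

/-- The components of `V` with the action of `G` form a projective family, which `realize` turns
into an object of `D`. As orbits are finite, `V` is the product of its components, so the
componentwise isomorphisms assemble. -/
lemma IsCocycle.exists_homFunctor_iso (V : RepSum.{max u v} (OrbitAlg α)) :
    ∃ Y : EquivMod π, ∀ o, Nonempty (hα.orbitObj o Y ≅ V.obj o) := by
  classical
  have hfd := V.property.1
  have hfin : {o | ∃ s : o.orbit, Nontrivial (component (V.obj o) s)}.Finite :=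
    V.property.2.subset fun o ⟨s, hs⟩ => by
      exact (component (V.obj o) s).subtype_injective.nontrivial
  obtain ⟨Y, i, hi⟩ := hα.realize hA hfin
    { ψ := fun o g _ _ h => componentAct (V.obj o) g h
      ψ_mul := fun o g h _ _ _ hst htr x => componentAct_componentAct (V.obj o) g h hst htr x
      ψ_one := fun o _ h x => componentAct_one (V.obj o) h x }
  refine ⟨Y, fun o => ?_⟩
  have := finite_orbit o
  let L : V.obj o →ₗ[ℂ] hα.orbitObj o Y := (hα.orbitEquiv o Y).symm.toLinearMap ∘ₗ
    LinearMap.pi fun s => (i o s).toLinearMap ∘ₗ componentProj (V.obj o) s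
  have hL : ∀ x s, hα.orbitEquiv o Y (L x) s = i o s (componentProj (V.obj o) s x) := fun x s => by
    simp only [L, LinearMap.comp_apply, LinearEquiv.coe_coe, LinearEquiv.apply_symm_apply]
    rfl
  have hLsmul := map_smul_of_generators L (fun g x => by
      apply (hα.orbitEquiv o Y).injective
      funext t
      have ht : g • g⁻¹ • t = t := smul_inv_smul g t
      rw [hL, hα.orbitEquiv_u o Y g _ ht, componentProj_u _ g ht, hL, ← hi])
    (fun s x => by
      apply (hα.orbitEquiv o Y).injective
      funext t
      rw [hL, hα.orbitEquiv_delta, hL]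
      have h1 : TwistedAlg.delta (α.inv.onOrbit o) s • x = (componentProj (V.obj o) s x : V.obj o) := rfl
      rw [h1]
      split_ifs with h
      · subst h
        rw [componentProj_apply]
      · rw [componentProj_eq_zero _ h, map_zero])
  have hbij : Function.Bijective L := by
    refine ⟨(injective_iff_map_eq_zero L).mpr fun x hx => ?_, fun a => ?_⟩
    · rw [← sum_componentProj _ x]
      refine Finset.sum_eq_zero fun s _ => ?_
      have h1 := hL x s
      rw [hx, map_zero, Pi.zero_apply, eq_comm, LinearEquiv.map_eq_zero_iff] at h1
      rw [h1, ZeroMemClass.coe_zero]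
    · refine ⟨∑ s, ((i o s).symm (hα.orbitEquiv o Y a s) : V.obj o), ?_⟩
      apply (hα.orbitEquiv o Y).injective
      funext t
      rw [hL, map_sum, Finset.sum_eq_single t]
      · rw [componentProj_apply, LinearEquiv.apply_symm_apply]
      · intro s _ hs
        exact componentProj_eq_zero _ hs.symm _
      · simp
  exact ⟨(LinearEquiv.ofBijective
    ({ toFun := L, map_add' := L.map_add, map_smul' := hLsmul } :
      V.obj o →ₗ[OrbitAlg α o] hα.orbitObj o Y) hbij).toModuleIso.symm⟩

end

end Choice

/-! ### Equivalences onto direct sums of representation categories. -/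

section RepSum

universe v₁ u₁

variable {D : Type u₁} [Category.{v₁} D] {ι : Type*} {R : ι → Type*} [∀ i, Ring (R i)]
  [∀ i, Algebra ℂ (R i)] (F : D ⥤ ∀ i, ModuleCat.{w} (R i))
  (hF : ∀ Y, isDirectSum.{w} R (F.obj Y))

/-- A full and faithful functor to families of finite dimensional representations with finite
support is an equivalence if every such family is, componentwise, isomorphic to an image. -/
lemma isEquivalence_repSumLift [F.Full] [F.Faithful]
    (hs : ∀ V : RepSum.{w} R, ∃ Y, ∀ i, Nonempty (F.obj Y i ≅ V.obj i)) :
    ((isDirectSum.{w} R).lift F hF).IsEquivalence where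
  essSurj := ⟨fun V => by
    obtain ⟨Y, hY⟩ := hs V
    let e : F.obj Y ≅ V.obj :=
      { hom := fun i => (hY i).some.hom
        inv := fun i => (hY i).some.inv
        hom_inv_id := funext fun i => (hY i).some.hom_inv_id
        inv_hom_id := funext fun i => (hY i).some.inv_hom_id }
    exact ⟨Y, ⟨(isDirectSum.{w} R).isoMk e⟩⟩⟩

lemma additive_repSumLift [Preadditive D]
    (h : ∀ {X Y : D} (f g : X ⟶ Y) i, F.map (f + g) i = F.map f i + F.map g i) :
    ((isDirectSum.{w} R).lift F hF).Additive where
  map_add {X Y f g} := by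
    apply ObjectProperty.hom_ext
    exact funext fun i => h f g i

lemma linear_repSumLift [Preadditive D] [Linear ℂ D]
    (h : ∀ {X Y : D} (z : ℂ) (f : X ⟶ Y) i, F.map (z • f) i = z • F.map f i) :
    ((isDirectSum.{w} R).lift F hF).Linear ℂ where
  map_smul {X Y} f z := by
    apply ObjectProperty.hom_ext
    exact funext fun i => h z f i

end RepSum

section

open scoped ModuleCat

/-- An isomorphism of representations induces isomorphisms of their components. -/
def componentIso {G T : Type*} [Group G] [MulAction G T] [Finite G] {α : Cocycle G T}
    {V W : ModuleCat.{w} (TwistedAlg α)} (e : V ≅ W) (s : T) :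
    component V s ≃ₗ[ℂ] component W s :=
  LinearEquiv.ofLinearMap (componentMap e.hom s) (componentMap e.inv s)
    (LinearMap.ext fun x => Subtype.ext (congrArg (fun f => f.hom (x : W)) e.inv_hom_id))
    (LinearMap.ext fun x => Subtype.ext (congrArg (fun f => f.hom (x : V)) e.hom_inv_id))

end

/-! ### The equivalence over the orbits and its inverse. -/

namespace Choice

open scoped ModuleCat

section

variable {C : Type u} [Category.{v} C] [MonoidalCategory C] [Preadditive C]
  [MonoidalPreadditive C] {G : Type w} [Group G] {A : Mon C} {π : G →* Aut A} {c : Choice π}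
  [Linear ℂ C] [MonoidalLinear ℂ C] [Finite G]
  {α : Cocycle G (SimpleClass π)} (hα : c.IsCocycle α)
  [IsIdempotentComplete C] (hA : IsSemisimpleAlg A)

/-- The functor `Y ↦ (⨁_{s ∈ O} Hom_A(X_s, Y))_O` to the direct sum of categories. -/
abbrev IsCocycle.homFunctorLift : EquivMod π ⥤ RepSum.{max u v} (OrbitAlg α) :=
  (isDirectSum.{max u v} (OrbitAlg α)).lift hα.homFunctor (hα.homFunctor_isDirectSum hA)

variable [HasFiniteBiproducts C]

include hA in
lemma IsCocycle.isEquivalence_homFunctorLift : (hα.homFunctorLift hA).IsEquivalence :=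
  have := hα.homFunctor_full hA
  have := hα.homFunctor_faithful hA
  isEquivalence_repSumLift _ _ (hα.exists_homFunctor_iso hA)

/-- `homFunctorLift` as an equivalence. -/
def IsCocycle.homEquivalence : EquivMod π ≌ RepSum.{max u v} (OrbitAlg α) :=
  have := hα.isEquivalence_homFunctorLift hA
  (hα.homFunctorLift hA).asEquivalence

lemma IsCocycle.homEquivalence_additive : (hα.homEquivalence hA).functor.Additive :=
  additive_repSumLift _ _ fun f g o => ModuleCat.hom_ext (LinearMap.ext fun a =>
    funext fun s => by exact Preadditive.comp_add _ _ _ (a s) f.hom g.hom)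

lemma IsCocycle.homEquivalence_linear : (hα.homEquivalence hA).functor.Linear ℂ :=
  linear_repSumLift _ _ fun {X Y} z f o => ModuleCat.hom_ext (LinearMap.ext fun a => by
    apply (hα.orbitEquiv o Y).injective
    change _ = hα.orbitEquiv o Y (z • ((hα.homFunctor.map f) o).hom a)
    refine Eq.trans ?_ ((hα.orbitEquiv o Y).map_smul z _).symm
    funext s
    exact Linear.comp_smul _ _ _ (hα.orbitEquiv o X a s) z f.hom)

/-- The unit isomorphisms of `homEquivalence`, componentwise. -/
def IsCocycle.homEquivalenceIso (V : RepSum.{max u v} (OrbitAlg α))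
    (o : MulAction.orbitRel.Quotient G (SimpleClass π)) :
    V.obj o ≅ hα.orbitObj o ((hα.homEquivalence hA).inverse.obj V) where
  hom := ((hα.homEquivalence hA).counitInv.app V).hom o
  inv := ((hα.homEquivalence hA).counit.app V).hom o
  hom_inv_id := congrFun (congrArg (fun f => f.hom)
    ((hα.homEquivalence hA).counitIso.inv_hom_id_app V)) o
  inv_hom_id := congrFun (congrArg (fun f => f.hom)
    ((hα.homEquivalence hA).counitIso.hom_inv_id_app V)) o

/-- The isomorphisms `V_s → Hom_A(X_s, Y)` for the object `Y` of `D` corresponding to a family of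
representations `V`. -/
def IsCocycle.sumTensorEquiv (V : RepSum.{max u v} (OrbitAlg α))
    (o : MulAction.orbitRel.Quotient G (SimpleClass π)) (s : o.orbit) :
    component (V.obj o) s ≃ₗ[ℂ] (c.X s ⟶ ((hα.homEquivalence hA).inverse.obj V).M) :=
  (componentIso (hα.homEquivalenceIso hA V o) s).trans (hα.componentEquiv o _ s)

lemma IsCocycle.sumTensorEquiv_apply (V : RepSum.{max u v} (OrbitAlg α))
    (o : MulAction.orbitRel.Quotient G (SimpleClass π)) (s : o.orbit) (x : component (V.obj o) s) :
    hα.sumTensorEquiv hA V o s x =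
      hα.orbitEquiv o _ ((hα.homEquivalenceIso hA V o).hom.hom (x : V.obj o)) s := rfl

lemma IsCocycle.sumTensorEquiv_componentAct (V : RepSum.{max u v} (OrbitAlg α))
    (o : MulAction.orbitRel.Quotient G (SimpleClass π)) (g : G) (s t : o.orbit) (h : g • s = t)
    (x : component (V.obj o) s) :
    hα.sumTensorEquiv hA V o t (componentAct (V.obj o) g h x) =
      c.conj _ g (orbit_smul h) (hα.sumTensorEquiv hA V o s x) := by
  rw [sumTensorEquiv_apply, sumTensorEquiv_apply, ← hα.orbitEquiv_u o _ g _ h, ← map_smul]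
  rfl

/-- The maps `V_s → Hom_A(X_s, Y)` are isomorphisms, so the universal property is
`existsUnique_hom_orbit` transported along them. Equivariance holds because the counit isomorphisms
are linear over the twisted algebra. -/
lemma IsCocycle.isSumTensor (V : RepSum.{max u v} (OrbitAlg α)) :
    IsSumTensor c α V.obj ((hα.homEquivalence hA).inverse.obj V)
      (fun o s => (hα.sumTensorEquiv hA V o s).toLinearMap) where
  universal Z j := by
    obtain ⟨m, hm, hu⟩ := existsUnique_hom_orbit hA c ((hα.homEquivalence hA).inverse.obj V).M Z
      fun o s => j o s ∘ₗ (hα.sumTensorEquiv hA V o s).symm.toLinearMap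
    refine ⟨m, fun o s x => ?_, fun m' hm' => hu m' fun o s a => ?_⟩
    · refine (hm o s _).trans ?_
      simp
    · have := hm' o s ((hα.sumTensorEquiv hA V o s).symm a)
      simpa using this
  equivariant g o s t h x := by
    rw [LinearEquiv.coe_coe, LinearEquiv.coe_coe, sumTensorEquiv_componentAct, f_conj]

lemma IsCocycle.sumTensorEquiv_naturality {V W : RepSum.{max u v} (OrbitAlg α)} (m : V ⟶ W)
    (o : MulAction.orbitRel.Quotient G (SimpleClass π)) (s : o.orbit)
    (x : component (V.obj o) s) :
    hα.sumTensorEquiv hA V o s x ≫ ((hα.homEquivalence hA).inverse.map m).hom =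
      hα.sumTensorEquiv hA W o s (componentMap (m.hom o) s x) := by
  have h1 := (hα.homEquivalence hA).counitInv.naturality m
  have h2 := congrArg (fun f => (f.hom o).hom (x : V.obj o)) h1
  exact congrFun (congrArg (hα.orbitEquiv o _) h2).symm s

end

end Choice

/-! ### Twisted group algebras -/

namespace TwistedGroupAlg

attribute [local instance] Fintype.ofFinite

variable {H : Type*} [Group H] {α : ScalarCocycle H}

open scoped Classical in
/-- The basis element `g` of the twisted group algebra. -/
def u (α : ScalarCocycle H) (g : H) : TwistedGroupAlg α := ⟨fun k => if k = g then 1 else 0⟩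

variable [Finite H]

lemma u_mul_u (g h : H) : u α g * u α h = ((α.toFun g h : ℂˣ) : ℂ) • u α (g * h) := by
  classical
  ext k
  rw [mul_coeff, Finset.sum_eq_single g, smul_coeff]
  · by_cases hk : k = g * h
    · subst hk
      simp [u]
    · have : g⁻¹ * k ≠ h := fun e => hk (by rw [← e, mul_inv_cancel_left])
      simp [u, hk, this]
  · intro k' _ hk'
    simp [u, hk']
  · simp

omit [Finite H] in
lemma u_one : u α 1 = ((α.toFun 1 1 : ℂˣ) : ℂ) • (1 : TwistedGroupAlg α) := by
  ext k
  rw [smul_coeff, one_coeff]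
  by_cases hk : k = 1 <;> simp [u, hk]

lemma sum_coeff {J : Type*} (F : Finset J) (x : J → TwistedGroupAlg α) (k : H) :
    (∑ j ∈ F, x j).coeff k = ∑ j ∈ F, (x j).coeff k :=
  map_sum (G := TwistedGroupAlg α →+ ℂ)
    { toFun := fun y => y.coeff k
      map_zero' := rfl
      map_add' := fun _ _ => rfl } x F

lemma eq_sum (x : TwistedGroupAlg α) : x = ∑ g, x.coeff g • u α g := by
  classical
  ext k
  rw [sum_coeff, Finset.sum_eq_single k]
  · simp [u]
  · intro g _ hg
    simp [u, hg.symm]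
  · simp

open scoped ModuleCat in
/-- A linear map is a morphism of representations of the twisted group algebra if it commutes with
the elements of the group. -/
lemma map_smul_of_generators {V W : ModuleCat.{w} (TwistedGroupAlg α)} (L : V →ₗ[ℂ] W)
    (hu : ∀ g x, L (u α g • x) = u α g • L x) (a : TwistedGroupAlg α) (x : V) :
    L (a • x) = a • L x := by
  rw [a.eq_sum]
  simp only [Finset.sum_smul, map_sum, smul_assoc, map_smul, hu]

end TwistedGroupAlg

/-! ### The functor to representations of the twisted group algebras of the stabilizers -/

namespace Choice

open scoped ModuleCat

section

variable {C : Type u} [Category.{v} C] [MonoidalCategory C] [Preadditive C]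
  [MonoidalPreadditive C] {G : Type w} [Group G] {A : Mon C} {π : G →* Aut A} {c : Choice π}
  [Linear ℂ C] [MonoidalLinear ℂ C]
  {α : Cocycle G (SimpleClass π)} (hα : c.IsCocycle α)
include hα

/-- The actions of `g` and `g⁻¹` are inverse to each other up to a nonzero scalar, coming from `α(g,
g⁻¹)` or `α(g⁻¹, g)` and from the unnormalized `α(1, 1)`. -/
lemma IsCocycle.conj_bijective (Y : EquivMod π) (g : G) {s t : SimpleClass π} (h : g • s = t) :
    Function.Bijective (c.conj Y g h) := by
  have h' : g⁻¹ • t = s := by rw [← h, inv_smul_smul]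
  have key : ∀ (k k' : G) (hk : k * k' = 1) {p q : SimpleClass π} (hpq : k' • p = q)
      (hqp : k • q = p) (a : c.X p ⟶ Y.M), ∃ z : ℂˣ,
        c.conj Y k hqp (c.conj Y k' hpq a) = (z : ℂ) • a := by
    intro k k' hk p q hpq hqp a
    refine ⟨(α.toFun k k' p)⁻¹ * (α.toFun 1 1 p)⁻¹, ?_⟩
    have h1 : c.conj Y (k * k') (by rw [mul_smul, hpq, hqp]) a =
        c.conj Y 1 (one_smul G p) a := by
      congr 2
    rw [hα.conj_conj, h1, hα.conj_one, smul_smul (_ : ℂ), Units.val_mul]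
  constructor
  · refine (injective_iff_map_eq_zero _).mpr fun a ha => ?_
    obtain ⟨z, hz⟩ := key g⁻¹ g (inv_mul_cancel g) h h' a
    rw [ha, map_zero] at hz
    exact (smul_eq_zero.mp hz.symm).resolve_left z.ne_zero
  · intro b
    obtain ⟨z, hz⟩ := key g g⁻¹ (mul_inv_cancel g) h' h b
    refine ⟨(z : ℂ)⁻¹ • c.conj Y g⁻¹ h' b, ?_⟩
    rw [map_smul, hz, smul_smul (_ : ℂ), inv_mul_cancel₀ z.ne_zero, one_smul]

/-- The scalar relating `conj g ∘ conj k` and `conj k' ∘ conj h`, where `g k = k' h`. -/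
lemma IsCocycle.conj_transfer (Y : EquivMod π) {g k k' h : G} (e : g * k = k' * h)
    {p s t q : SimpleClass π} (hk : k • p = s) (hg : g • s = t) (hh : h • p = q) (hk' : k' • q = t)
    (a : c.X p ⟶ Y.M) :
    c.conj Y g hg (c.conj Y k hk a) =
      (((α.toFun g k t)⁻¹ * α.toFun k' h t : ℂˣ) : ℂ) • c.conj Y k' hk' (c.conj Y h hh a) := by
  have h1 : c.conj Y (g * k) (by rw [mul_smul, hk, hg]) a =
      c.conj Y (k' * h) (by rw [mul_smul, hh, hk']) a := by
    congr 2
  rw [hα.conj_conj, hα.conj_conj, h1, smul_smul (_ : ℂ), ← Units.val_mul]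
  simp

variable [Finite G]

attribute [local instance] Fintype.ofFinite

lemma IsCocycle.stabObj_smul {s : SimpleClass π} {Y : EquivMod π} (x : StabAlg α s)
    (a : hα.stabObj s Y) :
    (x • a : hα.stabObj s Y) = ∑ g, x.coeff g • c.conj Y g (stab_smul g) a := rfl

lemma IsCocycle.sum_algebraMap_coeff_smul_conj {s : SimpleClass π} {Y : EquivMod π} (z : ℂ)
    (a : c.X s ⟶ Y.M) :
    ∑ g, (algebraMap ℂ (StabAlg α s) z).coeff g • c.conj Y g (stab_smul g) a = z • a := by
  have h1 : algebraMap ℂ (StabAlg α s) z = z • 1 := Algebra.algebraMap_eq_smul_one z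
  rw [h1, Finset.sum_eq_single 1]
  · have h2 := hα.conj_one Y (one_smul G s) a
    simp only [Subgroup.coe_one]
    rw [h2, smul_smul (_ : ℂ)]
    simp [TwistedGroupAlg.one_coeff, Cocycle.atPoint, Cocycle.inv]
  · intro g _ hg
    simp [TwistedGroupAlg.one_coeff, hg]
  · simp

/-- The representation `stabObj` as a vector space. -/
def IsCocycle.stabEquiv (s : SimpleClass π) (Y : EquivMod π) :
    hα.stabObj s Y ≃ₗ[ℂ] (c.X s ⟶ Y.M) where
  toFun a := a
  invFun a := a
  map_add' _ _ := rfl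
  map_smul' z a := hα.sum_algebraMap_coeff_smul_conj z a

lemma IsCocycle.stabEquiv_u (s : SimpleClass π) (Y : EquivMod π) (g : MulAction.stabilizer G s)
    (a : hα.stabObj s Y) :
    hα.stabEquiv s Y (TwistedGroupAlg.u (α.inv.atPoint s) g • a) =
      c.conj Y g (stab_smul g) (hα.stabEquiv s Y a) := by
  refine (hα.stabObj_smul _ a).trans ?_
  rw [Finset.sum_eq_single g]
  · simp only [TwistedGroupAlg.u, if_true]
    exact one_smul ℂ (c.conj Y g (stab_smul g) a)
  · intro k _ hk
    simp [TwistedGroupAlg.u, hk]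
  · simp

variable {r : MulAction.orbitRel.Quotient G (SimpleClass π) → SimpleClass π}
  (hr : ∀ o, (Quotient.mk'' (r o) : MulAction.orbitRel.Quotient G (SimpleClass π)) = o)

lemma IsCocycle.stabEquiv_map (o : MulAction.orbitRel.Quotient G (SimpleClass π))
    {Y Z : EquivMod π} (m : Y ⟶ Z) (a : hα.stabObj (r o) Y) :
    hα.stabEquiv (r o) Z ((((hα.stabHomFunctor r).map m) o).hom a) =
      hα.stabEquiv (r o) Y a ≫ m.hom := rfl

omit hα [Finite G] in
/-- Elements of `G` that move a representative of an orbit to the elements of the orbit. -/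
lemma exists_transporter {T : Type*} [MulAction G T]
    {r : MulAction.orbitRel.Quotient G T → T}
    (hr : ∀ o, (Quotient.mk'' (r o) : MulAction.orbitRel.Quotient G T) = o) :
    ∃ γ : ∀ o : MulAction.orbitRel.Quotient G T, o.orbit → G,
      (∀ o (s : o.orbit), γ o s • r o = s) ∧ ∀ o (s : o.orbit), (s : T) = r o → γ o s = 1 := by
  classical
  have h : ∀ (o : MulAction.orbitRel.Quotient G T) (s : o.orbit), ∃ g : G, g • r o = s := by
    intro o s
    have := (MulAction.orbitRel.Quotient.mem_orbit.mp s.2).trans (hr o).symm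
    exact MulAction.orbitRel_apply.mp (Quotient.exact this)
  choose γ hγ using h
  -- Taking the value `1` at the representative makes the induced action restrict there to the
  -- original one, without a correcting scalar.
  refine ⟨fun o s => if (s : T) = r o then 1 else γ o s, fun o s => ?_, fun o s hs => if_pos hs⟩
  dsimp only
  split_ifs with hs
  · rw [one_smul, hs]
  · exact hγ o s

variable [IsIdempotentComplete C] (hA : IsSemisimpleAlg A)
include hr hA

/-- The space at a representative is one factor of the product over its orbit, so finite support
follows from that of `homFunctor`. -/
lemma IsCocycle.stabHomFunctor_isDirectSum (Y : EquivMod π) :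
    isDirectSum.{v} (fun o => StabAlg α (r o)) ((hα.stabHomFunctor r).obj Y) := by
  classical
  have := hA.finiteDimensional
  refine ⟨fun o => (hα.stabEquiv (r o) Y).symm.finiteDimensional, ?_⟩
  refine (hα.homFunctor_isDirectSum hA Y).2.subset fun o ho => ?_
  have ho' : Nontrivial (c.X (r o) ⟶ Y.M) := ho
  let s : o.orbit := ⟨r o, MulAction.orbitRel.Quotient.mem_orbit.mpr (hr o)⟩
  exact Pi.nontrivial_at (f := fun s : o.orbit => c.X s ⟶ Y.M) s

/-- Every `X_s ⟶ Y` is conjugate, by a transporter, to a morphism from the representative of its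
orbit. Conjugation commutes with composition by morphisms of `D`, so agreement at the
representatives suffices. -/
lemma IsCocycle.stabHomFunctor_faithful : (hα.stabHomFunctor r).Faithful where
  map_injective {Y Z m m'} h := by
    obtain ⟨γ, hγ, -⟩ := exists_transporter hr
    ext1
    ext1
    refine hom_ext_X_orbit hA c fun o s a => ?_
    obtain ⟨b, rfl⟩ := (hα.conj_bijective Y (γ o s) (hγ o s)).2 a
    have h1 : ((hα.stabHomFunctor r).map m o).hom b = ((hα.stabHomFunctor r).map m' o).hom b := by
      rw [h]
    have h2 : b ≫ m.hom = b ≫ m'.hom := h1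
    have h3 : c.conj Y (γ o s) (hγ o s) b ≫ m.hom = c.conj Y (γ o s) (hγ o s) b ≫ m'.hom := by
      rw [conj_comp, conj_comp, h2]
    exact congrArg Mod.Hom.hom h3

/-- The map `T₀` given at the representative is carried to the other points of the orbit by
conjugation with the transporters. The result is compatible with `g` because `g γ_s = γ_t k` with
`k` in the stabilizer, and `T₀` is compatible with `k`. -/
lemma IsCocycle.stabHomFunctor_full : (hα.stabHomFunctor r).Full where
  map_surjective {Y Z} F := by
    obtain ⟨γ, hγ, hγ1⟩ := exists_transporter hr
    let Fl : ∀ o, hα.stabObj (r o) Y →ₗ[StabAlg α (r o)] hα.stabObj (r o) Z := fun o => (F o).hom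
    let T₀ : ∀ o : MulAction.orbitRel.Quotient G (SimpleClass π),
      (c.X (r o) ⟶ Y.M) →ₗ[ℂ] (c.X (r o) ⟶ Z.M) := fun o =>
        (hα.stabEquiv (r o) Z).toLinearMap ∘ₗ (Fl o).restrictScalars ℂ ∘ₗ
          (hα.stabEquiv (r o) Y).symm.toLinearMap
    have hT₀ : ∀ o (h : MulAction.stabilizer G (r o)) (a : c.X (r o) ⟶ Y.M),
        T₀ o (c.conj Y h (stab_smul h) a) = c.conj Z h (stab_smul h) (T₀ o a) := by
      intro o h a
      have h1 := congrArg (hα.stabEquiv (r o) Z)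
        (map_smul (Fl o) (TwistedGroupAlg.u _ h) ((hα.stabEquiv (r o) Y).symm a))
      rw [hα.stabEquiv_u] at h1
      refine Eq.trans ?_ h1
      change hα.stabEquiv (r o) Z (Fl o _) = hα.stabEquiv (r o) Z (Fl o _)
      congr 2
      apply (hα.stabEquiv (r o) Y).injective
      rw [hα.stabEquiv_u]
      rfl
    let e := fun o (s : o.orbit) => LinearEquiv.ofBijective _ (hα.conj_bijective Y (γ o s) (hγ o s))
    let T : ∀ (o : MulAction.orbitRel.Quotient G (SimpleClass π)) (s : o.orbit),
      (c.X s ⟶ Y.M) →ₗ[ℂ] (c.X s ⟶ Z.M) := fun o s =>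
        c.conj Z (γ o s) (hγ o s) ∘ₗ T₀ o ∘ₗ (e o s).symm.toLinearMap
    have hT : ∀ o (s : o.orbit) (b : c.X (r o) ⟶ Y.M),
        T o s (c.conj Y (γ o s) (hγ o s) b) = c.conj Z (γ o s) (hγ o s) (T₀ o b) := by
      intro o s b
      have : (e o s).symm (c.conj Y (γ o s) (hγ o s) b) = b := (e o s).symm_apply_apply b
      simp only [T, LinearMap.comp_apply, LinearEquiv.coe_coe, this]
    obtain ⟨m, hm⟩ := exists_hom_of_conj hA c Y Z T fun o g s t h a => by
      obtain ⟨b, rfl⟩ := (hα.conj_bijective Y (γ o s) (hγ o s)).2 a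
      have hk : (γ o t)⁻¹ * (g * γ o s) ∈ MulAction.stabilizer G (r o) := by
        rw [MulAction.mem_stabilizer_iff, mul_smul, mul_smul, hγ, orbit_smul h, inv_smul_eq_iff, hγ]
      have he : g * γ o s = γ o t * ((γ o t)⁻¹ * (g * γ o s)) := by group
      -- The scalar produced by `conj_transfer` depends only on `α` and the group elements, so it is
      -- the same for `Y` and `Z`.
      rw [hT, hα.conj_transfer Y he (hγ o s) (orbit_smul h) hk (hγ o t),
        hα.conj_transfer Z he (hγ o s) (orbit_smul h) hk (hγ o t), map_smul, hT]
      congr 2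
      exact hT₀ o ⟨_, hk⟩ b
    refine ⟨m, funext fun o => ModuleCat.hom_ext (LinearMap.ext fun x => ?_)⟩
    let s : o.orbit := ⟨r o, MulAction.orbitRel.Quotient.mem_orbit.mpr (hr o)⟩
    apply (hα.stabEquiv (r o) Z).injective
    refine (hα.stabEquiv_map o m x).trans ((hm o s (hα.stabEquiv (r o) Y x)).trans ?_)
    -- At the representative the transporter lies in the stabilizer, with which `T₀` commutes, so
    -- `T` agrees with `T₀` there.
    obtain ⟨b, hb⟩ := (hα.conj_bijective Y (γ o s) (hγ o s)).2 (hα.stabEquiv (r o) Y x)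
    rw [← hb, hT]
    refine (hT₀ o ⟨γ o s, hγ o s⟩ b).symm.trans ?_
    refine congrArg (T₀ o) (hb.trans ?_)
    rfl

end

end Choice

/-! ### Induction from the stabilizers -/

section Induction

open scoped ModuleCat

variable {G : Type*} {T : Type*} [Group G] [MulAction G T] (α : Cocycle G T)
  {r : MulAction.orbitRel.Quotient G T → T}
  {γ : ∀ o : MulAction.orbitRel.Quotient G T, o.orbit → G} (hγ : ∀ o s, γ o s • r o = s)

/-- The element `γ_t⁻¹ g γ_s` of the stabilizer of the representative, where `g s = t`. -/
def stabElement (g : G) {o : MulAction.orbitRel.Quotient G T} {s t : o.orbit} (h : g • s = t) :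
    MulAction.stabilizer G (r o) :=
  ⟨(γ o t)⁻¹ * (g * γ o s), by
    rw [MulAction.mem_stabilizer_iff, mul_smul, mul_smul, hγ, inv_smul_eq_iff, hγ, ← h]
    rfl⟩

/-- The scalar by which the action of `g` differs from that of `stabElement`. -/
def inducedScalar (γ : ∀ o : MulAction.orbitRel.Quotient G T, o.orbit → G) (g : G)
    {o : MulAction.orbitRel.Quotient G T} (s t : o.orbit) : ℂˣ :=
  (α.toFun g (γ o s) t)⁻¹ * α.toFun (γ o t) ((γ o t)⁻¹ * (g * γ o s)) t

lemma stabElement_mul (g h : G) {o : MulAction.orbitRel.Quotient G T} {s t p : o.orbit}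
    (hst : h • s = t) (htp : g • t = p) :
    stabElement hγ g htp * stabElement hγ h hst =
      stabElement hγ (g * h) (by rw [mul_smul, hst, htp] : (g * h) • s = p) := by
  apply Subtype.ext
  change (γ o p)⁻¹ * (g * γ o t) * ((γ o t)⁻¹ * (h * γ o s)) = (γ o p)⁻¹ * (g * h * γ o s)
  group

include hγ in
-- This is the scalar part of the composition law of the induced action. With `g' = γ_p⁻¹ g γ_t` and
-- `h' = γ_t⁻¹ h γ_s`, it combines the cocycle identities for the triples `(g, h, γ_s)`, `(g, γ_t,
-- h')` and `(γ_p, g', h')`, all at the point `p`.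
lemma inducedScalar_mul (g h : G) {o : MulAction.orbitRel.Quotient G T} {s t p : o.orbit}
    (htp : g • t = p) :
    inducedScalar α γ g t p * inducedScalar α γ h s t *
      (α.toFun ((γ o p)⁻¹ * (g * γ o t)) ((γ o t)⁻¹ * (h * γ o s)) (r o))⁻¹ =
      (α.toFun g h p)⁻¹ * inducedScalar α γ (g * h) s p := by
  have et : g⁻¹ • (p : T) = t := by
    rw [← htp]
    exact inv_smul_smul g (t : T)
  have ep : (γ o p)⁻¹ • (p : T) = r o := by rw [← hγ o p, inv_smul_smul]
  have c1 := α.cocycle g h (γ o s) p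
  have c2 := α.cocycle g (γ o t) ((γ o t)⁻¹ * (h * γ o s)) p
  have c3 := α.cocycle (γ o p) ((γ o p)⁻¹ * (g * γ o t)) ((γ o t)⁻¹ * (h * γ o s)) p
  have e4 : (γ o p)⁻¹ * (g * γ o t) * ((γ o t)⁻¹ * (h * γ o s)) =
      (γ o p)⁻¹ * (g * h * γ o s) := by group
  rw [et] at c1 c2
  rw [ep, e4, mul_inv_cancel_left] at c3
  rw [mul_inv_cancel_left] at c2
  unfold inducedScalar
  apply Units.ext
  have d1 := congrArg Units.val c1
  have d2 := congrArg Units.val c2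
  have d3 := congrArg Units.val c3
  push_cast at d1 d2 d3 ⊢
  field_simp
  linear_combination
    -(α.toFun (γ o p) ((γ o p)⁻¹ * (g * γ o t)) p * α.toFun (γ o t) ((γ o t)⁻¹ * (h * γ o s)) t : ℂ) * d1 +
    (α.toFun (γ o p) ((γ o p)⁻¹ * (g * γ o t)) p * α.toFun h (γ o s) t : ℂ) * d2 -
    (α.toFun g (γ o t) p * α.toFun h (γ o s) t : ℂ) * d3

variable [Finite G]

/-- The representation of `A_{α⁻¹}(G, O)` induced from representations of the twisted group
algebras of the stabilizers of representatives, as a projective family. -/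
def inducedFamily
    (W : ∀ o : MulAction.orbitRel.Quotient G T, ModuleCat.{w} (TwistedGroupAlg (α.inv.atPoint (r o)))) :
    ProjectiveFamily α (fun o (_ : o.orbit) => W o) where
  ψ o g s t h :=
    { toFun := fun x => ((inducedScalar α γ g s t : ℂˣ) : ℂ) •
        TwistedGroupAlg.u (α.inv.atPoint (r o)) (stabElement hγ g h) • x
      map_add' := fun x y => by simp
      map_smul' := fun z x => by
        rw [smul_comm (TwistedGroupAlg.u _ _) z x, smul_comm _ z]
        rfl }
  ψ_mul o g h s t p hst htp x := by
    change ((inducedScalar α γ g t p : ℂˣ) : ℂ) • TwistedGroupAlg.u (α.inv.atPoint (r o)) _ •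
      ((inducedScalar α γ h s t : ℂˣ) : ℂ) • TwistedGroupAlg.u (α.inv.atPoint (r o)) _ • x =
      (((α.toFun g h p)⁻¹ : ℂˣ) : ℂ) • ((inducedScalar α γ (g * h) s p : ℂˣ) : ℂ) •
        TwistedGroupAlg.u (α.inv.atPoint (r o)) _ • x
    rw [smul_comm (TwistedGroupAlg.u _ _) (_ : ℂ), ← mul_smul (TwistedGroupAlg.u _ _),
      TwistedGroupAlg.u_mul_u, stabElement_mul, smul_assoc, smul_smul (_ : ℂ), smul_smul (_ : ℂ),
      smul_smul (_ : ℂ), ← Units.val_mul, ← Units.val_mul, ← Units.val_mul,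
      ← inducedScalar_mul α hγ g h (s := s) htp]
    rfl
  ψ_one o s h x := by
    have h1 : stabElement hγ 1 h = 1 := Subtype.ext (by
      change (γ o s)⁻¹ * (1 * γ o s) = 1
      group)
    have h2 : (γ o s)⁻¹ * (1 * γ o s) = 1 := by group
    have ep : (γ o s)⁻¹ • (s : T) = r o := by rw [← hγ o s, inv_smul_smul]
    change ((inducedScalar α γ 1 s s : ℂˣ) : ℂ) •
      TwistedGroupAlg.u (α.inv.atPoint (r o)) _ • x = _
    rw [h1, TwistedGroupAlg.u_one, smul_assoc, one_smul, smul_smul (_ : ℂ), ← Units.val_mul,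
      inducedScalar, h2, α.one_left (γ o s), α.one_right (γ o s), ep]
    congr 2
    change (α.toFun 1 1 s)⁻¹ * α.toFun 1 1 (r o) * (α.toFun 1 1 (r o))⁻¹ = _
    rw [mul_inv_cancel_right]

/-- With `γ = 1` at the representative, the correcting scalar is `α(g,1)⁻¹ α(1,g)` at a point fixed
by `g`. Both values equal `α(1,1)` there, so they cancel. -/
lemma inducedFamily_ψ
    (W : ∀ o : MulAction.orbitRel.Quotient G T,
      ModuleCat.{w} (TwistedGroupAlg (α.inv.atPoint (r o))))
    {o : MulAction.orbitRel.Quotient G T} {s : o.orbit} (hs : (s : T) = r o) (hs1 : γ o s = 1)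
    (g : MulAction.stabilizer G (r o)) (h : (g : G) • s = s) (x : W o) :
    (inducedFamily α hγ W).ψ o g h x = TwistedGroupAlg.u (α.inv.atPoint (r o)) g • x := by
  change ((inducedScalar α γ g s s : ℂˣ) : ℂ) •
    TwistedGroupAlg.u (α.inv.atPoint (r o)) (stabElement hγ g h) • x = _
  have h1 : stabElement hγ (g : G) h = g := Subtype.ext (by
    change (γ o s)⁻¹ * (g * γ o s) = g
    rw [hs1]
    group)
  have h2 : inducedScalar α γ (g : G) s s = 1 := by
    have : (g : G)⁻¹ • (s : T) = s := by
      rw [hs]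
      exact (g⁻¹).2
    rw [inducedScalar, hs1, inv_one, one_mul, mul_one, α.one_left, α.one_right, this]
    exact inv_mul_cancel _
  rw [h1, h2, Units.val_one, one_smul]

end Induction

/-! ### The equivalence over the stabilizers. -/

namespace Choice

open scoped ModuleCat

section

variable {C : Type u} [Category.{v} C] [MonoidalCategory C] [Preadditive C]
  [MonoidalPreadditive C] {G : Type w} [Group G] {A : Mon C} {π : G →* Aut A} {c : Choice π}
  [Linear ℂ C] [MonoidalLinear ℂ C]
  {α : Cocycle G (SimpleClass π)} (hα : c.IsCocycle α) [Finite G]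
  {r : MulAction.orbitRel.Quotient G (SimpleClass π) → SimpleClass π}
  (hr : ∀ o, (Quotient.mk'' (r o) : MulAction.orbitRel.Quotient G (SimpleClass π)) = o)
  [IsIdempotentComplete C] (hA : IsSemisimpleAlg A) [HasFiniteBiproducts C]
include hr hA

/-- The representations `W` are induced to the orbits and realized by an object of `D`. At the
representative the induced action of the stabilizer is the given one, so the component there is `W
o` again. -/
lemma IsCocycle.exists_stabHomFunctor_iso (W : RepSum.{v} (fun o => StabAlg α (r o))) :
    ∃ Y : EquivMod π, ∀ o, Nonempty (hα.stabObj (r o) Y ≅ W.obj o) := by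
  obtain ⟨γ, hγ, hγ1⟩ := exists_transporter hr
  have hfd := W.property.1
  have hfin : {o : MulAction.orbitRel.Quotient G (SimpleClass π) |
      ∃ _ : o.orbit, Nontrivial (W.obj o)}.Finite :=
    W.property.2.subset fun o ⟨_, hs⟩ => hs
  obtain ⟨Y, i, hi⟩ := hα.realize hA hfin (inducedFamily α hγ W.obj)
  refine ⟨Y, fun o => ?_⟩
  let s : o.orbit := ⟨r o, MulAction.orbitRel.Quotient.mem_orbit.mpr (hr o)⟩
  let L : W.obj o ≃ₗ[ℂ] hα.stabObj (r o) Y := (i o s).trans (hα.stabEquiv (r o) Y).symm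
  have hL : ∀ x, hα.stabEquiv (r o) Y (L x) = i o s x := fun x =>
    (hα.stabEquiv (r o) Y).apply_symm_apply _
  have hLsmul := TwistedGroupAlg.map_smul_of_generators L.toLinearMap fun g x => by
    apply (hα.stabEquiv (r o) Y).injective
    have hg : (g : G) • s = s := Subtype.ext g.2
    rw [hα.stabEquiv_u, LinearEquiv.coe_coe, hL, hL,
      ← inducedFamily_ψ α hγ W.obj (s := s) rfl (hγ1 o s rfl) g hg, hi]
  exact ⟨(LinearEquiv.ofBijective
    ({ toFun := L, map_add' := L.map_add, map_smul' := hLsmul } :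
      W.obj o →ₗ[StabAlg α (r o)] hα.stabObj (r o) Y) L.bijective).toModuleIso.symm⟩

lemma IsCocycle.exists_stabEquivalence :
    ∃ E : EquivMod π ≌ RepSum.{v} (fun o => StabAlg α (r o)),
      E.functor.Additive ∧ E.functor.Linear ℂ ∧
      Nonempty (E.functor ⋙ (isDirectSum.{v} (fun o => StabAlg α (r o))).ι ≅
        hα.stabHomFunctor r) := by
  have := hα.stabHomFunctor_full hr hA
  have := hα.stabHomFunctor_faithful hr hA
  have hF := hα.stabHomFunctor_isDirectSum hr hA
  have : ((isDirectSum.{v} (fun o => StabAlg α (r o))).lift (hα.stabHomFunctor r)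
      hF).IsEquivalence := isEquivalence_repSumLift _ _ (hα.exists_stabHomFunctor_iso hr hA)
  refine ⟨((isDirectSum.{v} (fun o => StabAlg α (r o))).lift (hα.stabHomFunctor r)
      hF).asEquivalence, ?_, ?_, ⟨Iso.refl _⟩⟩
  · exact additive_repSumLift _ _ fun f g o => ModuleCat.hom_ext (LinearMap.ext fun a => by
      exact Preadditive.comp_add _ _ _ (a : c.X (r o) ⟶ _) f.hom g.hom)
  · exact linear_repSumLift _ _ fun {X Y} z f o => ModuleCat.hom_ext (LinearMap.ext fun a => by
      apply (hα.stabEquiv (r o) Y).injective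
      refine Eq.trans ?_ ((hα.stabEquiv (r o) Y).map_smul z _).symm
      exact Linear.comp_smul _ _ _ (hα.stabEquiv (r o) X a) z f.hom)

end

end Choice

end Orbifold

end

theorem mainTheorem7
    {C : Type u} [Category.{v} C] [Abelian C] [Linear ℂ C] [MonoidalCategory C]
    [MonoidalPreadditive C] [MonoidalLinear ℂ C] [BraidedCategory C] [RigidCategory C]
    [BalancedRigid C] (hC : IsSemisimpleCat C) (hone : Simple (𝟙_ C))
    {G : Type w} [Group G] [Finite G]
    (A : Mon C) [IsCommMonObj A.X] (hA : IsRigidAlgebra A) (hθ : theta A.X = 𝟙 A.X)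
    (π : G →* Aut A) (hπ : Function.Injective π) (hinv : InvariantsEqUnit π)
    (c : Choice π) :
    IsAbelian (EquivMod π) ∧
    ∃ (α : Cocycle G (SimpleClass π)) (hα : c.IsCocycle α),
      (∀ α' : Cocycle G (SimpleClass π), c.IsCocycle α' → α' = α) ∧
      (∃ (E : EquivMod π ≌ RepSum.{max u v} (Choice.OrbitAlg α))
        (i : ∀ (V : RepSum.{max u v} (Choice.OrbitAlg α))
          (o : MulAction.orbitRel.Quotient G (SimpleClass π)) (s : o.orbit),
          component (V.obj o) s →ₗ[ℂ] (c.X s ⟶ (E.inverse.obj V).M)),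
        E.functor.Additive ∧ E.functor.Linear ℂ ∧
        Nonempty (E.functor ⋙ (isDirectSum.{max u v} (Choice.OrbitAlg α)).ι ≅ hα.homFunctor) ∧
        (∀ V, IsSumTensor c α V.obj (E.inverse.obj V) (i V)) ∧
        (∀ (V W : RepSum.{max u v} (Choice.OrbitAlg α)) (m : V ⟶ W)
          (o : MulAction.orbitRel.Quotient G (SimpleClass π)) (s : o.orbit)
          (x : component (V.obj o) s),
          i V o s x ≫ (E.inverse.map m).hom = i W o s (componentMap (m.hom o) s x))) ∧
      (∀ r : MulAction.orbitRel.Quotient G (SimpleClass π) → SimpleClass π,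
        (∀ o, (Quotient.mk'' (r o) : MulAction.orbitRel.Quotient G (SimpleClass π)) = o) →
        ∃ E : EquivMod π ≌ RepSum.{v} (fun o => Choice.StabAlg α (r o)),
          E.functor.Additive ∧ E.functor.Linear ℂ ∧
          Nonempty (E.functor ⋙ (isDirectSum.{v} (fun o => Choice.StabAlg α (r o))).ι ≅
            hα.stabHomFunctor r)) := by
  obtain ⟨i, z, hi, hz0, hz⟩ := hA.exists_casimir hθ
  have := Abelian.hasFiniteBiproducts (C := C)
  -- The rigidity of `A` enters only here, through its Casimir element. The cocycle and both
  -- equivalences rest on the semisimplicity of `Rep A`.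
  have hS : IsSemisimpleAlg A :=
    ⟨finiteDimensional_mod_hom hC.finiteDimensional_hom, allRegular_mod hi hz0 hz hC.allRegular⟩
  obtain ⟨α, hα⟩ := c.exists_cocycle hS
  exact ⟨(EquivMod.allRegular hS.allRegular).isAbelian, α, hα, fun _ h => Choice.IsCocycle.unique c hα h,
    ⟨hα.homEquivalence hS, fun V o s => (hα.sumTensorEquiv hS V o s).toLinearMap,
      hα.homEquivalence_additive hS, hα.homEquivalence_linear hS, ⟨Iso.refl _⟩,
      hα.isSumTensor hS, fun _ _ m o s x => hα.sumTensorEquiv_naturality hS m o s x⟩,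
    fun _ hr => hα.exists_stabEquivalence hr hS⟩
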